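/- Let $G$ be a finite group with identity $e$, $K\subseteq G$ a subgroup, and $R\subseteq G$ a transversal: a set of representatives of the left cosets $gK$ with $e\in R$, so that every element of $G$ is uniquely of the form $rx$ with $r\in R$, $x\in K$. For $x\in K$ and $r,s\in R$ define $x\triangleright r,\ r\cdot s\in R$ and $x\triangleleft r,\ \tau(r,s)\in K$ by \[ xr=(x\triangleright r)(x\triangleleft r),\qquad rs=(r\cdot s)\,\tau(r,s). \] Let $\Xi(R,K)=\mathbb{C}(R)\rtimes\mathbb{C}K$ be the cross product algebra, generated by the algebra $\mathbb{C}(R)$ of functions on $R$, with basis the delta-functions $\delta_r$, and the group algebra $\mathbb{C}K$, with cross relations $x\,\delta_r=\delta_{x\triangleright r}\,x$. For a $\Xi(R,K)$-module $V$ write $|v|=r$ if $\delta_r.v=v$; this makes $V$ an $R$-graded vector space. A $G$-graded $K$-bimodule is a complex vector space $W=\bigoplus_{g\in G}W_g$ with commuting linear left and right actions of $K$ such that $|x.w.y|=x|w|y$. Morphisms are the degree-preserving bimodule maps. These form a monoidal category with $\otimes_{\mathbb{C}K}$ as tensor product, $|w\otimes_{\mathbb{C}K} w'|=|w||w'|$,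 and with unit object $\mathbb{C}K$. For a $\Xi(R,K)$-module $V$ let $F(V)=V\otimes\mathbb{C}K$ with \[ x.(v\otimes z).y=x.v\otimes (x\triangleleft|v|)\,zy,\qquad |v\otimes z|=|v|z\in G, \] for $v$ homogeneous and $x,y,z\in K$, and let $F(f)=f\otimes\mathrm{id}$ on morphisms. Then: 1. $F$ is an equivalence from the category of $\Xi(R,K)$-modules to the category of $G$-graded $K$-bimodules. 2. $\Xi(R,K)$ is a quasi-bialgebra with \[ \Delta x=\sum_{s\in R}x\delta_s\otimes (x\triangleleft s),\quad \Delta\delta_r=\sum_{s,t\in R,\ s\cdot t=r}\delta_s\otimes\delta_t,\quad \epsilon(x)=1,\quad \epsilon(\delta_r)=\delta_{r,e}, \] \[ \phi=\sum_{r,s\in R}\delta_r\otimes\delta_s\otimes\tau(r,s)^{-1},\qquad \phi^{-1}=\sum_{r,s\in R}\delta_r\otimes\delta_s\otimes\tau(r,s) \] for $x\in K$, $r\in R$. Here a quasi-bialgebra is a unital algebra $H$ with algebra maps $\Delta:H\to H\otimes H$ and $\epsilon:H\to\mathbb{C}$ and an invertible $\phi\in H^{\otimes3}$ such that $(\mathrm{id}\otimes\epsilon)\Delta=(\epsilon\otimes\mathrm{id})\Delta=\mathrm{id}$,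 $(\mathrm{id}\otimes\Delta)\Delta=\phi\,((\Delta\otimes\mathrm{id})\Delta(\ ))\,\phi^{-1}$, $(1\otimes\phi)\,(\mathrm{id}\otimes\Delta\otimes\mathrm{id})(\phi)\,(\phi\otimes1)=(\mathrm{id}\otimes\mathrm{id}\otimes\Delta)(\phi)\,(\Delta\otimes\mathrm{id}\otimes\mathrm{id})(\phi)$ and $(\mathrm{id}\otimes\epsilon\otimes\mathrm{id})(\phi)=1\otimes1$. 3. Give the category of $\Xi(R,K)$-modules the monoidal structure defined by this quasi-bialgebra: the tensor product $V\otimes V'$ over $\mathbb{C}$ with $h.(v\otimes v')=(\Delta h).(v\otimes v')$, the unit object $\mathbb{C}$ with action by $\epsilon$, and the associator $(V\otimes V')\otimes V''\to V\otimes(V'\otimes V'')$ given by the action of $\phi$. Then $F$ is a (strong) monoidal functor, hence a monoidal equivalence, with the natural isomorphisms \[ f_{V,V'}:F(V)\otimes_{\mathbb{C}K}F(V')\to F(V\otimes V'),\qquad f_{V,V'}\big((v\otimes 1)\otimes_{\mathbb{C}K}(v'\otimes z)\big)=(v\otimes v')\otimes\tau(|v|,|v'|)\,z \] for homogeneous $v\in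 V$, $v'\in V'$ and $z\in K$. -/

import Mathlib

open CategoryTheory
open scoped TensorProduct

universe u v w

noncomputable section

/-! ## Modules over a complex algebra -/

/-- A (left) module over a unital complex algebra `H`: a complex vector space together with a unital
algebra homomorphism from `H` to its linear endomorphisms. -/
structure AlgMod (H : Type v) [Ring H] [Algebra ℂ H] where
  carrier : Type w
  [addCommGroup : AddCommGroup carrier]
  [module : Module ℂ carrier]
  act : H →ₐ[ℂ] Module.End ℂ carrier

namespace AlgMod

attribute [instance] AlgMod.addCommGroup AlgMod.module

section

variable {H : Type v} [Ring H] [Algebra ℂ H]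

/-- `H`-linear maps. -/
@[ext]
structure Hom (V W : AlgMod.{v, w} H) where
  toLin : V.carrier →ₗ[ℂ] W.carrier
  comm : ∀ (h : H) (v : V.carrier), toLin (V.act h v) = W.act h (toLin v)

instance : Category (AlgMod.{v, w} H) where
  Hom V W := Hom V W
  id V := ⟨LinearMap.id, fun _ _ => rfl⟩
  comp f g := ⟨g.toLin ∘ₗ f.toLin, fun h v => by simp [f.comm, g.comm]⟩

@[ext]
theorem hom_ext {V W : AlgMod.{v, w} H} {f g : V ⟶ W} (h : f.toLin = g.toLin) : f = g :=
  Hom.ext h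

@[simp] theorem id_toLin (V : AlgMod.{v, w} H) : Hom.toLin (𝟙 V) = LinearMap.id := rfl

@[simp] theorem comp_toLin {U V W : AlgMod.{v, w} H} (f : U ⟶ V) (g : V ⟶ W) :
    (f ≫ g).toLin = g.toLin ∘ₗ f.toLin := rfl

/-- An isomorphism from an `H`-linear equivalence. -/
def isoOfEquiv {V W : AlgMod.{v, w} H} (e : V.carrier ≃ₗ[ℂ] W.carrier)
    (he : ∀ (h : H) (v : V.carrier), e (V.act h v) = W.act h (e v)) : V ≅ W where
  hom := ⟨e.toLinearMap, he⟩
  inv := ⟨e.symm.toLinearMap, fun h v => e.injective (by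
    change e (e.symm _) = e (V.act h (e.symm v)); simp [he])⟩
  hom_inv_id := hom_ext (by
    change e.symm.toLinearMap ∘ₗ e.toLinearMap = LinearMap.id; ext; simp)
  inv_hom_id := hom_ext (by
    change e.toLinearMap ∘ₗ e.symm.toLinearMap = LinearMap.id; ext; simp)

end

/-- The action of `A ⊗ B` on `V ⊗ W` given by actions of `A` on `V` and of `B` on `W`:
`(a ⊗ b).(v ⊗ w) = a.v ⊗ b.w`. -/
def tensorAct {A B : Type*} [Ring A] [Algebra ℂ A] [Ring B] [Algebra ℂ B] {V W : Type*}
    [AddCommGroup V] [Module ℂ V] [AddCommGroup W] [Module ℂ W]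
    (ρ : A →ₐ[ℂ] Module.End ℂ V) (σ : B →ₐ[ℂ] Module.End ℂ W) :
    A ⊗[ℂ] B →ₐ[ℂ] Module.End ℂ (V ⊗[ℂ] W) :=
  (Module.endTensorEndAlgHom (R := ℂ) (S := ℂ) (A := ℂ) (M := V) (N := W)).comp
    (Algebra.TensorProduct.map ρ σ)

section

variable {A B C A' B' : Type*} [Ring A] [Algebra ℂ A] [Ring B] [Algebra ℂ B] [Ring C] [Algebra ℂ C]
  [Ring A'] [Algebra ℂ A'] [Ring B'] [Algebra ℂ B']
  {V W U : Type*} [AddCommGroup V] [Module ℂ V] [AddCommGroup W] [Module ℂ W]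
  [AddCommGroup U] [Module ℂ U]

@[simp] theorem tensorAct_tmul (ρ : A →ₐ[ℂ] Module.End ℂ V) (σ : B →ₐ[ℂ] Module.End ℂ W)
    (a : A) (b : B) : tensorAct ρ σ (a ⊗ₜ b) = TensorProduct.map (ρ a) (σ b) := rfl

theorem tensorAct_comp (ρ : A →ₐ[ℂ] Module.End ℂ V) (σ : B →ₐ[ℂ] Module.End ℂ W)
    (f : A' →ₐ[ℂ] A) (g : B' →ₐ[ℂ] B) :
    tensorAct (ρ.comp f) (σ.comp g) = (tensorAct ρ σ).comp (Algebra.TensorProduct.map f g) := by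
  apply Algebra.TensorProduct.ext'
  intro a b
  simp

theorem tensorAct_assoc (ρ : A →ₐ[ℂ] Module.End ℂ V) (σ : B →ₐ[ℂ] Module.End ℂ W)
    (τ : C →ₐ[ℂ] Module.End ℂ U) (t : (A ⊗[ℂ] B) ⊗[ℂ] C) :
    (TensorProduct.assoc ℂ V W U).toLinearMap ∘ₗ tensorAct (tensorAct ρ σ) τ t =
      tensorAct ρ (tensorAct σ τ) (Algebra.TensorProduct.assoc ℂ ℂ ℂ A B C t) ∘ₗ
        (TensorProduct.assoc ℂ V W U).toLinearMap := by
  induction t with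
  | zero => simp
  | add x y hx hy => simp only [map_add, LinearMap.comp_add, LinearMap.add_comp, hx, hy]
  | tmul s c =>
    induction s with
    | zero => simp
    | add x y hx hy =>
      simp only [map_add, LinearMap.comp_add, LinearMap.add_comp, hx, hy, TensorProduct.add_tmul]
    | tmul a b =>
      ext v w u
      simp

theorem id_map_comp_tensorAct {W' : Type*} [AddCommGroup W'] [Module ℂ W']
    (ρ : A →ₐ[ℂ] Module.End ℂ V) (σ : B →ₐ[ℂ] Module.End ℂ W) (σ' : B' →ₐ[ℂ] Module.End ℂ W')
    (f : B →ₐ[ℂ] B') (g : W →ₗ[ℂ] W') (h : ∀ b, g ∘ₗ σ b = σ' (f b) ∘ₗ g) (t : A ⊗[ℂ] B) :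
    TensorProduct.map LinearMap.id g ∘ₗ tensorAct ρ σ t =
      tensorAct ρ σ' (Algebra.TensorProduct.map (AlgHom.id ℂ A) f t) ∘ₗ
        TensorProduct.map LinearMap.id g := by
  induction t with
  | zero => simp
  | add x y hx hy => simp only [map_add, LinearMap.comp_add, LinearMap.add_comp, hx, hy]
  | tmul a b =>
    ext v w
    have := LinearMap.congr_fun (h b) w
    simp only [LinearMap.comp_apply] at this
    simp [this]

theorem map_comp_tensorAct (ρ : A →ₐ[ℂ] Module.End ℂ V) (σ : B →ₐ[ℂ] Module.End ℂ W)
    {V' W' : Type*} [AddCommGroup V'] [Module ℂ V'] [AddCommGroup W'] [Module ℂ W']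
    (ρ' : A →ₐ[ℂ] Module.End ℂ V') (σ' : B →ₐ[ℂ] Module.End ℂ W')
    (f : V →ₗ[ℂ] V') (g : W →ₗ[ℂ] W')
    (hf : ∀ a v, f (ρ a v) = ρ' a (f v)) (hg : ∀ b w, g (σ b w) = σ' b (g w)) (t : A ⊗[ℂ] B) :
    TensorProduct.map f g ∘ₗ tensorAct ρ σ t = tensorAct ρ' σ' t ∘ₗ TensorProduct.map f g := by
  induction t with
  | zero => simp
  | add x y hx hy => simp only [map_add, LinearMap.comp_add, LinearMap.add_comp, hx, hy]
  | tmul a b =>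
    ext v w
    simp [hf, hg]

end

end AlgMod

/-! ## Quasi-bialgebras and the monoidal category of their modules -/

/-- A quasi-bialgebra structure on a unital complex algebra `H`: algebra homomorphisms
`Δ : H → H ⊗ H` and `ε : H → ℂ` with `ε` a counit for `Δ`, and an invertible
`φ ∈ H ⊗ H ⊗ H` with `(id ⊗ Δ)Δ(h) = φ ((Δ ⊗ id)Δ(h)) φ⁻¹`,
`(1 ⊗ φ) (id ⊗ Δ ⊗ id)(φ) (φ ⊗ 1) = (id ⊗ id ⊗ Δ)(φ) (Δ ⊗ id ⊗ id)(φ)` and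
`(id ⊗ ε ⊗ id)(φ) = 1 ⊗ 1`. Iterated tensor products are bracketed to the right. -/
class QuasiBialgebra (H : Type v) [Ring H] [Algebra ℂ H] where
  comul : H →ₐ[ℂ] H ⊗[ℂ] H
  counit : H →ₐ[ℂ] ℂ
  assoc : (H ⊗[ℂ] (H ⊗[ℂ] H))ˣ
  counit_left : ∀ h : H, Algebra.TensorProduct.lid ℂ H
    (Algebra.TensorProduct.map counit (AlgHom.id ℂ H) (comul h)) = h
  counit_right : ∀ h : H, Algebra.TensorProduct.rid ℂ ℂ H
    (Algebra.TensorProduct.map (AlgHom.id ℂ H) counit (comul h)) = h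
  coassoc : ∀ h : H, Algebra.TensorProduct.map (AlgHom.id ℂ H) comul (comul h) =
    (assoc : H ⊗[ℂ] (H ⊗[ℂ] H)) *
      Algebra.TensorProduct.assoc ℂ ℂ ℂ H H H
        (Algebra.TensorProduct.map comul (AlgHom.id ℂ H) (comul h)) *
      ((assoc⁻¹ : (H ⊗[ℂ] (H ⊗[ℂ] H))ˣ) : H ⊗[ℂ] (H ⊗[ℂ] H))
  cocycle :
    ((1 : H) ⊗ₜ[ℂ] (assoc : H ⊗[ℂ] (H ⊗[ℂ] H)) : H ⊗[ℂ] (H ⊗[ℂ] (H ⊗[ℂ] H))) *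
      Algebra.TensorProduct.map (AlgHom.id ℂ H)
        ((Algebra.TensorProduct.assoc ℂ ℂ ℂ H H H).toAlgHom.comp
          (Algebra.TensorProduct.map comul (AlgHom.id ℂ H)))
        (assoc : H ⊗[ℂ] (H ⊗[ℂ] H)) *
      Algebra.TensorProduct.map (AlgHom.id ℂ H)
        (Algebra.TensorProduct.assoc ℂ ℂ ℂ H H H).toAlgHom
        (Algebra.TensorProduct.assoc ℂ ℂ ℂ H (H ⊗[ℂ] H) H
          ((assoc : H ⊗[ℂ] (H ⊗[ℂ] H)) ⊗ₜ[ℂ] (1 : H))) =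
    Algebra.TensorProduct.map (AlgHom.id ℂ H)
        (Algebra.TensorProduct.map (AlgHom.id ℂ H) comul)
        (assoc : H ⊗[ℂ] (H ⊗[ℂ] H)) *
      Algebra.TensorProduct.assoc ℂ ℂ ℂ H H (H ⊗[ℂ] H)
        (Algebra.TensorProduct.map comul (AlgHom.id ℂ (H ⊗[ℂ] H))
          (assoc : H ⊗[ℂ] (H ⊗[ℂ] H)))
  counit_mid : Algebra.TensorProduct.map (AlgHom.id ℂ H)
      ((Algebra.TensorProduct.lid ℂ H).toAlgHom.comp
        (Algebra.TensorProduct.map counit (AlgHom.id ℂ H)))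
      (assoc : H ⊗[ℂ] (H ⊗[ℂ] H)) = 1

namespace AlgMod

variable {H : Type v} [Ring H] [Algebra ℂ H]

/-- The underlying linear equivalence of the left unitor, `c ⊗ v ↦ c v`. -/
def lidEquiv (V : AlgMod.{v, w} H) : ULift.{w} ℂ ⊗[ℂ] V.carrier ≃ₗ[ℂ] V.carrier :=
  (TensorProduct.congr ULift.moduleEquiv (LinearEquiv.refl ℂ V.carrier)).trans
      (TensorProduct.lid ℂ V.carrier)

/-- The underlying linear equivalence of the right unitor, `v ⊗ c ↦ c v`. -/
def ridEquiv (V : AlgMod.{v, w} H) : V.carrier ⊗[ℂ] ULift.{w} ℂ ≃ₗ[ℂ] V.carrier :=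
  (TensorProduct.congr (LinearEquiv.refl ℂ V.carrier) ULift.moduleEquiv).trans
      (TensorProduct.rid ℂ V.carrier)

@[simp] theorem lidEquiv_tmul (V : AlgMod.{v, w} H) (c : ULift.{w} ℂ) (v : V.carrier) :
    lidEquiv V (c ⊗ₜ v) = c.down • v := rfl

@[simp] theorem ridEquiv_tmul (V : AlgMod.{v, w} H) (c : ULift.{w} ℂ) (v : V.carrier) :
    ridEquiv V (v ⊗ₜ c) = c.down • v := rfl

variable [Q : QuasiBialgebra H]

/-- `V ⊗ W` with the action `h.(v ⊗ w) = Δ(h).(v ⊗ w)`. -/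
def tensor (V W : AlgMod.{v, w} H) : AlgMod.{v, w} H where
  carrier := V.carrier ⊗[ℂ] W.carrier
  act := (tensorAct V.act W.act).comp Q.comul

variable (H) in
/-- The action `h.c = ε(h) c` on a copy of `ℂ` in the appropriate universe. -/
def trivialAct : H →ₐ[ℂ] Module.End ℂ (ULift.{w} ℂ) :=
  (Algebra.ofId ℂ (Module.End ℂ (ULift.{w} ℂ))).comp Q.counit

variable (H) in
/-- The unit object: `ℂ` with `H` acting through the counit. -/
def trivial : AlgMod.{v, w} H where
  carrier := ULift.{w} ℂ
  act := trivialAct H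

/-- The tensor product of module maps. -/
def tensorMap {V V' W W' : AlgMod.{v, w} H} (f : V ⟶ V') (g : W ⟶ W') :
    tensor V W ⟶ tensor V' W' where
  toLin := TensorProduct.map f.toLin g.toLin
  comm h t := LinearMap.congr_fun
    (map_comp_tensorAct V.act W.act V'.act W'.act f.toLin g.toLin f.comm g.comm (Q.comul h)) t

@[simp] theorem tensorMap_toLin {V V' W W' : AlgMod.{v, w} H} (f : V ⟶ V') (g : W ⟶ W') :
    (tensorMap f g).toLin = TensorProduct.map f.toLin g.toLin := rfl

/-- The action of `H ⊗ H ⊗ H` on `U ⊗ (V ⊗ W)`. -/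
def act₃ (U V W : AlgMod.{v, w} H) : H ⊗[ℂ] (H ⊗[ℂ] H) →ₐ[ℂ]
    Module.End ℂ (U.carrier ⊗[ℂ] (V.carrier ⊗[ℂ] W.carrier)) :=
  tensorAct U.act (tensorAct V.act W.act)

/-- The underlying linear equivalence of the associator,
`(u ⊗ v) ⊗ w ↦ φ¹.u ⊗ (φ².v ⊗ φ³.w)`. -/
def assocEquiv (U V W : AlgMod.{v, w} H) : (U.carrier ⊗[ℂ] V.carrier) ⊗[ℂ] W.carrier ≃ₗ[ℂ]
    U.carrier ⊗[ℂ] (V.carrier ⊗[ℂ] W.carrier) :=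
  (TensorProduct.assoc ℂ U.carrier V.carrier W.carrier).trans
    (LinearMap.GeneralLinearGroup.generalLinearEquiv ℂ _ (Units.map (act₃ U V W) Q.assoc))

theorem assocEquiv_toLin (U V W : AlgMod.{v, w} H) : (assocEquiv U V W).toLinearMap =
    act₃ U V W Q.assoc ∘ₗ (TensorProduct.assoc ℂ U.carrier V.carrier W.carrier).toLinearMap := rfl

theorem assocEquiv_comm (U V W : AlgMod.{v, w} H) (h : H) :
    (assocEquiv U V W).toLinearMap ∘ₗ
        tensorAct ((tensorAct U.act V.act).comp Q.comul) W.act (Q.comul h) =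
      tensorAct U.act ((tensorAct V.act W.act).comp Q.comul) (Q.comul h) ∘ₗ
        (assocEquiv U V W).toLinearMap := by
  have h1 : tensorAct ((tensorAct U.act V.act).comp Q.comul) W.act (Q.comul h) =
      tensorAct (tensorAct U.act V.act) W.act
        (Algebra.TensorProduct.map Q.comul (AlgHom.id ℂ H) (Q.comul h)) :=
    DFunLike.congr_fun (tensorAct_comp (tensorAct U.act V.act) W.act Q.comul (AlgHom.id ℂ H)) _
  have h2 : tensorAct U.act ((tensorAct V.act W.act).comp Q.comul) (Q.comul h) = act₃ U V W
      (Algebra.TensorProduct.map (AlgHom.id ℂ H) Q.comul (Q.comul h)) :=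
    DFunLike.congr_fun (tensorAct_comp U.act (tensorAct V.act W.act) (AlgHom.id ℂ H) Q.comul) _
  have h3 : act₃ U V W (((Q.assoc⁻¹ : (H ⊗[ℂ] (H ⊗[ℂ] H))ˣ) : H ⊗[ℂ] (H ⊗[ℂ] H))) ∘ₗ
      act₃ U V W Q.assoc = LinearMap.id := by
    rw [← Module.End.mul_eq_comp, ← map_mul, Units.inv_mul, map_one]; rfl
  rw [h2, Q.coassoc h, assocEquiv_toLin, h1, LinearMap.comp_assoc, tensorAct_assoc, map_mul,
    map_mul, Module.End.mul_eq_comp, Module.End.mul_eq_comp, LinearMap.comp_assoc,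
    LinearMap.comp_assoc]
  rw [← LinearMap.comp_assoc _ (act₃ U V W (Q.assoc : H ⊗[ℂ] (H ⊗[ℂ] H))), h3, LinearMap.id_comp]
  rfl

/-- The associator. -/
def associator (U V W : AlgMod.{v, w} H) :
    tensor (tensor U V) W ≅ tensor U (tensor V W) :=
  isoOfEquiv (V := tensor (tensor U V) W) (W := tensor U (tensor V W)) (assocEquiv U V W)
    fun h t => LinearMap.congr_fun (assocEquiv_comm U V W h) t

theorem associator_toLin (U V W : AlgMod.{v, w} H) : (associator U V W).hom.toLin =
    act₃ U V W Q.assoc ∘ₗ (TensorProduct.assoc ℂ U.carrier V.carrier W.carrier).toLinearMap := rfl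

theorem lidEquiv_act (V : AlgMod.{v, w} H) (t : H ⊗[ℂ] H) :
    (lidEquiv V).toLinearMap ∘ₗ tensorAct (trivialAct.{v, w} H) V.act t =
      V.act (Algebra.TensorProduct.lid ℂ H
        (Algebra.TensorProduct.map Q.counit (AlgHom.id ℂ H) t)) ∘ₗ (lidEquiv V).toLinearMap := by
  induction t with
  | zero => simp
  | add x y hx hy => simp only [map_add, LinearMap.comp_add, LinearMap.add_comp, hx, hy]
  | tmul a b =>
    apply TensorProduct.ext'
    intro c v
    change (Q.counit a * c.down) • V.act b v = V.act (Q.counit a • b) (c.down • v)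
    rw [map_smul, map_smul, LinearMap.smul_apply, mul_smul, smul_comm]

theorem ridEquiv_act (V : AlgMod.{v, w} H) (t : H ⊗[ℂ] H) :
    (ridEquiv V).toLinearMap ∘ₗ tensorAct V.act (trivialAct.{v, w} H) t =
      V.act (Algebra.TensorProduct.rid ℂ ℂ H
        (Algebra.TensorProduct.map (AlgHom.id ℂ H) Q.counit t)) ∘ₗ (ridEquiv V).toLinearMap := by
  induction t with
  | zero => simp
  | add x y hx hy => simp only [map_add, LinearMap.comp_add, LinearMap.add_comp, hx, hy]
  | tmul a b =>
    apply TensorProduct.ext'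
    intro v c
    change (Q.counit b * c.down) • V.act a v = V.act (Q.counit b • a) (c.down • v)
    rw [map_smul, map_smul, LinearMap.smul_apply, mul_smul, smul_comm]

/-- The left unitor. -/
def leftUnitor (V : AlgMod.{v, w} H) : tensor (trivial H) V ≅ V :=
  isoOfEquiv (V := tensor (trivial H) V) (W := V) (lidEquiv V) fun h t => by
    have := LinearMap.congr_fun (lidEquiv_act V (Q.comul h)) t
    rwa [Q.counit_left h] at this

/-- The right unitor. -/
def rightUnitor (V : AlgMod.{v, w} H) : tensor V (trivial H) ≅ V :=
  isoOfEquiv (V := tensor V (trivial H)) (W := V) (ridEquiv V) fun h t => by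
    have := LinearMap.congr_fun (ridEquiv_act V (Q.comul h)) t
    rwa [Q.counit_right h] at this

theorem pentagon_aux (U V W X : AlgMod.{v, w} H) :
    TensorProduct.map LinearMap.id (act₃ V W X Q.assoc ∘ₗ
        (TensorProduct.assoc ℂ V.carrier W.carrier X.carrier).toLinearMap) ∘ₗ
      ((tensorAct U.act (tensorAct ((tensorAct V.act W.act).comp Q.comul) X.act) Q.assoc ∘ₗ
        (TensorProduct.assoc ℂ U.carrier (V.carrier ⊗[ℂ] W.carrier) X.carrier).toLinearMap) ∘ₗ
      TensorProduct.map (act₃ U V W Q.assoc ∘ₗ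
        (TensorProduct.assoc ℂ U.carrier V.carrier W.carrier).toLinearMap) LinearMap.id) =
    (tensorAct U.act (tensorAct V.act ((tensorAct W.act X.act).comp Q.comul)) Q.assoc ∘ₗ
      (TensorProduct.assoc ℂ U.carrier V.carrier (W.carrier ⊗[ℂ] X.carrier)).toLinearMap) ∘ₗ
      (tensorAct ((tensorAct U.act V.act).comp Q.comul) (tensorAct W.act X.act) Q.assoc ∘ₗ
      (TensorProduct.assoc ℂ (U.carrier ⊗[ℂ] V.carrier) W.carrier X.carrier).toLinearMap) := by
  have e1 : TensorProduct.map LinearMap.id (act₃ V W X Q.assoc ∘ₗ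
        (TensorProduct.assoc ℂ V.carrier W.carrier X.carrier).toLinearMap) =
      tensorAct U.act (act₃ V W X) ((1 : H) ⊗ₜ[ℂ] (Q.assoc : H ⊗[ℂ] (H ⊗[ℂ] H))) ∘ₗ
        TensorProduct.map LinearMap.id
          (TensorProduct.assoc ℂ V.carrier W.carrier X.carrier).toLinearMap := by
    rw [tensorAct_tmul, ← TensorProduct.map_comp, map_one]; rfl
  have e2 : TensorProduct.map (act₃ U V W Q.assoc ∘ₗ
        (TensorProduct.assoc ℂ U.carrier V.carrier W.carrier).toLinearMap) LinearMap.id =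
      tensorAct (act₃ U V W) X.act ((Q.assoc : H ⊗[ℂ] (H ⊗[ℂ] H)) ⊗ₜ[ℂ] (1 : H)) ∘ₗ
        TensorProduct.map (TensorProduct.assoc ℂ U.carrier V.carrier W.carrier).toLinearMap
          (LinearMap.id (R := ℂ) (M := X.carrier)) := by
    rw [tensorAct_tmul, ← TensorProduct.map_comp, map_one]; rfl
  have e3 := id_map_comp_tensorAct U.act
    (tensorAct ((tensorAct V.act W.act).comp Q.comul) X.act) (act₃ V W X)
    ((Algebra.TensorProduct.assoc ℂ ℂ ℂ H H H).toAlgHom.comp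
          (Algebra.TensorProduct.map Q.comul (AlgHom.id ℂ H)))
    (TensorProduct.assoc ℂ V.carrier W.carrier X.carrier).toLinearMap (fun b => by
      have := tensorAct_comp (tensorAct V.act W.act) X.act Q.comul (AlgHom.id ℂ H)
      rw [AlgHom.comp_id] at this
      rw [this]
      exact tensorAct_assoc V.act W.act X.act _) Q.assoc
  have e4 := tensorAct_assoc U.act (tensorAct V.act W.act) X.act
    ((Q.assoc : H ⊗[ℂ] (H ⊗[ℂ] H)) ⊗ₜ[ℂ] (1 : H))
  have e5 := id_map_comp_tensorAct U.act
    (tensorAct (tensorAct V.act W.act) X.act) (act₃ V W X)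
    (Algebra.TensorProduct.assoc ℂ ℂ ℂ H H H).toAlgHom
    (TensorProduct.assoc ℂ V.carrier W.carrier X.carrier).toLinearMap
    (tensorAct_assoc V.act W.act X.act)
    (Algebra.TensorProduct.assoc ℂ ℂ ℂ H (H ⊗[ℂ] H) H
          ((Q.assoc : H ⊗[ℂ] (H ⊗[ℂ] H)) ⊗ₜ[ℂ] (1 : H)))
  have e6 : tensorAct U.act (tensorAct V.act ((tensorAct W.act X.act).comp Q.comul)) =
      (tensorAct U.act (act₃ V W X)).comp (Algebra.TensorProduct.map (AlgHom.id ℂ H)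
        (Algebra.TensorProduct.map (AlgHom.id ℂ H) Q.comul)) := by
    rw [act₃, ← tensorAct_comp, ← tensorAct_comp, AlgHom.comp_id, AlgHom.comp_id]
  have e7 : tensorAct ((tensorAct U.act V.act).comp Q.comul) (tensorAct W.act X.act) =
      (tensorAct (tensorAct U.act V.act) (tensorAct W.act X.act)).comp
        (Algebra.TensorProduct.map Q.comul (AlgHom.id ℂ (H ⊗[ℂ] H))) := by
    rw [← tensorAct_comp, AlgHom.comp_id]
  have e8 := tensorAct_assoc U.act V.act (tensorAct W.act X.act)
    (Algebra.TensorProduct.map Q.comul (AlgHom.id ℂ (H ⊗[ℂ] H)) (Q.assoc : H ⊗[ℂ] (H ⊗[ℂ] H)))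
  have e9 : TensorProduct.map LinearMap.id
          (TensorProduct.assoc ℂ V.carrier W.carrier X.carrier).toLinearMap ∘ₗ
      (TensorProduct.assoc ℂ U.carrier (V.carrier ⊗[ℂ] W.carrier) X.carrier).toLinearMap ∘ₗ
      TensorProduct.map (TensorProduct.assoc ℂ U.carrier V.carrier W.carrier).toLinearMap
          (LinearMap.id (R := ℂ) (M := X.carrier)) =
      (TensorProduct.assoc ℂ U.carrier V.carrier (W.carrier ⊗[ℂ] X.carrier)).toLinearMap ∘ₗ
      (TensorProduct.assoc ℂ (U.carrier ⊗[ℂ] V.carrier) W.carrier X.carrier).toLinearMap := by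
    ext u v w x; rfl
  have key := congrArg (tensorAct U.act (act₃ V W X)) Q.cocycle
  rw [map_mul, map_mul, map_mul, Module.End.mul_eq_comp, Module.End.mul_eq_comp,
    Module.End.mul_eq_comp] at key
  rw [e1, e2, e6, e7]
  refine LinearMap.ext fun t => ?_
  replace e3 := fun t => LinearMap.congr_fun e3 t
  replace e4 := fun t => LinearMap.congr_fun e4 t
  replace e5 := fun t => LinearMap.congr_fun e5 t
  replace e8 := fun t => LinearMap.congr_fun e8 t
  replace e9 := LinearMap.congr_fun e9 t
  replace key := fun t => LinearMap.congr_fun key t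
  simp only [LinearMap.comp_apply, AlgHom.comp_apply, act₃] at e3 e4 e5 e8 e9 key ⊢
  rw [e3, e4, e5, e9, key, e8]

instance : MonoidalCategoryStruct (AlgMod.{v, w} H) where
  tensorObj := tensor
  whiskerLeft V _ _ f := tensorMap (𝟙 V) f
  whiskerRight f V := tensorMap f (𝟙 V)
  tensorHom f g := tensorMap f g
  tensorUnit := trivial H
  associator := associator
  leftUnitor := leftUnitor
  rightUnitor := rightUnitor

instance : MonoidalCategory (AlgMod.{v, w} H) where
  tensorHom_def f g := hom_ext (by
    change TensorProduct.map f.toLin g.toLin =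
      TensorProduct.map LinearMap.id g.toLin ∘ₗ TensorProduct.map f.toLin LinearMap.id
    rw [← TensorProduct.map_comp]; rfl)
  id_tensorHom_id V W := hom_ext TensorProduct.map_id
  tensorHom_comp_tensorHom f₁ f₂ g₁ g₂ := hom_ext
    (TensorProduct.map_comp _ _ _ _).symm
  whiskerLeft_id V W := hom_ext TensorProduct.map_id
  id_whiskerRight V W := hom_ext TensorProduct.map_id
  associator_naturality {U V W U' V' W'} f g h := hom_ext (by
    change (act₃ U' V' W' Q.assoc ∘ₗ
        (TensorProduct.assoc ℂ U'.carrier V'.carrier W'.carrier).toLinearMap) ∘ₗ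
        TensorProduct.map (TensorProduct.map f.toLin g.toLin) h.toLin =
      TensorProduct.map f.toLin (TensorProduct.map g.toLin h.toLin) ∘ₗ act₃ U V W Q.assoc ∘ₗ
        (TensorProduct.assoc ℂ U.carrier V.carrier W.carrier).toLinearMap
    have h1 := map_comp_tensorAct U.act (tensorAct V.act W.act) U'.act (tensorAct V'.act W'.act)
      f.toLin (TensorProduct.map g.toLin h.toLin) f.comm (fun b t => LinearMap.congr_fun
        (map_comp_tensorAct V.act W.act V'.act W'.act g.toLin h.toLin g.comm h.comm b) t) Q.assoc
    simp only [act₃]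
    rw [← LinearMap.comp_assoc _ _ (TensorProduct.map f.toLin _), h1, LinearMap.comp_assoc,
      LinearMap.comp_assoc]
    congr 1
    ext u v w; rfl)
  leftUnitor_naturality {V W} f := hom_ext (by
    change (lidEquiv W).toLinearMap ∘ₗ TensorProduct.map LinearMap.id f.toLin =
      f.toLin ∘ₗ (lidEquiv V).toLinearMap
    refine TensorProduct.ext' fun c v => ?_
    simp)
  rightUnitor_naturality {V W} f := hom_ext (by
    change (ridEquiv W).toLinearMap ∘ₗ TensorProduct.map f.toLin LinearMap.id =
      f.toLin ∘ₗ (ridEquiv V).toLinearMap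
    refine TensorProduct.ext' fun c v => ?_
    simp)
  pentagon U V W X := hom_ext (pentagon_aux U V W X)
  triangle V W := hom_ext (by
    change TensorProduct.map LinearMap.id (lidEquiv W).toLinearMap ∘ₗ
        (tensorAct V.act (tensorAct (trivialAct.{v, w} H) W.act) Q.assoc ∘ₗ
        (TensorProduct.assoc ℂ V.carrier (ULift.{w} ℂ) W.carrier).toLinearMap) =
      TensorProduct.map (ridEquiv V).toLinearMap LinearMap.id
    have h1 := id_map_comp_tensorAct V.act (tensorAct (trivialAct.{v, w} H) W.act) W.act
      ((Algebra.TensorProduct.lid ℂ H).toAlgHom.comp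
        (Algebra.TensorProduct.map Q.counit (AlgHom.id ℂ H)))
      (lidEquiv W).toLinearMap (lidEquiv_act W) Q.assoc
    rw [Q.counit_mid, map_one] at h1
    rw [← LinearMap.comp_assoc, h1]
    ext v c w
    simp [TensorProduct.smul_tmul])

end AlgMod

/-! ## Graded bimodules -/

/-- A `G`-graded `K`-bimodule, for `K` a subgroup of `G`: a complex vector space with commuting
linear left and right actions of `K` which is the internal direct sum of subspaces `deg g`, `g ∈ G`,
such that `|x.w.y| = x|w|y`. -/
structure GrBimod {G : Type u} [Group G] (K : Subgroup G) where
  carrier : Type w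
  [addCommGroup : AddCommGroup carrier]
  [module : Module ℂ carrier]
  left : K →* Module.End ℂ carrier
  right : Kᵐᵒᵖ →* Module.End ℂ carrier
  left_right : ∀ (x y : K) (m : carrier),
    left x (right (MulOpposite.op y) m) = right (MulOpposite.op y) (left x m)
  deg : G → Submodule ℂ carrier
  deg_indep : iSupIndep deg
  deg_iSup : ⨆ g, deg g = ⊤
  left_deg : ∀ (x : K) (g : G) (m : carrier), m ∈ deg g → left x m ∈ deg (x * g)
  right_deg : ∀ (y : K) (g : G) (m : carrier), m ∈ deg g →
    right (MulOpposite.op y) m ∈ deg (g * y)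

namespace GrBimod

attribute [instance] GrBimod.addCommGroup GrBimod.module

open MulOpposite (op)

variable {G : Type u} [Group G] {K : Subgroup G}

/-- Maps of graded bimodules: linear maps that commute with both actions and preserve the degree. -/
@[ext]
structure Hom (M N : GrBimod.{u, w} K) where
  toLin : M.carrier →ₗ[ℂ] N.carrier
  comm_left : ∀ (x : K) (m : M.carrier), toLin (M.left x m) = N.left x (toLin m)
  comm_right : ∀ (y : K) (m : M.carrier), toLin (M.right (op y) m) = N.right (op y) (toLin m)
  map_deg : ∀ (g : G) (m : M.carrier), m ∈ M.deg g → toLin m ∈ N.deg g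

instance : Category (GrBimod.{u, w} K) where
  Hom M N := Hom M N
  id M := ⟨LinearMap.id, fun _ _ => rfl, fun _ _ => rfl, fun _ _ h => h⟩
  comp f g := ⟨g.toLin ∘ₗ f.toLin, fun x m => by simp [f.comm_left, g.comm_left],
    fun y m => by simp [f.comm_right, g.comm_right],
    fun d m h => g.map_deg d _ (f.map_deg d m h)⟩

@[ext]
theorem hom_ext {M N : GrBimod.{u, w} K} {f g : M ⟶ N} (h : f.toLin = g.toLin) : f = g :=
  Hom.ext h

@[simp] theorem id_toLin (M : GrBimod.{u, w} K) : Hom.toLin (𝟙 M) = LinearMap.id := rfl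

@[simp] theorem comp_toLin {L M N : GrBimod.{u, w} K} (f : L ⟶ M) (g : M ⟶ N) :
    (f ≫ g).toLin = g.toLin ∘ₗ f.toLin := rfl

/-- Induction on homogeneous elements. -/
theorem deg_induction (M : GrBimod.{u, w} K) {p : M.carrier → Prop}
    (hom : ∀ g m, m ∈ M.deg g → p m) (add : ∀ m n, p m → p n → p (m + n)) (m : M.carrier) : p m := by
  have hm : m ∈ ⨆ g, M.deg g := by rw [M.deg_iSup]; trivial
  exact Submodule.iSup_induction M.deg (motive := p) hm hom (hom 1 0 (zero_mem _)) add

open Classical in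
/-- The projection to the component of degree `g`. -/
theorem exists_proj (M : GrBimod.{u, w} K) : ∃ P : G → Module.End ℂ M.carrier,
    ∀ g h m, m ∈ M.deg h → P g m = if g = h then m else 0 := by
  have hint := DirectSum.isInternal_submodule_of_iSupIndep_of_iSup_eq_top M.deg_indep M.deg_iSup
  let e := LinearEquiv.ofBijective (DirectSum.coeLinearMap M.deg) hint
  refine ⟨fun g => (M.deg g).subtype ∘ₗ DirectSum.component ℂ G (fun g => M.deg g) g ∘ₗ
    e.symm.toLinearMap, fun g h m hm => ?_⟩
  have : e.symm m = DirectSum.lof ℂ G (fun g => M.deg g) h ⟨m, hm⟩ := by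
    rw [LinearEquiv.symm_apply_eq]
    exact (DirectSum.coeLinearMap_lof (A := M.deg) h ⟨m, hm⟩).symm
  simp only [LinearMap.comp_apply, LinearEquiv.coe_coe, this, DirectSum.component.of]
  split_ifs with h1 h2 h2
  · subst h1; rfl
  · exact absurd h1.symm h2
  · exact absurd h2.symm h1
  · simp

open Classical in
theorem indep_of_proj {I : Type*} {E : Type*} [AddCommGroup E] [Module ℂ E]
    (A : I → Submodule ℂ E) (P : I → Module.End ℂ E) (h : ∀ g h m, m ∈ A h → P g m = if g = h then m else 0) :
    iSupIndep A := by
  intro g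
  rw [Submodule.disjoint_def]
  intro m hm hm'
  have h1 : (⨆ j, ⨆ (_ : j ≠ g), A j) ≤ LinearMap.ker (P g) := by
    refine iSup_le fun j => iSup_le fun hj m hm => ?_
    rw [LinearMap.mem_ker, h g j m hm, if_neg hj.symm]
  have h2 := h1 hm'
  rw [LinearMap.mem_ker, h g g m hm, if_pos rfl] at h2
  exact h2

/-- An isomorphism from a linear equivalence compatible with all structures. -/
def isoOfEquiv {M N : GrBimod.{u, w} K} (e : M.carrier ≃ₗ[ℂ] N.carrier)
    (hl : ∀ (x : K) (m : M.carrier), e (M.left x m) = N.left x (e m))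
    (hr : ∀ (y : K) (m : M.carrier), e (M.right (op y) m) = N.right (op y) (e m))
    (hd : ∀ (g : G) (m : M.carrier), m ∈ M.deg g → e m ∈ N.deg g) : M ≅ N where
  hom := ⟨e.toLinearMap, hl, hr, hd⟩
  inv := ⟨e.symm.toLinearMap,
    fun x m => e.injective (by change e (e.symm _) = e (M.left x (e.symm m)); simp [hl]),
    fun x m => e.injective (by change e (e.symm _) = e (M.right (op x) (e.symm m)); simp [hr]),
    fun g n hn => by
      classical
      obtain ⟨P, hP⟩ := M.exists_proj
      obtain ⟨P', hP'⟩ := N.exists_proj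
      have h1 : ∀ m, e (P g m) = P' g (e m) := by
        intro m
        induction m using M.deg_induction with
        | hom h m hm => rw [hP g h m hm, hP' g h _ (hd h m hm)]; split_ifs <;> simp
        | add a b ha hb => simp [ha, hb]
      have h2 : ∀ m, P g m ∈ M.deg g := by
        intro m
        induction m using M.deg_induction with
        | hom h m hm =>
          rw [hP g h m hm]
          split_ifs with h
          · subst h; exact hm
          · exact zero_mem _
        | add a b ha hb => rw [map_add]; exact add_mem ha hb
      have h3 : P g (e.symm n) = e.symm n := e.injective (by
        rw [h1, LinearEquiv.apply_symm_apply, hP' g g n hn, if_pos rfl])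
      change e.symm n ∈ M.deg g
      rw [← h3]
      exact h2 _⟩
  hom_inv_id := hom_ext (by
    change e.symm.toLinearMap ∘ₗ e.toLinearMap = LinearMap.id; ext; simp)
  inv_hom_id := hom_ext (by
    change e.toLinearMap ∘ₗ e.symm.toLinearMap = LinearMap.id; ext; simp)

/-! ### The tensor product over the group algebra -/

/-- The subspace of `M ⊗ N` spanned by the elements `m.x ⊗ n - m ⊗ x.n`. -/
def balanced (M N : GrBimod.{u, w} K) : Submodule ℂ (M.carrier ⊗[ℂ] N.carrier) :=
  Submodule.span ℂ {t | ∃ (m : M.carrier) (x : K) (n : N.carrier),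
    t = M.right (op x) m ⊗ₜ[ℂ] n - m ⊗ₜ[ℂ] N.left x n}

/-- The vector space `M ⊗_{ℂK} N`. -/
abbrev BTensor (M N : GrBimod.{u, w} K) : Type w := (M.carrier ⊗[ℂ] N.carrier) ⧸ balanced M N

/-- The bilinear map `(m, n) ↦ m ⊗_{ℂK} n`. -/
def bt (M N : GrBimod.{u, w} K) : M.carrier →ₗ[ℂ] N.carrier →ₗ[ℂ] BTensor M N :=
  (TensorProduct.mk ℂ M.carrier N.carrier).compr₂ (balanced M N).mkQ

theorem bt_balanced (M N : GrBimod.{u, w} K) (m : M.carrier) (x : K) (n : N.carrier) :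
    bt M N (M.right (op x) m) n = bt M N m (N.left x n) :=
  (Submodule.Quotient.eq _).2 (Submodule.subset_span ⟨m, x, n, rfl⟩)

/-- The linear map out of `M ⊗_{ℂK} N` given by a balanced bilinear map. -/
def btLift {M N : GrBimod.{u, w} K} {E : Type*} [AddCommGroup E] [Module ℂ E]
    (f : M.carrier →ₗ[ℂ] N.carrier →ₗ[ℂ] E)
    (hf : ∀ m x n, f (M.right (op x) m) n = f m (N.left x n)) : BTensor M N →ₗ[ℂ] E :=
  (balanced M N).liftQ (TensorProduct.lift f) (by
    rw [balanced, Submodule.span_le]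
    rintro _ ⟨m, x, n, rfl⟩
    simp [hf])

@[simp] theorem btLift_bt {M N : GrBimod.{u, w} K} {E : Type*} [AddCommGroup E] [Module ℂ E]
    (f : M.carrier →ₗ[ℂ] N.carrier →ₗ[ℂ] E)
    (hf : ∀ m x n, f (M.right (op x) m) n = f m (N.left x n)) (m : M.carrier) (n : N.carrier) :
    btLift f hf (bt M N m n) = f m n := by
  simp [btLift, bt]

theorem bt_induction {M N : GrBimod.{u, w} K} {p : BTensor M N → Prop}
    (h : ∀ m n, p (bt M N m n)) (add : ∀ s t, p s → p t → p (s + t)) (t : BTensor M N) : p t := by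
  induction t using Submodule.Quotient.induction_on with
  | H t =>
    induction t with
    | zero => simpa using h 0 0
    | tmul m n => exact h m n
    | add s t hs ht => exact add _ _ hs ht

theorem bt_ext {M N : GrBimod.{u, w} K} {E : Type*} [AddCommGroup E] [Module ℂ E]
    {f g : BTensor M N →ₗ[ℂ] E} (h : ∀ m n, f (bt M N m n) = g (bt M N m n)) : f = g := by
  refine LinearMap.ext fun t => ?_
  induction t using bt_induction with
  | h m n => exact h m n
  | add s t hs ht => rw [map_add, map_add, hs, ht]

/-- The linear map `m ⊗ n ↦ f m ⊗ g n`. -/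
def btMap {M N M' N' : GrBimod.{u, w} K} (f : M.carrier →ₗ[ℂ] M'.carrier)
    (g : N.carrier →ₗ[ℂ] N'.carrier)
    (hf : ∀ x m, f (M.right (op x) m) = M'.right (op x) (f m))
    (hg : ∀ x n, g (N.left x n) = N'.left x (g n)) : BTensor M N →ₗ[ℂ] BTensor M' N' :=
  btLift ((bt M' N').compl₁₂ f g) fun m x n => by simp [hf, hg, bt_balanced]

@[simp] theorem btMap_bt {M N M' N' : GrBimod.{u, w} K} (f : M.carrier →ₗ[ℂ] M'.carrier)
    (g : N.carrier →ₗ[ℂ] N'.carrier)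
    (hf : ∀ x m, f (M.right (op x) m) = M'.right (op x) (f m))
    (hg : ∀ x n, g (N.left x n) = N'.left x (g n)) (m : M.carrier) (n : N.carrier) :
    btMap f g hf hg (bt M N m n) = bt M' N' (f m) (g n) := by
  simp [btMap]

/-- The subspace of `M ⊗_{ℂK} N` of degree `g`: it is spanned by the `m ⊗ n` with `m`, `n`
homogeneous and `|m||n| = g`. -/
def btDeg (M N : GrBimod.{u, w} K) (g : G) : Submodule ℂ (BTensor M N) :=
  Submodule.span ℂ {t | ∃ (a b : G) (m : M.carrier) (n : N.carrier),
    a * b = g ∧ m ∈ M.deg a ∧ n ∈ N.deg b ∧ t = bt M N m n}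

theorem bt_mem_btDeg {M N : GrBimod.{u, w} K} {a b : G} {m : M.carrier} {n : N.carrier}
    (hm : m ∈ M.deg a) (hn : n ∈ N.deg b) : bt M N m n ∈ btDeg M N (a * b) :=
  Submodule.subset_span ⟨a, b, m, n, rfl, hm, hn, rfl⟩

theorem btDeg_le {M N : GrBimod.{u, w} K} {g : G} {S : Submodule ℂ (BTensor M N)}
    (h : ∀ a b m n, a * b = g → m ∈ M.deg a → n ∈ N.deg b → bt M N m n ∈ S) :
    btDeg M N g ≤ S := by
  rw [btDeg, Submodule.span_le]
  rintro _ ⟨a, b, m, n, hg, hm, hn, rfl⟩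
  exact h a b m n hg hm hn

theorem btDeg_iSup (M N : GrBimod.{u, w} K) : ⨆ g, btDeg M N g = ⊤ := by
  refine Submodule.eq_top_iff'.2 fun t => ?_
  induction t using bt_induction with
  | add s t hs ht => exact add_mem hs ht
  | h m n =>
    induction m using M.deg_induction with
    | add a b ha hb => rw [map_add]; exact add_mem ha hb
    | hom g m hm =>
      induction n using N.deg_induction with
      | add a b ha hb => rw [map_add]; exact add_mem ha hb
      | hom h n hn => exact Submodule.mem_iSup_of_mem (g * h) (bt_mem_btDeg hm hn)

theorem btDeg_indep [Finite G] (M N : GrBimod.{u, w} K) : iSupIndep (btDeg M N) := by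
  classical
  cases nonempty_fintype G
  obtain ⟨P, hP⟩ := M.exists_proj
  obtain ⟨P', hP'⟩ := N.exists_proj
  have hPr : ∀ (a : G) (x : K) (m : M.carrier),
      P a (M.right (op x) m) = M.right (op x) (P (a * (x : G)⁻¹) m) := by
    intro a x m
    induction m using M.deg_induction with
    | add s t hs ht => simp [hs, ht]
    | hom h m hm =>
      rw [hP _ _ _ (M.right_deg x h m hm), hP _ _ _ hm]
      by_cases hh : a = h * x
      · simp [hh]
      · rw [if_neg hh, if_neg (fun h' => hh (by rw [← h']; group)), map_zero]
  have hPl : ∀ (a : G) (x : K) (n : N.carrier),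
      P' (x * a) (N.left x n) = N.left x (P' a n) := by
    intro a x n
    induction n using N.deg_induction with
    | add s t hs ht => simp [hs, ht]
    | hom h n hn =>
      rw [hP' _ _ _ (N.left_deg x h n hn), hP' _ _ _ hn]
      by_cases hh : a = h
      · simp [hh]
      · rw [if_neg hh, if_neg (fun h' => hh (mul_left_cancel h')), map_zero]
  have hbal : ∀ (g : G) (m : M.carrier) (x : K) (n : N.carrier),
      (∑ a : G, (bt M N).compl₁₂ (P a) (P' (a⁻¹ * g))) (M.right (op x) m) n =
        (∑ a : G, (bt M N).compl₁₂ (P a) (P' (a⁻¹ * g))) m (N.left x n) := by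
    intro g m x n
    simp only [LinearMap.sum_apply, LinearMap.compl₁₂_apply]
    rw [← Equiv.sum_comp (Equiv.mulRight (x : G)⁻¹)
      (fun a => bt M N (P a m) (P' (a⁻¹ * g) (N.left x n)))]
    refine Finset.sum_congr rfl fun a _ => ?_
    have h1 : (a * (x : G)⁻¹)⁻¹ * g = x * (a⁻¹ * g) := by group
    rw [Equiv.coe_mulRight, h1, hPr, bt_balanced, hPl]
  refine indep_of_proj _ (fun g => btLift _ (hbal g)) fun g h t ht => ?_
  induction ht using Submodule.span_induction with
  | zero => simp
  | add s t _ _ hs ht => rw [map_add, hs, ht]; split_ifs <;> simp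
  | smul c t _ ht => rw [map_smul, ht]; split_ifs <;> simp
  | mem t ht =>
    obtain ⟨a, b, m, n, rfl, hm, hn, rfl⟩ := ht
    rw [btLift_bt]
    simp only [LinearMap.sum_apply, LinearMap.compl₁₂_apply]
    rw [Finset.sum_eq_single a]
    · rw [hP _ _ _ hm, hP' _ _ _ hn, if_pos rfl]
      by_cases hg : g = a * b
      · simp [hg]
      · rw [if_neg hg, if_neg (fun h' => hg (by rw [← h']; group)), map_zero]
    · intro c _ hc
      rw [hP _ _ _ hm, if_neg hc, map_zero, LinearMap.zero_apply]
    · simp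

/-- The linear map `m ⊗ n ↦ x.m ⊗ n`. -/
def btLeft (M N : GrBimod.{u, w} K) : K →* Module.End ℂ (BTensor M N) where
  toFun x := btMap (M.left x) LinearMap.id (fun y m => M.left_right x y m) fun _ _ => rfl
  map_one' := bt_ext fun m n => by simp
  map_mul' x y := bt_ext fun m n => by simp

/-- The linear map `m ⊗ n ↦ m ⊗ n.y`. -/
def btRight (M N : GrBimod.{u, w} K) : Kᵐᵒᵖ →* Module.End ℂ (BTensor M N) where
  toFun y := btMap (M := M) (N := N) (M' := M) (N' := N) LinearMap.id (N.right (op y.unop))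
    (fun _ _ => rfl) fun x n => (N.left_right x y.unop n).symm
  map_one' := bt_ext fun m n => by simp
  map_mul' x y := bt_ext fun m n => by simp

@[simp] theorem btLeft_bt (M N : GrBimod.{u, w} K) (x : K) (m : M.carrier) (n : N.carrier) :
    btLeft M N x (bt M N m n) = bt M N (M.left x m) n := by simp [btLeft]

@[simp] theorem btRight_bt (M N : GrBimod.{u, w} K) (y : Kᵐᵒᵖ) (m : M.carrier) (n : N.carrier) :
    btRight M N y (bt M N m n) = bt M N m (N.right y n) := by simp [btRight]

/-! ### The unit object -/

variable (K) in
/-- The unit object: the group algebra `ℂK`, with basis `K`, with left and right multiplication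
and `|z| = z` for `z ∈ K`. -/
abbrev unit : GrBimod.{u, u} K where
  carrier := K →₀ ℂ
  left :=
    { toFun x := Finsupp.lmapDomain ℂ ℂ (x * ·)
      map_one' := by ext; simp
      map_mul' x y := by ext; simp [mul_assoc] }
  right :=
    { toFun y := Finsupp.lmapDomain ℂ ℂ (· * y.unop)
      map_one' := by ext; simp
      map_mul' x y := by ext; simp [mul_assoc] }
  left_right x y m := by
    induction m using Finsupp.induction_linear with
    | zero => simp
    | add f g hf hg => simp only [map_add, hf, hg]
    | single a b => simp [mul_assoc]
  deg g := Submodule.span ℂ {t | ∃ z : K, (z : G) = g ∧ t = Finsupp.single z 1}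
  deg_indep := by
    classical
    refine indep_of_proj _ (fun g => Finsupp.lsum ℂ fun z : K =>
      if g = z then Finsupp.lsingle z else 0) fun g h t ht => ?_
    induction ht using Submodule.span_induction with
    | zero => simp
    | add s t _ _ hs ht => rw [map_add, hs, ht]; split_ifs <;> simp
    | smul c t _ ht => rw [map_smul, ht]; split_ifs <;> simp
    | mem t ht =>
      obtain ⟨z, rfl, rfl⟩ := ht
      by_cases hg : g = z <;> simp [hg]
  deg_iSup := by
    refine Submodule.eq_top_iff'.2 fun t => ?_
    induction t using Finsupp.induction_linear with
    | zero => exact zero_mem _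
    | add f g hf hg => exact add_mem hf hg
    | single z c =>
      have : Finsupp.single z c = c • Finsupp.single z (1 : ℂ) := by simp
      rw [this]
      exact Submodule.smul_mem _ c (Submodule.mem_iSup_of_mem (z : G)
        (Submodule.subset_span ⟨z, rfl, rfl⟩))
  left_deg x g m hm := by
    refine (Submodule.span_le (p := Submodule.comap (Finsupp.lmapDomain ℂ ℂ (x * ·))
      (Submodule.span ℂ {t | ∃ z : K, (z : G) = x * g ∧ t = Finsupp.single z 1}))).2 ?_ hm
    rintro _ ⟨z, rfl, rfl⟩
    exact Submodule.subset_span ⟨x * z, by simp, by simp⟩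
  right_deg y g m hm := by
    refine (Submodule.span_le (p := Submodule.comap (Finsupp.lmapDomain ℂ ℂ (· * y))
      (Submodule.span ℂ {t | ∃ z : K, (z : G) = g * y ∧ t = Finsupp.single z 1}))).2 ?_ hm
    rintro _ ⟨z, rfl, rfl⟩
    exact Submodule.subset_span ⟨z * y, by simp, by simp⟩

theorem unit_ext {E : Type*} [AddCommGroup E] [Module ℂ E] {f g : (K →₀ ℂ) →ₗ[ℂ] E}
    (h : ∀ z, f (Finsupp.single z 1) = g (Finsupp.single z 1)) : f = g :=
  Finsupp.lhom_ext' fun z => LinearMap.ext_ring (h z)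

theorem lid_balanced (M : GrBimod.{u, u} K) (z : (unit K).carrier) (x : K) (m : M.carrier) :
    Finsupp.linearCombination ℂ (fun x => M.left x) ((unit K).right (op x) z) m =
      Finsupp.linearCombination ℂ (fun x => M.left x) z (M.left x m) := by
  have : (Finsupp.linearCombination ℂ fun x => M.left x).flip m ∘ₗ (unit K).right (op x) =
      (Finsupp.linearCombination ℂ fun x => M.left x).flip (M.left x m) :=
    unit_ext fun z => by simp
  exact LinearMap.congr_fun this z

theorem rid_balanced (M : GrBimod.{u, u} K) (m : M.carrier) (x : K) (z : (unit K).carrier) :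
    (Finsupp.linearCombination ℂ fun x => M.right (op x)).flip (M.right (op x) m) z =
      (Finsupp.linearCombination ℂ fun x => M.right (op x)).flip m ((unit K).left x z) := by
  have : (Finsupp.linearCombination ℂ fun x => M.right (op x)).flip (M.right (op x) m) =
      (Finsupp.linearCombination ℂ fun x => M.right (op x)).flip m ∘ₗ (unit K).left x :=
    unit_ext fun z => by simp
  exact LinearMap.congr_fun this z

/-- The linear map `z ⊗ m ↦ z.m`. -/
def lidFwd (M : GrBimod.{u, u} K) : BTensor (unit K) M →ₗ[ℂ] M.carrier :=
  btLift (M := unit K) (Finsupp.linearCombination ℂ fun x => M.left x) (lid_balanced M)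

/-- The linear map `m ⊗ z ↦ m.z`. -/
def ridFwd (M : GrBimod.{u, u} K) : BTensor M (unit K) →ₗ[ℂ] M.carrier :=
  btLift (N := unit K) (Finsupp.linearCombination ℂ fun x => M.right (op x)).flip (rid_balanced M)

@[simp] theorem lidFwd_bt (M : GrBimod.{u, u} K) (z : K) (m : M.carrier) :
    lidFwd M (bt (unit K) M (Finsupp.single z 1) m) = M.left z m := by
  rw [lidFwd, btLift_bt]; simp

@[simp] theorem ridFwd_bt (M : GrBimod.{u, u} K) (z : K) (m : M.carrier) :
    ridFwd M (bt M (unit K) m (Finsupp.single z 1)) = M.right (op z) m := by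
  rw [ridFwd, btLift_bt]; simp

variable (K) in
theorem unit_left (x z : K) :
    (unit K).left x (Finsupp.single z 1) = Finsupp.single (x * z) (1 : ℂ) := by simp

variable (K) in
theorem unit_right (x z : K) :
    (unit K).right (op x) (Finsupp.single z 1) = Finsupp.single (z * x) (1 : ℂ) := by simp

theorem bt_ext_unit_left {M : GrBimod.{u, u} K} {E : Type*} [AddCommGroup E] [Module ℂ E]
    {f g : BTensor (unit K) M →ₗ[ℂ] E} (h : ∀ z m,
      f (bt (unit K) M (Finsupp.single z 1) m) = g (bt (unit K) M (Finsupp.single z 1) m)) :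
    f = g :=
  bt_ext fun z m => LinearMap.congr_fun (f := f ∘ₗ (bt (unit K) M).flip m)
    (g := g ∘ₗ (bt (unit K) M).flip m) (unit_ext fun z => h z m) z

theorem bt_ext_unit_right {M : GrBimod.{u, u} K} {E : Type*} [AddCommGroup E] [Module ℂ E]
    {f g : BTensor M (unit K) →ₗ[ℂ] E} (h : ∀ z m,
      f (bt M (unit K) m (Finsupp.single z 1)) = g (bt M (unit K) m (Finsupp.single z 1))) :
    f = g :=
  bt_ext fun m z => LinearMap.congr_fun (f := f ∘ₗ bt M (unit K) m)
    (g := g ∘ₗ bt M (unit K) m) (unit_ext fun z => h z m) z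

/-! ### The monoidal structure -/

variable [Finite G]

/-- The tensor product `M ⊗_{ℂK} N` of graded bimodules, with `x.(m ⊗ n).y = x.m ⊗ n.y` and
`|m ⊗ n| = |m||n|`. -/
abbrev tensor (M N : GrBimod.{u, w} K) : GrBimod.{u, w} K where
  carrier := BTensor M N
  left := btLeft M N
  right := btRight M N
  left_right x y t := by
    induction t using bt_induction with
    | h m n => simp
    | add s t hs ht => simp only [map_add, hs, ht]
  deg := btDeg M N
  deg_indep := btDeg_indep M N
  deg_iSup := btDeg_iSup M N
  left_deg x g t ht := by
    refine (btDeg_le (S := (btDeg M N (x * g)).comap (btLeft M N x)) ?_) ht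
    rintro a b m n rfl hm hn
    rw [Submodule.mem_comap, btLeft_bt, ← mul_assoc]
    exact bt_mem_btDeg (M.left_deg x a m hm) hn
  right_deg y g t ht := by
    refine (btDeg_le (S := (btDeg M N (g * y)).comap (btRight M N (op y))) ?_) ht
    rintro a b m n rfl hm hn
    rw [Submodule.mem_comap, btRight_bt, mul_assoc]
    exact bt_mem_btDeg hm (N.right_deg y b n hn)

/-- The tensor product of maps of graded bimodules. -/
def tensorMap {M N M' N' : GrBimod.{u, w} K} (f : M ⟶ M') (g : N ⟶ N') :
    tensor M N ⟶ tensor M' N' where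
  toLin := btMap f.toLin g.toLin f.comm_right g.comm_left
  comm_left x t := by
    change btMap _ _ _ _ (btLeft M N x t) = btLeft M' N' x (btMap _ _ _ _ t)
    induction t using bt_induction with
    | h m n => simp [f.comm_left]
    | add s t hs ht => simp only [map_add, hs, ht]
  comm_right y t := by
    change btMap _ _ _ _ (btRight M N (op y) t) = btRight M' N' (op y) (btMap _ _ _ _ t)
    induction t using bt_induction with
    | h m n => simp [g.comm_right]
    | add s t hs ht => simp only [map_add, hs, ht]
  map_deg d t ht := by
    refine (btDeg_le (S := (btDeg M' N' d).comap
      (btMap f.toLin g.toLin f.comm_right g.comm_left)) ?_) ht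
    rintro a b m n rfl hm hn
    rw [Submodule.mem_comap, btMap_bt]
    exact bt_mem_btDeg (f.map_deg a m hm) (g.map_deg b n hn)

/-- The linear map `l ⊗ m ↦ (n ↦ l ⊗ (m ⊗ n))`. -/
def assocFwdAux (L M N : GrBimod.{u, w} K) :
    BTensor L M →ₗ[ℂ] N.carrier →ₗ[ℂ] BTensor L (tensor M N) :=
  btLift ((LinearMap.llcomp ℂ N.carrier (BTensor M N) (BTensor L (tensor M N))).compl₁₂
      (bt L (tensor M N)) (bt M N))
    fun l x m => LinearMap.ext fun n => by
      change bt L (tensor M N) (L.right (op x) l) (bt M N m n) =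
        bt L (tensor M N) l (bt M N (M.left x m) n)
      rw [bt_balanced, ← btLeft_bt]

@[simp] theorem assocFwdAux_bt (L M N : GrBimod.{u, w} K) (l : L.carrier) (m : M.carrier)
    (n : N.carrier) : assocFwdAux L M N (bt L M l m) n = bt L (tensor M N) l (bt M N m n) := by
  rw [assocFwdAux, btLift_bt]; rfl

/-- The linear map `(l ⊗ m) ⊗ n ↦ l ⊗ (m ⊗ n)`. -/
def assocFwd (L M N : GrBimod.{u, w} K) :
    BTensor (tensor L M) N →ₗ[ℂ] BTensor L (tensor M N) :=
  btLift (assocFwdAux L M N) fun t x n => by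
    induction t using bt_induction with
    | add s t hs ht => simp only [map_add, LinearMap.add_apply, hs, ht]
    | h l m => simp [bt_balanced]

@[simp] theorem assocFwd_bt (L M N : GrBimod.{u, w} K) (l : L.carrier) (m : M.carrier)
    (n : N.carrier) :
    assocFwd L M N (bt (tensor L M) N (bt L M l m) n) = bt L (tensor M N) l (bt M N m n) := by
  rw [assocFwd, btLift_bt, assocFwdAux_bt]

/-- The linear map `m ⊗ n ↦ (l ↦ (l ⊗ m) ⊗ n)`. -/
def assocBwdAux (L M N : GrBimod.{u, w} K) :
    BTensor M N →ₗ[ℂ] L.carrier →ₗ[ℂ] BTensor (tensor L M) N :=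
  btLift ((LinearMap.llcomp ℂ L.carrier (BTensor L M) (BTensor (tensor L M) N)).compl₁₂
      (bt (tensor L M) N).flip (bt L M).flip).flip
    fun m x n => LinearMap.ext fun l => by
      change bt (tensor L M) N (bt L M l (M.right (op x) m)) n =
        bt (tensor L M) N (bt L M l m) (N.left x n)
      rw [← bt_balanced, ← btRight_bt]

@[simp] theorem assocBwdAux_bt (L M N : GrBimod.{u, w} K) (l : L.carrier) (m : M.carrier)
    (n : N.carrier) : assocBwdAux L M N (bt M N m n) l = bt (tensor L M) N (bt L M l m) n := by
  rw [assocBwdAux, btLift_bt]; rfl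

/-- The linear map `l ⊗ (m ⊗ n) ↦ (l ⊗ m) ⊗ n`. -/
def assocBwd (L M N : GrBimod.{u, w} K) :
    BTensor L (tensor M N) →ₗ[ℂ] BTensor (tensor L M) N :=
  btLift (assocBwdAux L M N).flip fun l x t => by
    induction t using bt_induction with
    | add s t hs ht => simp only [map_add, hs, ht]
    | h m n => simp [bt_balanced]

@[simp] theorem assocBwd_bt (L M N : GrBimod.{u, w} K) (l : L.carrier) (m : M.carrier)
    (n : N.carrier) :
    assocBwd L M N (bt L (tensor M N) l (bt M N m n)) = bt (tensor L M) N (bt L M l m) n := by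
  rw [assocBwd, btLift_bt, LinearMap.flip_apply, assocBwdAux_bt]

theorem bt_ext₃ {L M N : GrBimod.{u, w} K} {E : Type*} [AddCommGroup E] [Module ℂ E]
    {f g : BTensor (tensor L M) N →ₗ[ℂ] E} (h : ∀ l m n,
      f (bt (tensor L M) N (bt L M l m) n) = g (bt (tensor L M) N (bt L M l m) n)) : f = g :=
  bt_ext fun t n => by
    induction t using bt_induction with
    | h l m => exact h l m n
    | add s t hs ht => simp only [map_add, LinearMap.add_apply, hs, ht]

theorem bt_ext₃' {L M N : GrBimod.{u, w} K} {E : Type*} [AddCommGroup E] [Module ℂ E]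
    {f g : BTensor L (tensor M N) →ₗ[ℂ] E} (h : ∀ l m n,
      f (bt L (tensor M N) l (bt M N m n)) = g (bt L (tensor M N) l (bt M N m n))) : f = g :=
  bt_ext fun l t => by
    induction t using bt_induction with
    | h m n => exact h l m n
    | add s t hs ht => simp only [map_add, hs, ht]

/-- The associator `(l ⊗ m) ⊗ n ↦ l ⊗ (m ⊗ n)` as a linear equivalence. -/
def assocEquiv (L M N : GrBimod.{u, w} K) :
    BTensor (tensor L M) N ≃ₗ[ℂ] BTensor L (tensor M N) :=
  LinearEquiv.ofLinearMap (assocFwd L M N) (assocBwd L M N)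
    (bt_ext₃' fun _ _ _ => by
      rw [LinearMap.comp_apply, assocBwd_bt, assocFwd_bt, LinearMap.id_apply])
    (bt_ext₃ fun _ _ _ => by
      rw [LinearMap.comp_apply, assocFwd_bt, assocBwd_bt, LinearMap.id_apply])

theorem assocEquiv_apply (L M N : GrBimod.{u, w} K) (t : BTensor (tensor L M) N) :
    assocEquiv L M N t = assocFwd L M N t := rfl

/-- The associator. -/
def associator (L M N : GrBimod.{u, w} K) :
    tensor (tensor L M) N ≅ tensor L (tensor M N) :=
  isoOfEquiv (M := tensor (tensor L M) N) (N := tensor L (tensor M N)) (assocEquiv L M N)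
    (fun x t => by
      have : assocFwd L M N ∘ₗ btLeft (tensor L M) N x = btLeft L (tensor M N) x ∘ₗ assocFwd L M N :=
        bt_ext₃ fun _ _ _ => by
          rw [LinearMap.comp_apply, LinearMap.comp_apply, btLeft_bt, assocFwd_bt, btLeft_bt,
            btLeft_bt, assocFwd_bt]
      exact LinearMap.congr_fun this t)
    (fun x t => by
      have : assocFwd L M N ∘ₗ btRight (tensor L M) N (op x) =
          btRight L (tensor M N) (op x) ∘ₗ assocFwd L M N :=
        bt_ext₃ fun _ _ _ => by
          rw [LinearMap.comp_apply, LinearMap.comp_apply, btRight_bt, assocFwd_bt, assocFwd_bt,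
            btRight_bt, btRight_bt]
      exact LinearMap.congr_fun this t)
    (fun g t ht => by
      refine (btDeg_le (S := (btDeg L (tensor M N) g).comap (assocFwd L M N)) ?_) ht
      rintro a b s n rfl hs hn
      refine (btDeg_le (S := (btDeg L (tensor M N) (a * b)).comap
        (assocFwd L M N ∘ₗ (bt (tensor L M) N).flip n)) ?_) hs
      rintro c d l m rfl hl hm
      rw [Submodule.mem_comap, LinearMap.comp_apply, LinearMap.flip_apply, assocFwd_bt, mul_assoc]
      exact bt_mem_btDeg (N := tensor M N) hl (bt_mem_btDeg hm hn))

/-- The left unitor `z ⊗ m ↦ z.m`. -/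
def leftUnitor (M : GrBimod.{u, u} K) : tensor (unit K) M ≅ M :=
  isoOfEquiv (M := tensor (unit K) M) (N := M)
    (LinearEquiv.ofLinearMap (lidFwd M) (bt (unit K) M (Finsupp.single 1 1))
      (LinearMap.ext fun m => by
        rw [LinearMap.comp_apply, lidFwd_bt, map_one]; rfl)
      (bt_ext_unit_left fun z m => by
        rw [LinearMap.comp_apply, lidFwd_bt, ← bt_balanced, unit_right, one_mul]; rfl))
    (fun x t => by
      have : lidFwd M ∘ₗ btLeft (unit K) M x = M.left x ∘ₗ lidFwd M :=
        bt_ext_unit_left fun z m => by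
          rw [LinearMap.comp_apply, LinearMap.comp_apply, btLeft_bt, unit_left, lidFwd_bt,
            lidFwd_bt, map_mul]; rfl
      exact LinearMap.congr_fun this t)
    (fun x t => by
      have : lidFwd M ∘ₗ btRight (unit K) M (op x) = M.right (op x) ∘ₗ lidFwd M :=
        bt_ext_unit_left fun z m => by
          rw [LinearMap.comp_apply, LinearMap.comp_apply, btRight_bt, lidFwd_bt, lidFwd_bt,
            M.left_right]
      exact LinearMap.congr_fun this t)
    (fun g t ht => by
      refine (btDeg_le (S := (M.deg g).comap (lidFwd M)) ?_) ht
      rintro a b s m rfl hs hm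
      refine (Submodule.span_le (p := (M.deg (a * b)).comap
        (lidFwd M ∘ₗ (bt (unit K) M).flip m))).2 ?_ hs
      rintro _ ⟨z, rfl, rfl⟩
      change lidFwd M (bt (unit K) M _ m) ∈ M.deg (z * b)
      rw [lidFwd_bt]
      exact M.left_deg z b m hm)

/-- The right unitor `m ⊗ z ↦ m.z`. -/
def rightUnitor (M : GrBimod.{u, u} K) : tensor M (unit K) ≅ M :=
  isoOfEquiv (M := tensor M (unit K)) (N := M)
    (LinearEquiv.ofLinearMap (ridFwd M) ((bt M (unit K)).flip (Finsupp.single 1 1))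
      (LinearMap.ext fun m => by
        rw [LinearMap.comp_apply, LinearMap.flip_apply, ridFwd_bt]; simp)
      (bt_ext_unit_right fun z m => by
        rw [LinearMap.comp_apply, LinearMap.flip_apply, ridFwd_bt, bt_balanced, unit_left,
          mul_one]; rfl))
    (fun x t => by
      have : ridFwd M ∘ₗ btLeft M (unit K) x = M.left x ∘ₗ ridFwd M :=
        bt_ext_unit_right fun z m => by
          rw [LinearMap.comp_apply, LinearMap.comp_apply, btLeft_bt, ridFwd_bt, ridFwd_bt,
            M.left_right]
      exact LinearMap.congr_fun this t)
    (fun x t => by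
      have : ridFwd M ∘ₗ btRight M (unit K) (op x) = M.right (op x) ∘ₗ ridFwd M :=
        bt_ext_unit_right fun z m => by
          rw [LinearMap.comp_apply, LinearMap.comp_apply, btRight_bt, unit_right, ridFwd_bt,
            ridFwd_bt, MulOpposite.op_mul, map_mul]; rfl
      exact LinearMap.congr_fun this t)
    (fun g t ht => by
      refine (btDeg_le (S := (M.deg g).comap (ridFwd M)) ?_) ht
      rintro a b m s rfl hm hs
      refine (Submodule.span_le (p := (M.deg (a * b)).comap
        (ridFwd M ∘ₗ bt M (unit K) m))).2 ?_ hs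
      rintro _ ⟨z, rfl, rfl⟩
      change ridFwd M (bt M (unit K) m _) ∈ M.deg (a * z)
      rw [ridFwd_bt]
      exact M.right_deg z a m hm)

theorem tensorMap_bt {M N M' N' : GrBimod.{u, w} K} (f : M ⟶ M') (g : N ⟶ N') (m : M.carrier)
    (n : N.carrier) : (tensorMap f g).toLin (bt M N m n) = bt M' N' (f.toLin m) (g.toLin n) :=
  btMap_bt f.toLin g.toLin f.comm_right g.comm_left m n

theorem associator_bt (L M N : GrBimod.{u, w} K) (l : L.carrier) (m : M.carrier) (n : N.carrier) :
    (associator L M N).hom.toLin (bt (tensor L M) N (bt L M l m) n) =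
      bt L (tensor M N) l (bt M N m n) := assocFwd_bt L M N l m n

theorem leftUnitor_bt (M : GrBimod.{u, u} K) (z : K) (m : M.carrier) :
    (leftUnitor M).hom.toLin (bt (unit K) M (Finsupp.single z 1) m) = M.left z m := lidFwd_bt M z m

theorem rightUnitor_bt (M : GrBimod.{u, u} K) (z : K) (m : M.carrier) :
    (rightUnitor M).hom.toLin (bt M (unit K) m (Finsupp.single z 1)) = M.right (op z) m :=
  ridFwd_bt M z m

theorem tensorMap_comp {M₁ M₂ M₃ N₁ N₂ N₃ : GrBimod.{u, w} K} (f₁ : M₁ ⟶ M₂) (f₂ : M₂ ⟶ M₃)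
    (g₁ : N₁ ⟶ N₂) (g₂ : N₂ ⟶ N₃) :
    tensorMap f₁ g₁ ≫ tensorMap f₂ g₂ = tensorMap (f₁ ≫ f₂) (g₁ ≫ g₂) :=
  hom_ext (bt_ext fun m n => by
    rw [comp_toLin, LinearMap.comp_apply, tensorMap_bt, tensorMap_bt, tensorMap_bt]; rfl)

theorem tensorMap_id (M N : GrBimod.{u, w} K) : tensorMap (𝟙 M) (𝟙 N) = 𝟙 (tensor M N) :=
  hom_ext (bt_ext fun m n => by rw [tensorMap_bt]; rfl)

theorem associator_nat {L M N L' M' N' : GrBimod.{u, w} K} (f : L ⟶ L') (g : M ⟶ M')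
    (h : N ⟶ N') : tensorMap (tensorMap f g) h ≫ (associator L' M' N').hom =
      (associator L M N).hom ≫ tensorMap f (tensorMap g h) :=
  hom_ext (bt_ext₃ fun l m n => by
    rw [comp_toLin, comp_toLin, LinearMap.comp_apply, LinearMap.comp_apply, tensorMap_bt,
      tensorMap_bt, associator_bt, associator_bt, tensorMap_bt, tensorMap_bt])

theorem leftUnitor_nat {M M' : GrBimod.{u, u} K} (f : M ⟶ M') :
    tensorMap (𝟙 (unit K)) f ≫ (leftUnitor M').hom = (leftUnitor M).hom ≫ f :=
  hom_ext (bt_ext_unit_left fun z m => by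
    rw [comp_toLin, comp_toLin, LinearMap.comp_apply, LinearMap.comp_apply, tensorMap_bt,
      leftUnitor_bt, f.comm_left]
    exact leftUnitor_bt M' z _)

theorem rightUnitor_nat {M M' : GrBimod.{u, u} K} (f : M ⟶ M') :
    tensorMap f (𝟙 (unit K)) ≫ (rightUnitor M').hom = (rightUnitor M).hom ≫ f :=
  hom_ext (bt_ext_unit_right fun z m => by
    rw [comp_toLin, comp_toLin, LinearMap.comp_apply, LinearMap.comp_apply, tensorMap_bt,
      rightUnitor_bt, f.comm_right]
    exact rightUnitor_bt M' z _)

theorem pentagon_aux (L M N O : GrBimod.{u, w} K) :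
    tensorMap (associator L M N).hom (𝟙 O) ≫ (associator L (tensor M N) O).hom ≫
        tensorMap (𝟙 L) (associator M N O).hom =
      (associator (tensor L M) N O).hom ≫ (associator L M (tensor N O)).hom :=
  hom_ext (bt_ext fun t o => by
    induction t using bt_induction with
    | add s t hs ht => simp only [map_add, LinearMap.add_apply, hs, ht]
    | h t n =>
      induction t using bt_induction with
      | add s t hs ht => simp only [map_add, LinearMap.add_apply, hs, ht]
      | h l m =>
        rw [comp_toLin, comp_toLin, comp_toLin, LinearMap.comp_apply, LinearMap.comp_apply,
          LinearMap.comp_apply, tensorMap_bt, associator_bt, associator_bt, associator_bt,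
          id_toLin, LinearMap.id_apply, associator_bt, tensorMap_bt, associator_bt]
        rfl)

theorem triangle_aux (M N : GrBimod.{u, u} K) :
    (associator M (unit K) N).hom ≫ tensorMap (𝟙 M) (leftUnitor N).hom =
      tensorMap (rightUnitor M).hom (𝟙 N) :=
  hom_ext (bt_ext₃ fun m z n => by
    have : ((associator M (unit K) N).hom ≫ tensorMap (𝟙 M) (leftUnitor N).hom).toLin ∘ₗ
        (bt (tensor M (unit K)) N).flip n ∘ₗ bt M (unit K) m =
      (tensorMap (rightUnitor M).hom (𝟙 N)).toLin ∘ₗ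
        (bt (tensor M (unit K)) N).flip n ∘ₗ bt M (unit K) m := unit_ext fun z => by
      rw [LinearMap.comp_apply, LinearMap.comp_apply, LinearMap.comp_apply, LinearMap.comp_apply,
        LinearMap.flip_apply, comp_toLin, LinearMap.comp_apply, associator_bt, tensorMap_bt,
        tensorMap_bt, leftUnitor_bt, rightUnitor_bt, bt_balanced]
      rfl
    exact LinearMap.congr_fun this z)

instance : MonoidalCategoryStruct (GrBimod.{u, u} K) where
  tensorObj := tensor
  whiskerLeft M _ _ f := tensorMap (𝟙 M) f
  whiskerRight f M := tensorMap f (𝟙 M)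
  tensorHom f g := tensorMap f g
  tensorUnit := unit K
  associator := associator
  leftUnitor := leftUnitor
  rightUnitor := rightUnitor

instance : MonoidalCategory (GrBimod.{u, u} K) where
  tensorHom_def f g := by
    refine Eq.trans ?_ (tensorMap_comp f (𝟙 _) (𝟙 _) g).symm
    rw [Category.comp_id, Category.id_comp]; rfl
  id_tensorHom_id M N := tensorMap_id M N
  tensorHom_comp_tensorHom f₁ f₂ g₁ g₂ := tensorMap_comp f₁ g₁ f₂ g₂
  whiskerLeft_id M N := tensorMap_id M N
  id_whiskerRight M N := tensorMap_id M N
  associator_naturality f g h := associator_nat f g h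
  leftUnitor_naturality f := leftUnitor_nat f
  rightUnitor_naturality f := rightUnitor_nat f
  pentagon L M N O := pentagon_aux L M N O
  triangle M N := triangle_aux M N

end GrBimod

/-! ## Transversals and the algebra `Ξ(R,K)` -/

/-- A transversal `R` for the subgroup `K` of `G`: a set of representatives of the left cosets
`gK`, so that every element of `G` is uniquely of the form `rx` with `r ∈ R`, `x ∈ K`; it is required
to contain the identity. -/
structure Transversal {G : Type u} [Group G] (K : Subgroup G) where
  carrier : Set G
  isComplement : Subgroup.IsComplement carrier (K : Set G)
  one_mem : (1 : G) ∈ carrier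

namespace Transversal

variable {G : Type u} [Group G] {K : Subgroup G} (R : Transversal K)

instance [Finite G] : Fintype R.carrier := Fintype.ofFinite _

/-- The identity as an element of `R`. -/
def e : R.carrier := ⟨1, R.one_mem⟩

/-- The factor in `R` of an element of `G = RK`. -/
def rPart (g : G) : R.carrier := (R.isComplement.equiv g).1

/-- The factor in `K` of an element of `G = RK`. -/
def kPart (g : G) : K := ⟨(R.isComplement.equiv g).2, (R.isComplement.equiv g).2.2⟩

theorem rPart_mul_kPart (g : G) : (R.rPart g : G) * (R.kPart g : G) = g :=
  R.isComplement.equiv_fst_mul_equiv_snd g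

theorem factor_unique {r s : R.carrier} {x y : K} (h : (r : G) * x = s * y) : r = s ∧ x = y := by
  have := @(R.isComplement).1 (r, ⟨x, x.2⟩) (s, ⟨y, y.2⟩) h
  simp only [Prod.mk.injEq, Subtype.mk.injEq] at this
  exact ⟨this.1, Subtype.ext this.2⟩

/-- `x ▷ r`, defined by `xr = (x ▷ r)(x ◁ r)`. -/
def lact (x : K) (r : R.carrier) : R.carrier := R.rPart (x * r)

/-- `x ◁ r`, defined by `xr = (x ▷ r)(x ◁ r)`. -/
def ract (x : K) (r : R.carrier) : K := R.kPart (x * r)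

/-- The product `r · s` on `R`, defined by `rs = (r · s) τ(r,s)`. -/
def dot (r s : R.carrier) : R.carrier := R.rPart (r * s)

/-- The cocycle `τ`, defined by `rs = (r · s) τ(r,s)`. -/
def tau (r s : R.carrier) : K := R.kPart (r * s)

theorem lact_mul_ract (x : K) (r : R.carrier) : (R.lact x r : G) * R.ract x r = x * r :=
  R.rPart_mul_kPart _

theorem dot_mul_tau (r s : R.carrier) : (R.dot r s : G) * R.tau r s = r * s :=
  R.rPart_mul_kPart _

theorem lact_ract_one (r : R.carrier) : R.lact 1 r = r ∧ R.ract 1 r = 1 :=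
  R.factor_unique (by rw [lact_mul_ract]; simp)

theorem lact_ract_mul (x y : K) (r : R.carrier) : R.lact (x * y) r = R.lact x (R.lact y r) ∧
    R.ract (x * y) r = R.ract x (R.lact y r) * R.ract y r :=
  R.factor_unique (by
    rw [lact_mul_ract, Subgroup.coe_mul, Subgroup.coe_mul, ← mul_assoc, lact_mul_ract,
      mul_assoc (x : G) (R.lact y r : G), lact_mul_ract, mul_assoc])

/-- The action of `K` on the functions on `R`, `(x • f)(r) = f(x⁻¹ ▷ r)`. -/
instance : MulSemiringAction K (R.carrier → ℂ) where
  smul x f := fun r => f (R.lact x⁻¹ r)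
  one_smul f := funext fun r => by
    change f (R.lact 1⁻¹ r) = f r
    rw [inv_one, (R.lact_ract_one r).1]
  mul_smul x y f := funext fun r => by
    change f (R.lact (x * y)⁻¹ r) = f (R.lact y⁻¹ (R.lact x⁻¹ r))
    rw [mul_inv_rev, (R.lact_ract_mul _ _ r).1]
  smul_zero _ := rfl
  smul_add _ _ _ := rfl
  smul_one _ := rfl
  smul_mul _ _ _ := rfl

theorem smul_fun_apply (x : K) (f : R.carrier → ℂ) (r : R.carrier) :
    (x • f) r = f (R.lact x⁻¹ r) := rfl

instance : SMulCommClass K ℂ (R.carrier → ℂ) := ⟨fun _ _ _ => rfl⟩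

end Transversal

section

variable {G : Type u} [Group G] {K : Subgroup G}

/-- The cross product algebra `Ξ(R,K) = ℂ(R) ⋊ ℂK` of the algebra of functions on `R` by the action
of `K`: its elements are the sums of products `f x` with `f ∈ ℂ(R)` and `x ∈ K`, multiplied by
`(f x)(g y) = (f (x • g)) (xy)`. -/
def Xi (R : Transversal K) : Type u := SkewMonoidAlgebra (R.carrier → ℂ) K

namespace Xi

variable (R : Transversal K)

instance : Ring (Xi R) := inferInstanceAs (Ring (SkewMonoidAlgebra (R.carrier → ℂ) K))

instance : Algebra ℂ (Xi R) := inferInstanceAs (Algebra ℂ (SkewMonoidAlgebra (R.carrier → ℂ) K))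

/-- The product `f x` of `f ∈ ℂ(R)` and `x ∈ K`, additively in `f`. -/
def single (x : K) : (R.carrier → ℂ) →+ Xi R := SkewMonoidAlgebra.singleAddHom x

theorem single_mul_single (x y : K) (f g : R.carrier → ℂ) :
    single R x f * single R y g = single R (x * y) (f * x • g) :=
  SkewMonoidAlgebra.single_mul_single

theorem single_one_one : single R 1 1 = 1 := rfl

open Classical in
/-- The function `δ_r` as an element of `Ξ(R,K)`. -/
def delta (r : R.carrier) : Xi R := single R 1 (Pi.single r 1)

/-- The inclusion of `K` in `Ξ(R,K)`. -/
def grp : K →* Xi R where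
  toFun x := single R x 1
  map_one' := rfl
  map_mul' x y := by rw [single_mul_single, smul_one, mul_one]

theorem grp_apply (x : K) : grp R x = single R x 1 := rfl

/-- The cross relation `x δ_r = δ_{x ▷ r} x`. -/
theorem grp_mul_delta (x : K) (r : R.carrier) :
    grp R x * delta R r = delta R (R.lact x r) * grp R x := by
  classical
  have key : x • (Pi.single r 1 : R.carrier → ℂ) = Pi.single (R.lact x r) 1 := by
    funext s
    rw [Transversal.smul_fun_apply, Pi.single_apply, Pi.single_apply]
    congr 1
    apply propext
    constructor
    · rintro rfl
      rw [← (R.lact_ract_mul _ _ s).1, mul_inv_cancel, (R.lact_ract_one s).1]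
    · rintro rfl
      rw [← (R.lact_ract_mul _ _ r).1, inv_mul_cancel, (R.lact_ract_one r).1]
  rw [grp_apply, delta, delta, single_mul_single, single_mul_single, key]
  simp

open Classical in
theorem delta_mul_delta (r s : R.carrier) :
    delta R r * delta R s = if r = s then delta R r else 0 := by
  rw [delta, delta, single_mul_single, one_smul, mul_one]
  split_ifs with h
  · subst h
    congr 1
    funext t
    by_cases ht : t = r <;> simp [ht]
  · have : (Pi.single r 1 * Pi.single s 1 : R.carrier → ℂ) = 0 := by
      funext t
      by_cases ht : t = r
      · subst ht; simp [h]
      · simp [ht]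
    rw [this, map_zero]

theorem sum_delta [Finite G] : ∑ r, delta R r = 1 := by
  classical
  simp only [delta]
  rw [← map_sum, Finset.univ_sum_single]
  rfl

end Xi

/-! ## The functor `V ↦ V ⊗ ℂK` -/

namespace AlgMod

variable {R : Transversal K} (V : AlgMod.{u, w} (Xi R))

/-- The subspace of elements `v` with `|v| = r`, that is, with `δ_r.v = v`. -/
def grade (r : R.carrier) : Submodule ℂ V.carrier where
  carrier := {v | V.act (Xi.delta R r) v = v}
  zero_mem' := map_zero _
  add_mem' {v w} hv hw := by
    simp only [Set.mem_ofPred_eq] at hv hw ⊢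
    rw [map_add, hv, hw]
  smul_mem' c v hv := by
    simp only [Set.mem_ofPred_eq] at hv ⊢
    rw [map_smul, hv]

variable {V}

theorem mem_grade {r : R.carrier} {v : V.carrier} :
    v ∈ V.grade r ↔ V.act (Xi.delta R r) v = v := Iff.rfl

open Classical in
theorem delta_of_mem_grade {r : R.carrier} {v : V.carrier} (hv : v ∈ V.grade r) (s : R.carrier) :
    V.act (Xi.delta R s) v = if s = r then v else 0 := by
  rw [mem_grade] at hv
  conv_lhs => rw [← hv]
  rw [← Module.End.mul_apply, ← map_mul, Xi.delta_mul_delta]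
  split_ifs with h
  · rw [h, hv]
  · simp

theorem delta_mem_grade (r : R.carrier) (v : V.carrier) :
    V.act (Xi.delta R r) v ∈ V.grade r := by
  classical
  rw [mem_grade, ← Module.End.mul_apply, ← map_mul, Xi.delta_mul_delta, if_pos rfl]

theorem grp_mem_grade {r : R.carrier} {v : V.carrier} (hv : v ∈ V.grade r) (x : K) :
    V.act (Xi.grp R x) v ∈ V.grade (R.lact x r) := by
  rw [mem_grade, ← Module.End.mul_apply, ← map_mul, ← Xi.grp_mul_delta, map_mul,
    Module.End.mul_apply, mem_grade.1 hv]

theorem sum_delta_apply [Finite G] (v : V.carrier) : ∑ r, V.act (Xi.delta R r) v = v := by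
  rw [← LinearMap.sum_apply, ← map_sum, Xi.sum_delta, map_one]
  rfl

variable (V)

theorem grade_ext [Finite G] {E : Type*} [AddCommGroup E] [Module ℂ E]
    {f g : V.carrier ⊗[ℂ] (K →₀ ℂ) →ₗ[ℂ] E} (h : ∀ (r : R.carrier) (v : V.carrier) (z : K),
      v ∈ V.grade r → f (v ⊗ₜ Finsupp.single z 1) = g (v ⊗ₜ Finsupp.single z 1)) : f = g := by
  refine TensorProduct.ext (LinearMap.ext fun v => Finsupp.lhom_ext' fun z => LinearMap.ext_ring ?_)
  change f (v ⊗ₜ Finsupp.single z 1) = g (v ⊗ₜ Finsupp.single z 1)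
  rw [← sum_delta_apply v, TensorProduct.sum_tmul, map_sum, map_sum]
  exact Finset.sum_congr rfl fun r _ => h r _ z (delta_mem_grade r v)

/-- The subspace of `V ⊗ ℂK` spanned by the `v ⊗ z` with `|v|z = g`. -/
def tensorDeg (g : G) : Submodule ℂ (V.carrier ⊗[ℂ] (K →₀ ℂ)) :=
  Submodule.span ℂ {t | ∃ (r : R.carrier) (v : V.carrier) (z : K),
    (r : G) * z = g ∧ v ∈ V.grade r ∧ t = v ⊗ₜ Finsupp.single z 1}

variable {V}

theorem tensorDeg_le {g : G} {S : Submodule ℂ (V.carrier ⊗[ℂ] (K →₀ ℂ))}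
    (h : ∀ (r : R.carrier) (v : V.carrier) (z : K), (r : G) * z = g → v ∈ V.grade r →
      v ⊗ₜ Finsupp.single z 1 ∈ S) : V.tensorDeg g ≤ S := by
  rw [tensorDeg, Submodule.span_le]
  rintro _ ⟨r, v, z, hg, hv, rfl⟩
  exact h r v z hg hv

theorem tmul_mem_tensorDeg {r : R.carrier} {v : V.carrier} (hv : v ∈ V.grade r) (z : K) :
    v ⊗ₜ Finsupp.single z 1 ∈ V.tensorDeg (r * z) :=
  Submodule.subset_span ⟨r, v, z, rfl, hv, rfl⟩

variable (V)

variable [Finite G]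

/-- The linear map `v ⊗ z ↦ x.v ⊗ (x ◁ |v|) z`. -/
def leftLin (x : K) : Module.End ℂ (V.carrier ⊗[ℂ] (K →₀ ℂ)) :=
  ∑ r : R.carrier, TensorProduct.map (V.act (Xi.grp R x * Xi.delta R r))
    (Finsupp.lmapDomain ℂ ℂ (R.ract x r * ·))

variable {V}

theorem leftLin_tmul (x : K) {r : R.carrier} {v : V.carrier} (hv : v ∈ V.grade r) (z : K) :
    leftLin V x (v ⊗ₜ Finsupp.single z 1) =
      V.act (Xi.grp R x) v ⊗ₜ Finsupp.single (R.ract x r * z) 1 := by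
  classical
  rw [leftLin, LinearMap.sum_apply, Finset.sum_eq_single r]
  · rw [TensorProduct.map_tmul, map_mul, Module.End.mul_apply, mem_grade.1 hv]
    simp
  · intro s _ hs
    rw [TensorProduct.map_tmul, map_mul, Module.End.mul_apply, delta_of_mem_grade hv, if_neg hs]
    simp
  · simp

variable (V)

/-- The `G`-graded `K`-bimodule `V ⊗ ℂK` of a `Ξ(R,K)`-module `V`, with
`x.(v ⊗ z).y = x.v ⊗ (x ◁ |v|)zy` and `|v ⊗ z| = |v|z`. -/
def toGrBimod : GrBimod.{u, max u w} K where
  carrier := V.carrier ⊗[ℂ] (K →₀ ℂ)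
  left :=
    { toFun x := leftLin V x
      map_one' := V.grade_ext fun r v z hv => by
        rw [leftLin_tmul 1 hv, map_one, map_one, (R.lact_ract_one r).2, one_mul]; rfl
      map_mul' x y := V.grade_ext fun r v z hv => by
        rw [Module.End.mul_apply, leftLin_tmul _ hv, leftLin_tmul _ hv,
          leftLin_tmul _ (grp_mem_grade hv y), map_mul, map_mul, (R.lact_ract_mul x y r).2,
          mul_assoc]
        rfl }
  right :=
    { toFun y := TensorProduct.map LinearMap.id (Finsupp.lmapDomain ℂ ℂ (· * y.unop))
      map_one' := V.grade_ext fun r v z hv => by simp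
      map_mul' x y := V.grade_ext fun r v z hv => by simp [mul_assoc] }
  left_right x y t := by
    have : leftLin V x ∘ₗ TensorProduct.map LinearMap.id (Finsupp.lmapDomain ℂ ℂ (· * y)) =
        TensorProduct.map LinearMap.id (Finsupp.lmapDomain ℂ ℂ (· * y)) ∘ₗ leftLin V x :=
      V.grade_ext fun r v z hv => by
        simp [leftLin_tmul x hv, mul_assoc]
    exact LinearMap.congr_fun this t
  deg := V.tensorDeg
  deg_indep := by
    classical
    refine GrBimod.indep_of_proj _ (fun g => ∑ r : R.carrier,
      TensorProduct.map (V.act (Xi.delta R r)) (Finsupp.lsum ℂ fun z : K =>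
      if g = r * z then Finsupp.lsingle z else 0)) fun g h t ht => ?_
    induction ht using Submodule.span_induction with
    | zero => simp
    | add s t _ _ hs ht => rw [map_add, hs, ht]; split_ifs <;> simp
    | smul c t _ ht => rw [map_smul, ht]; split_ifs <;> simp
    | mem t ht =>
      obtain ⟨r, v, z, rfl, hv, rfl⟩ := ht
      rw [LinearMap.sum_apply, Finset.sum_eq_single r]
      · rw [TensorProduct.map_tmul, mem_grade.1 hv]
        by_cases hg : g = r * z <;> simp [hg]
      · intro s _ hs
        rw [TensorProduct.map_tmul, delta_of_mem_grade hv, if_neg hs, TensorProduct.zero_tmul]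
      · simp
  deg_iSup := by
    have : (⨆ g, V.tensorDeg g).mkQ = 0 := V.grade_ext fun r v z hv => by
      rw [LinearMap.zero_apply, Submodule.mkQ_apply, Submodule.Quotient.mk_eq_zero]
      exact Submodule.mem_iSup_of_mem _ (tmul_mem_tensorDeg hv z)
    rw [← Submodule.ker_mkQ (⨆ g, V.tensorDeg g), this, LinearMap.ker_zero]
  left_deg x g t ht := by
    refine (tensorDeg_le (S := (V.tensorDeg (x * g)).comap (leftLin V x)) ?_) ht
    rintro r v z rfl hv
    rw [Submodule.mem_comap, leftLin_tmul x hv, ← mul_assoc, ← R.lact_mul_ract, mul_assoc,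
      ← Subgroup.coe_mul]
    exact tmul_mem_tensorDeg (grp_mem_grade hv x) _
  right_deg y g t ht := by
    refine (tensorDeg_le (S := (V.tensorDeg (g * y)).comap
      (TensorProduct.map LinearMap.id (Finsupp.lmapDomain ℂ ℂ (· * y)))) ?_) ht
    rintro r v z rfl hv
    rw [Submodule.mem_comap, TensorProduct.map_tmul, Finsupp.lmapDomain_apply,
      Finsupp.mapDomain_single, mul_assoc, ← Subgroup.coe_mul]
    exact tmul_mem_tensorDeg hv _

theorem toGrBimod_left (x : K) {r : R.carrier} {v : V.carrier} (hv : v ∈ V.grade r) (z : K) :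
    V.toGrBimod.left x (v ⊗ₜ[ℂ] Finsupp.single z (1 : ℂ) : V.carrier ⊗[ℂ] (K →₀ ℂ)) =
      (V.act (Xi.grp R x) v ⊗ₜ[ℂ] Finsupp.single (R.ract x r * z) (1 : ℂ) :
        V.carrier ⊗[ℂ] (K →₀ ℂ)) := leftLin_tmul x hv z

end AlgMod

/-- The functor `F` from `Ξ(R,K)`-modules to `G`-graded `K`-bimodules, `V ↦ V ⊗ ℂK` on objects and
`f ↦ f ⊗ id` on morphisms. -/
def bimodFunctor [Finite G] (R : Transversal K) :
    AlgMod.{u, w} (Xi R) ⥤ GrBimod.{u, max u w} K where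
  obj V := V.toGrBimod
  map {V W} f :=
    have hf : ∀ {r : R.carrier} {v : V.carrier}, v ∈ V.grade r → f.toLin v ∈ W.grade r :=
      fun {r v} hv => by
        rw [AlgMod.mem_grade] at hv ⊢
        rw [← f.comm, hv]
    { toLin := TensorProduct.map f.toLin LinearMap.id
      comm_left x t := by
        have : TensorProduct.map f.toLin LinearMap.id ∘ₗ V.leftLin x =
            W.leftLin x ∘ₗ TensorProduct.map f.toLin LinearMap.id :=
          V.grade_ext fun r v z hv => by
            rw [LinearMap.comp_apply, AlgMod.leftLin_tmul x hv, LinearMap.comp_apply,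
              TensorProduct.map_tmul, TensorProduct.map_tmul, LinearMap.id_apply,
              LinearMap.id_apply, AlgMod.leftLin_tmul x (hf hv), f.comm]
        exact LinearMap.congr_fun this t
      comm_right y t := by
        have : TensorProduct.map f.toLin LinearMap.id ∘ₗ
              TensorProduct.map LinearMap.id (Finsupp.lmapDomain ℂ ℂ (· * y)) =
            TensorProduct.map LinearMap.id (Finsupp.lmapDomain ℂ ℂ (· * y)) ∘ₗ
              TensorProduct.map f.toLin LinearMap.id :=
          V.grade_ext fun r v z hv => by simp
        exact LinearMap.congr_fun this t
      map_deg g t ht := by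
        refine (AlgMod.tensorDeg_le (S := (W.tensorDeg g).comap
          (TensorProduct.map f.toLin LinearMap.id)) ?_) ht
        rintro r v z rfl hv
        rw [Submodule.mem_comap, TensorProduct.map_tmul]
        exact AlgMod.tmul_mem_tensorDeg (hf hv) z }
  map_id V := GrBimod.hom_ext TensorProduct.map_id
  map_comp f g := GrBimod.hom_ext (by
    change TensorProduct.map _ _ = TensorProduct.map _ _ ∘ₗ TensorProduct.map _ _
    rw [← TensorProduct.map_comp]; rfl)

end

end

/-! Everything rests on the uniqueness of the factorization $g=rx$ in $G=RK$. Reading $x(st)=(xs)t$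
and $a(bc)=(ab)c$ through it gives `lact_ract_dot` and `dot_tau_assoc`; their $R$-parts say how
$\triangleright$ meets the product of $R$ and how that product fails to be associative, and their
$K$-parts are cocycle identities for $\tau$. These identities are what the quasi-bialgebra axioms
and the monoidality of $F$ reduce to.

Equivalence. In a graded bimodule $M$, right multiplication by $k\in K$ maps $M_r$ isomorphically
onto $M_{rk}$, so $M$ is free as a right $\mathbb{C}K$-module on its components of degree in $R$. In
$F(V)$ these components make up $V\otimes 1$. A degree-preserving map therefore sends $V\otimes 1$
to $W\otimes 1$, and right equivariance determines the rest: $F$ is fully faithful. For essential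
surjectivity, $V$ is recovered from $M$ as the coinvariants of the right action. The left action of
$K$ descends to them unchanged, $\delta_r$ acts as the projection to the degrees in $rK$, and
$m\mapsto [m]\otimes k$ for $|m|=rk$ is the isomorphism `coinvTensorEquiv`.

Quasi-bialgebra. The coproduct and counit are defined on generators by the universal property
`Xi.lift`. Since the $\delta_r$ sum to $1$, an identity in a tensor power of $\Xi(R,K)$ may be
tested after right multiplication by $\delta_a\otimes\delta_b\otimes\cdots$; each axiom then becomes
one identity in $R$ or $K$.

Monoidality. Elements of $K$ can be moved across $\otimes_{\mathbb{C}K}$, so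
$F(V)\otimes_{\mathbb{C}K}F(W)$ is spanned by the $(v\otimes 1)\otimes(w\otimes z)$. Such an element
has degree $rsz=(r\cdot s)\tau(r,s)z$, which forces the factor $\tau$ in $f_{V,W}$. Rebracketing
three factors makes $\tau(|u|,|v|)$ act on the third one, and the associator $\phi$ cancels this
action. -/

noncomputable section

/-! ## Identities for the factorization `G = RK` -/

namespace Transversal

variable {G : Type u} [Group G] {K : Subgroup G} (R : Transversal K)

/-- Both sides factor $x(st)=(xs)t$. The first half makes the coproduct respect the cross relations;
the second gives quasi-coassociativity on $K$ and the left equivariance of the tensorator. -/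
theorem lact_ract_dot (x : K) (s t : R.carrier) :
    R.lact x (R.dot s t) = R.dot (R.lact x s) (R.lact (R.ract x s) t) ∧
      R.ract x (R.dot s t) * R.tau s t =
        R.tau (R.lact x s) (R.lact (R.ract x s) t) * R.ract (R.ract x s) t :=
  R.factor_unique (by
    rw [Subgroup.coe_mul, Subgroup.coe_mul, ← mul_assoc, ← mul_assoc, lact_mul_ract, dot_mul_tau,
      mul_assoc, dot_mul_tau, mul_assoc, lact_mul_ract, ← mul_assoc, ← mul_assoc, lact_mul_ract])

/-- Both sides factor $a(bc)=(ab)c$. The first half gives quasi-coassociativity on the $\delta_r$;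
the second gives the 3-cocycle identity for $\phi$ and the associativity of the tensorator. -/
theorem dot_tau_assoc (a b c : R.carrier) :
    R.dot a (R.dot b c) = R.dot (R.dot a b) (R.lact (R.tau a b) c) ∧
      R.tau a (R.dot b c) * R.tau b c =
        R.tau (R.dot a b) (R.lact (R.tau a b) c) * R.ract (R.tau a b) c :=
  R.factor_unique (by
    rw [Subgroup.coe_mul, Subgroup.coe_mul, ← mul_assoc, ← mul_assoc, dot_mul_tau, dot_mul_tau,
      mul_assoc, dot_mul_tau, mul_assoc, lact_mul_ract, ← mul_assoc, ← mul_assoc, dot_mul_tau])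

theorem lact_ract_e (x : K) : R.lact x R.e = R.e ∧ R.ract x R.e = x :=
  R.factor_unique (by rw [lact_mul_ract]; simp [e])

theorem e_dot_tau (r : R.carrier) : R.dot R.e r = r ∧ R.tau R.e r = 1 :=
  R.factor_unique (by rw [dot_mul_tau]; simp [e])

theorem dot_tau_e (r : R.carrier) : R.dot r R.e = r ∧ R.tau r R.e = 1 :=
  R.factor_unique (by rw [dot_mul_tau]; simp [e])

theorem lact_inv_lact (x : K) (r : R.carrier) : R.lact x⁻¹ (R.lact x r) = r := by
  rw [← (R.lact_ract_mul _ _ r).1, inv_mul_cancel, (R.lact_ract_one r).1]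

theorem lact_lact_inv (x : K) (r : R.carrier) : R.lact x (R.lact x⁻¹ r) = r := by
  rw [← (R.lact_ract_mul _ _ r).1, mul_inv_cancel, (R.lact_ract_one r).1]

/-- The rule for $(xy)\triangleleft r$ applied to $x^{-1}x=1$: $\triangleleft$ is not multiplicative
in $x$, so inverting requires moving $r$ along. -/
theorem ract_inv_lact (x : K) (r : R.carrier) : R.ract x⁻¹ (R.lact x r) = (R.ract x r)⁻¹ := by
  rw [eq_inv_iff_mul_eq_one, ← (R.lact_ract_mul _ _ r).2, inv_mul_cancel, (R.lact_ract_one r).2]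

theorem lact_injective (x : K) : Function.Injective (R.lact x) := fun r s h => by
  rw [← R.lact_inv_lact x r, h, lact_inv_lact]

end Transversal

/-! ## The universal property of `Ξ(R,K)` -/

namespace Xi

variable {G : Type u} [Group G] {K : Subgroup G} {R : Transversal K}

theorem smul_single (c : ℂ) (x : K) (f : R.carrier → ℂ) :
    c • single R x f = single R x (c • f) :=
  SkewMonoidAlgebra.smul_single c x f

theorem delta_mul_grp (r : R.carrier) (x : K) [DecidableEq R.carrier] :
    delta R r * grp R x = single R x (Pi.single r 1) := by
  rw [delta, grp_apply, single_mul_single, one_mul, smul_one, mul_one]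
  congr!

theorem delta_mul_self (r : R.carrier) : delta R r * delta R r = delta R r := by
  rw [delta_mul_delta, if_pos rfl]

theorem delta_mul_of_ne {r s : R.carrier} (h : r ≠ s) : delta R r * delta R s = 0 := by
  rw [delta_mul_delta, if_neg h]

theorem grp_inv_mul (x : K) : grp R x⁻¹ * grp R x = 1 := by
  rw [← map_mul, inv_mul_cancel, map_one]

theorem grp_mul_inv (x : K) : grp R x * grp R x⁻¹ = 1 := by
  rw [← map_mul, mul_inv_cancel, map_one]

variable [Finite G]

/-- The expansion $f=\sum_r f(r)\delta_r$, which reduces every element of $\Xi(R,K)$ to combinations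
of products $\delta_r x$. -/
theorem sum_smul_delta_mul_grp (x : K) (f : R.carrier → ℂ) :
    ∑ r, f r • (delta R r * grp R x) = single R x f := by
  classical
  simp only [delta_mul_grp, smul_single]
  rw [← map_sum]
  congr 1
  ext r
  simp [Finset.sum_apply, Pi.single_apply]

/-- The elements of `Ξ(R,K)` are generated by `K` and the `δ_r`. -/
theorem induction_on {p : Xi R → Prop} (hgrp : ∀ x, p (grp R x)) (hdelta : ∀ r, p (delta R r))
    (add : ∀ a b, p a → p b → p (a + b)) (mul : ∀ a b, p a → p b → p (a * b))
    (smul : ∀ (c : ℂ) a, p a → p (c • a)) (h : Xi R) : p h := by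
  have h0 : p 0 := by simpa using smul 0 _ (hgrp 1)
  refine SkewMonoidAlgebra.induction_on h h0 (fun x f => ?_) add
  change p (single R x f)
  rw [← sum_smul_delta_mul_grp]
  exact Finset.sum_induction _ p add h0 fun r _ => smul _ _ (mul _ _ (hdelta r) (hgrp x))

theorem algHom_ext {A : Type*} [Ring A] [Algebra ℂ A] {f g : Xi R →ₐ[ℂ] A}
    (hgrp : ∀ x, f (grp R x) = g (grp R x)) (hdelta : ∀ r, f (delta R r) = g (delta R r)) :
    f = g :=
  AlgHom.ext fun h => by
    induction h using induction_on with
    | hgrp x => exact hgrp x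
    | hdelta r => exact hdelta r
    | add a b ha hb => rw [map_add, map_add, ha, hb]
    | mul a b ha hb => rw [map_mul, map_mul, ha, hb]
    | smul c a ha => rw [map_smul, map_smul, ha]

/-- The algebra homomorphism from the functions on `R` given by a complete family of orthogonal
idempotents. -/
def funLift {A : Type*} [Ring A] [Algebra ℂ A] {I : Type*} [Fintype I] (d : I → A)
    (hself : ∀ r, d r * d r = d r) (hne : ∀ r s, r ≠ s → d r * d s = 0) (hsum : ∑ r, d r = 1) :
    (I → ℂ) →ₐ[ℂ] A :=
  AlgHom.ofLinearMap (Fintype.linearCombination ℂ d)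
    (by simp [Fintype.linearCombination_apply, hsum])
    fun f g => by
      rw [Fintype.linearCombination_apply, Fintype.linearCombination_apply,
        Fintype.linearCombination_apply, Finset.sum_mul_sum]
      refine Finset.sum_congr rfl fun r _ => ?_
      rw [Finset.sum_eq_single r (fun s _ hs => by rw [smul_mul_smul_comm, hne r s hs.symm, smul_zero])
        (by simp), smul_mul_smul_comm, hself, Pi.mul_apply]

/-- An algebra homomorphism out of `Ξ(R,K)` is given by a homomorphism on `K` and a complete family
of orthogonal idempotents indexed by `R` which satisfy the cross relations. -/
def lift {A : Type*} [Ring A] [Algebra ℂ A] (g : K →* A) (d : R.carrier → A)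
    (hself : ∀ r, d r * d r = d r) (hne : ∀ r s, r ≠ s → d r * d s = 0) (hsum : ∑ r, d r = 1)
    (hcross : ∀ x r, g x * d r = d (R.lact x r) * g x) : Xi R →ₐ[ℂ] A :=
  SkewMonoidAlgebra.liftNCAlgHom (k := ℂ) (funLift d hself hne hsum) g fun {x y} => by
    change Fintype.linearCombination ℂ d (y • x) * g y = g y * Fintype.linearCombination ℂ d x
    rw [Fintype.linearCombination_apply, Fintype.linearCombination_apply, Finset.sum_mul,
      Finset.mul_sum]
    let σ : R.carrier ≃ R.carrier :=
      ⟨R.lact y, R.lact y⁻¹, R.lact_inv_lact y, R.lact_lact_inv y⟩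
    -- Reindexing by $r\mapsto y\triangleright r$ undoes the twist of $f$ by $y$, and the assumed
    -- cross relation then matches the two sums term by term.
    rw [← Equiv.sum_comp σ]
    refine Finset.sum_congr rfl fun r _ => ?_
    rw [Transversal.smul_fun_apply]
    change x (R.lact y⁻¹ (R.lact y r)) • d (R.lact y r) * g y = _
    rw [R.lact_inv_lact, smul_mul_assoc, ← hcross, mul_smul_comm]

section lift

variable {A : Type*} [Ring A] [Algebra ℂ A] (g : K →* A) (d : R.carrier → A)
    (hself : ∀ r, d r * d r = d r) (hne : ∀ r s, r ≠ s → d r * d s = 0) (hsum : ∑ r, d r = 1)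
    (hcross : ∀ x r, g x * d r = d (R.lact x r) * g x)

theorem lift_single (x : K) (f : R.carrier → ℂ) :
    lift g d hself hne hsum hcross (single R x f) = (∑ r, f r • d r) * g x :=
  (SkewMonoidAlgebra.liftNC_single (funLift d hself hne hsum : (R.carrier → ℂ) →+ A) g x f)

@[simp] theorem lift_grp (x : K) : lift g d hself hne hsum hcross (grp R x) = g x := by
  rw [grp_apply, lift_single]
  simp [hsum]

@[simp] theorem lift_delta (r : R.carrier) :
    lift g d hself hne hsum hcross (delta R r) = d r := by
  classical
  rw [delta, lift_single, map_one, mul_one, Finset.sum_eq_single r] <;> simp +contextual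

end lift

end Xi

end

noncomputable section

/-- Shaped for the pentagon-type axiom: three factors on one side and two on the other, each applied
in turn to a homogeneous tensor $t$. -/
theorem mul_eq_mul_of_chain {S : Type*} [Semigroup S] {x y z u v t t₁ t₂ t₃ s : S} (h₁ : z * t = t₁)
    (h₂ : y * t₁ = t₂) (h₃ : x * t₂ = t₃) (h₄ : v * t = s) (h₅ : u * s = t₃) :
    x * y * z * t = u * v * t := by
  rw [mul_assoc, h₁, mul_assoc, h₂, h₃, mul_assoc, h₄, h₅]

/-! ## Computing in tensor products of algebras -/

section TensorAlgebra

variable {A B C D E : Type*} [Ring A] [Algebra ℂ A] [Ring B] [Algebra ℂ B] [Ring C] [Algebra ℂ C]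
  [Ring D] [Algebra ℂ D] [Ring E] [Algebra ℂ E]

/-- Since $a\otimes w=(\mathrm{id}\otimes f)(a\otimes 1)\,(1\otimes w)$, multiplicativity reduces
the product to $T(a\otimes 1)$. -/
theorem tensorMap_right_mul (f : B →ₐ[ℂ] C) {T : A ⊗[ℂ] B} {a a' : A} {q : B}
    (h : T * a ⊗ₜ 1 = a' ⊗ₜ q) (w : C) :
    Algebra.TensorProduct.map (AlgHom.id ℂ A) f T * a ⊗ₜ w = a' ⊗ₜ (f q * w) := by
  have e : a ⊗ₜ[ℂ] w = Algebra.TensorProduct.map (AlgHom.id ℂ A) f (a ⊗ₜ 1) * 1 ⊗ₜ w := by simp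
  rw [e, ← mul_assoc, ← map_mul, h]
  simp

/-- In the intended case $f=\Delta$, the tensor $b\otimes c$ need not be in the image of $f$, but it
is fixed by some $f(p)$. Inserting that $f(p)$ brings $T(p\otimes d)$ inside the algebra map. -/
theorem tensorMap_left_mul (f : A →ₐ[ℂ] B ⊗[ℂ] C) {T : A ⊗[ℂ] D} {p p' : A} {b b' : B} {c c' : C}
    {d d' : D} (h : T * p ⊗ₜ d = p' ⊗ₜ d') (hp : f p * b ⊗ₜ c = b ⊗ₜ c)
    (hp' : f p' * b ⊗ₜ c = b' ⊗ₜ c') :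
    Algebra.TensorProduct.assoc ℂ ℂ ℂ B C D
      (Algebra.TensorProduct.map f (AlgHom.id ℂ D) T) * b ⊗ₜ (c ⊗ₜ d) = b' ⊗ₜ (c' ⊗ₜ d') := by
  have e : b ⊗ₜ[ℂ] (c ⊗ₜ[ℂ] d) = Algebra.TensorProduct.assoc ℂ ℂ ℂ B C D
      (Algebra.TensorProduct.map f (AlgHom.id ℂ D) (p ⊗ₜ d) * (b ⊗ₜ c) ⊗ₜ 1) := by
    simp [hp]
  rw [e, ← map_mul, ← mul_assoc, ← map_mul, h]
  simp [hp']

theorem tmul_one_assoc_mul {T : A ⊗[ℂ] (B ⊗[ℂ] C)} {a a' : A} {b b' : B} {c c' : C}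
    (h : T * a ⊗ₜ (b ⊗ₜ c) = a' ⊗ₜ (b' ⊗ₜ c')) (d : D) :
    Algebra.TensorProduct.map (AlgHom.id ℂ A) (Algebra.TensorProduct.assoc ℂ ℂ ℂ B C D).toAlgHom
        (Algebra.TensorProduct.assoc ℂ ℂ ℂ A (B ⊗[ℂ] C) D (T ⊗ₜ 1)) *
      a ⊗ₜ (b ⊗ₜ (c ⊗ₜ d)) = a' ⊗ₜ (b' ⊗ₜ (c' ⊗ₜ d)) := by
  have e : a ⊗ₜ[ℂ] (b ⊗ₜ[ℂ] (c ⊗ₜ[ℂ] d)) = Algebra.TensorProduct.map (AlgHom.id ℂ A)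
      (Algebra.TensorProduct.assoc ℂ ℂ ℂ B C D).toAlgHom
        (Algebra.TensorProduct.assoc ℂ ℂ ℂ A (B ⊗[ℂ] C) D ((a ⊗ₜ (b ⊗ₜ c)) ⊗ₜ d)) := by
    simp
  rw [e, ← map_mul, ← map_mul, Algebra.TensorProduct.tmul_mul_tmul, h, one_mul]
  simp

end TensorAlgebra

/-! ## The quasi-bialgebra structure of `Ξ(R,K)` -/

namespace Xi

variable {G : Type u} [Group G] {K : Subgroup G} {R : Transversal K}

/-- The condition $\delta_s a=a$ expresses that $a$ has degree $s$ for left multiplication. The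
lemmas below assume it instead of $a=\delta_s$ because it survives multiplication by $K$, with $s$
replaced by $x\triangleright s$. -/
theorem delta_mul_grp_mul {s : R.carrier} {a : Xi R} (ha : delta R s * a = a) (x : K) :
    delta R (R.lact x s) * (grp R x * a) = grp R x * a := by
  rw [← mul_assoc, ← grp_mul_delta, mul_assoc, ha]

theorem delta_mul_eq_zero {s : R.carrier} {a : Xi R} (ha : delta R s * a = a) {r : R.carrier}
    (h : r ≠ s) : delta R r * a = 0 := by
  rw [← ha, ← mul_assoc, delta_mul_of_ne h, zero_mul]

variable [Finite G]

theorem sum_delta₂ : ∑ r, ∑ s, delta R r ⊗ₜ[ℂ] delta R s = 1 := by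
  simp only [← TensorProduct.tmul_sum, ← TensorProduct.sum_tmul, sum_delta]
  rfl

theorem ext₂ {t t' : Xi R ⊗[ℂ] Xi R}
    (h : ∀ r s, t * delta R r ⊗ₜ delta R s = t' * delta R r ⊗ₜ delta R s) : t = t' := by
  rw [← mul_one t, ← mul_one t', ← sum_delta₂]
  simp only [Finset.mul_sum, h]

/-- By orthogonality only the term of index $s$ survives. Both $\Delta x$ and $\phi$ contain sums of
this kind, so on homogeneous tensors they act by a single term. -/
theorem sum_tmul_mul {A : Type*} [Ring A] [Algebra ℂ A] (f : R.carrier → A) {s : R.carrier}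
    {a : Xi R} (ha : delta R s * a = a) (w : A) :
    (∑ r, delta R r ⊗ₜ[ℂ] f r) * a ⊗ₜ w = a ⊗ₜ (f s * w) := by
  rw [Finset.sum_mul, Finset.sum_eq_single s]
  · rw [Algebra.TensorProduct.tmul_mul_tmul, ha]
  · intro r _ hr
    rw [Algebra.TensorProduct.tmul_mul_tmul, delta_mul_eq_zero ha hr, TensorProduct.zero_tmul]
  · simp

/-- Prepends one factor to a family summing to $1$, so the tests for three and four factors follow
from those for two and three. -/
theorem ext_tmul {A : Type*} [Ring A] [Algebra ℂ A] {ι : Type*} [Fintype ι] {d : ι → A}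
    (hd : ∑ i, d i = 1) {t t' : Xi R ⊗[ℂ] A}
    (h : ∀ r i, t * delta R r ⊗ₜ d i = t' * delta R r ⊗ₜ d i) : t = t' := by
  have e : ∑ r, ∑ i, delta R r ⊗ₜ[ℂ] d i = 1 := by
    simp only [← TensorProduct.tmul_sum, ← TensorProduct.sum_tmul, sum_delta, hd]
    rfl
  rw [← mul_one t, ← mul_one t', ← e]
  simp only [Finset.mul_sum, h]

theorem ext₃ {t t' : Xi R ⊗[ℂ] (Xi R ⊗[ℂ] Xi R)} (h : ∀ a b c,
    t * delta R a ⊗ₜ (delta R b ⊗ₜ delta R c) = t' * delta R a ⊗ₜ (delta R b ⊗ₜ delta R c)) :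
    t = t' :=
  ext_tmul (d := fun i : R.carrier × R.carrier => delta R i.1 ⊗ₜ delta R i.2)
    (by rw [Fintype.sum_prod_type, sum_delta₂]) fun a i => h a i.1 i.2

theorem sum_delta₃ :
    ∑ a, ∑ b, ∑ c, delta R a ⊗ₜ[ℂ] (delta R b ⊗ₜ[ℂ] delta R c) = 1 := by
  simp only [← TensorProduct.tmul_sum, ← TensorProduct.sum_tmul, sum_delta]
  rfl

theorem ext₄ {t t' : Xi R ⊗[ℂ] (Xi R ⊗[ℂ] (Xi R ⊗[ℂ] Xi R))} (h : ∀ a b c d,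
    t * delta R a ⊗ₜ (delta R b ⊗ₜ (delta R c ⊗ₜ delta R d)) =
      t' * delta R a ⊗ₜ (delta R b ⊗ₜ (delta R c ⊗ₜ delta R d))) :
    t = t' :=
  ext_tmul (d := fun i : R.carrier × R.carrier × R.carrier =>
      delta R i.1 ⊗ₜ (delta R i.2.1 ⊗ₜ delta R i.2.2))
    (by rw [Fintype.sum_prod_type]; simp only [Fintype.sum_prod_type]; rw [sum_delta₃])
    fun a i => h a i.1 i.2.1 i.2.2

variable (R) in
/-- `Δx = ∑ x δ_s ⊗ (x ◁ s)`. -/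
def comulGrp (x : K) : Xi R ⊗[ℂ] Xi R :=
  ∑ s, (grp R x * delta R s) ⊗ₜ[ℂ] grp R (R.ract x s)

open Classical in
/-- `Δδ_r`, the sum of the `δ_s ⊗ δ_t` with `s · t = r`. -/
def comulDelta (r : R.carrier) : Xi R ⊗[ℂ] Xi R :=
  ∑ s, ∑ t, if R.dot s t = r then delta R s ⊗ₜ[ℂ] delta R t else 0

/-- Nothing is asked of $b$, since the idempotents in $\Delta x$ sit in the first factor only. -/
theorem comulGrp_mul (x : K) {s : R.carrier} {a : Xi R} (ha : delta R s * a = a) (b : Xi R) :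
    comulGrp R x * a ⊗ₜ b = (grp R x * a) ⊗ₜ (grp R (R.ract x s) * b) := by
  have : comulGrp R x = (grp R x) ⊗ₜ 1 * ∑ s, delta R s ⊗ₜ[ℂ] grp R (R.ract x s) := by
    simp [comulGrp, Finset.mul_sum]
  rw [this, mul_assoc, sum_tmul_mul _ ha, Algebra.TensorProduct.tmul_mul_tmul, one_mul]

open Classical in
theorem comulDelta_mul (r : R.carrier) {s t : R.carrier} {a b : Xi R} (ha : delta R s * a = a)
    (hb : delta R t * b = b) :
    comulDelta r * a ⊗ₜ b = if R.dot s t = r then a ⊗ₜ[ℂ] b else 0 := by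
  have : comulDelta r = ∑ s, delta R s ⊗ₜ[ℂ] ∑ t, if R.dot s t = r then delta R t else 0 := by
    refine Finset.sum_congr rfl fun s _ => ?_
    rw [TensorProduct.tmul_sum]
    refine Finset.sum_congr rfl fun t _ => ?_
    split_ifs <;> simp
  rw [this, sum_tmul_mul _ ha, Finset.sum_mul, Finset.sum_eq_single t]
  · split_ifs
    · rw [hb]
    · simp
  · intro t' _ h
    split_ifs
    · exact delta_mul_eq_zero hb h
    · simp
  · simp

variable (R) in
/-- The coproduct of `Ξ(R,K)`. -/
def comul : Xi R →ₐ[ℂ] Xi R ⊗[ℂ] Xi R :=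
  lift (R := R)
    { toFun := comulGrp R
      map_one' := ext₂ fun r s => by
        rw [comulGrp_mul _ (delta_mul_self r), (R.lact_ract_one r).2]; simp
      -- Applying $y$ moves the first degree from $r$ to $y\triangleright r$, so the second factors
      -- agree by $(xy)\triangleleft r=(x\triangleleft(y\triangleright r))(y\triangleleft r)$.
      map_mul' x y := ext₂ fun r s => by
        rw [mul_assoc, comulGrp_mul _ (delta_mul_self r), comulGrp_mul _ (delta_mul_self r),
          comulGrp_mul _ (delta_mul_grp_mul (delta_mul_self r) y), (R.lact_ract_mul x y r).2,
          map_mul, map_mul, mul_assoc, mul_assoc] }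
    comulDelta
    (fun r => ext₂ fun s t => by
      rw [mul_assoc, comulDelta_mul _ (delta_mul_self s) (delta_mul_self t)]
      split_ifs with h
      · rw [comulDelta_mul _ (delta_mul_self s) (delta_mul_self t), if_pos h]
      · rw [mul_zero])
    (fun r r' hr => ext₂ fun s t => by
      rw [mul_assoc, comulDelta_mul _ (delta_mul_self s) (delta_mul_self t), zero_mul]
      split_ifs with h
      · rw [comulDelta_mul _ (delta_mul_self s) (delta_mul_self t), if_neg (h ▸ hr.symm)]
      · rw [mul_zero])
    (ext₂ fun s t => by
      rw [Finset.sum_mul, Finset.sum_congr rfl fun r _ =>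
        comulDelta_mul r (delta_mul_self s) (delta_mul_self t)]
      simp)
    -- The cross relation: $\Delta x$ carries degrees $(s,t)$ to $(x\triangleright s,(x\triangleleft
    -- s)\triangleright t)$, whose product is $x\triangleright(s\cdot t)$. As $x\triangleright$ is
    -- injective, this is $x\triangleright r$ exactly when $s\cdot t=r$.
    (fun x r => ext₂ fun s t => by
      change comulGrp R x * _ * _ = _ * comulGrp R x * _
      rw [mul_assoc, mul_assoc, comulDelta_mul _ (delta_mul_self s) (delta_mul_self t),
        comulGrp_mul _ (delta_mul_self s), comulDelta_mul _
          (delta_mul_grp_mul (delta_mul_self s) x) (delta_mul_grp_mul (delta_mul_self t) _),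
        ← (R.lact_ract_dot x s t).1]
      by_cases h : R.dot s t = r
      · rw [if_pos h, if_pos (congrArg _ h), comulGrp_mul _ (delta_mul_self s)]
      · rw [if_neg h, if_neg fun h' => h (R.lact_injective x h'), mul_zero])

@[simp] theorem comul_grp (x : K) : comul R (grp R x) = comulGrp R x := lift_grp ..

@[simp] theorem comul_delta (r : R.carrier) : comul R (delta R r) = comulDelta r := lift_delta ..

/-- Supplies the element $p=\delta_{s\cdot t}$ required by `tensorMap_left_mul` for $f=\Delta$. -/
theorem comul_delta_dot_mul {s t : R.carrier} {a b : Xi R} (ha : delta R s * a = a)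
    (hb : delta R t * b = b) : comul R (delta R (R.dot s t)) * a ⊗ₜ b = a ⊗ₜ b := by
  rw [comul_delta, comulDelta_mul _ ha hb, if_pos rfl]

open Classical in
variable (R) in
/-- The counit of `Ξ(R,K)`. -/
def counit : Xi R →ₐ[ℂ] ℂ :=
  lift (R := R) 1 (fun r => if r = R.e then 1 else 0) (by simp)
    (fun r s h => by
      by_cases hr : r = R.e
      · rw [if_neg (c := s = R.e) fun hs => h (hr.trans hs.symm), mul_zero]
      · rw [if_neg hr, zero_mul])
    (by simp) fun x r => by
      -- Compatibility of the counit with the cross relations: $K$ fixes $e$ and permutes the other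
      -- elements of $R$.
      have : R.lact x r = R.e ↔ r = R.e := by
        conv_lhs => rw [← (R.lact_ract_e x).1]
        exact (R.lact_injective x).eq_iff
      simp [this]

@[simp] theorem counit_grp (x : K) : counit R (grp R x) = 1 := lift_grp ..

open Classical in
@[simp] theorem counit_delta (r : R.carrier) :
    counit R (delta R r) = if r = R.e then 1 else 0 := lift_delta ..

variable (R) in
/-- The element `∑ δ_r ⊗ δ_s ⊗ κ(r,s)` of `Ξ(R,K)⊗Ξ(R,K)⊗Ξ(R,K)`. -/
def cochain (κ : R.carrier → R.carrier → K) : Xi R ⊗[ℂ] (Xi R ⊗[ℂ] Xi R) :=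
  ∑ r, ∑ s, delta R r ⊗ₜ[ℂ] (delta R s ⊗ₜ[ℂ] grp R (κ r s))

theorem cochain_eq (κ : R.carrier → R.carrier → K) :
    cochain R κ = ∑ r, delta R r ⊗ₜ[ℂ] ∑ s, delta R s ⊗ₜ[ℂ] grp R (κ r s) := by
  simp only [cochain, TensorProduct.tmul_sum]

theorem cochain_mul (κ : R.carrier → R.carrier → K) {r s : R.carrier} {a b : Xi R}
    (ha : delta R r * a = a) (hb : delta R s * b = b) (c : Xi R) :
    cochain R κ * a ⊗ₜ (b ⊗ₜ c) = a ⊗ₜ (b ⊗ₜ (grp R (κ r s) * c)) := by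
  rw [cochain_eq, sum_tmul_mul _ ha, sum_tmul_mul _ hb]

variable (R) in
/-- The associator `φ = ∑ δ_r ⊗ δ_s ⊗ τ(r,s)⁻¹` of `Ξ(R,K)`. -/
def phi : (Xi R ⊗[ℂ] (Xi R ⊗[ℂ] Xi R))ˣ where
  val := cochain R fun r s => (R.tau r s)⁻¹
  inv := cochain R R.tau
  val_inv := ext₃ fun a b c => by
    rw [mul_assoc, cochain_mul _ (delta_mul_self a) (delta_mul_self b),
      cochain_mul _ (delta_mul_self a) (delta_mul_self b), ← mul_assoc, grp_inv_mul, one_mul,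
      one_mul]
  inv_val := ext₃ fun a b c => by
    rw [mul_assoc, cochain_mul _ (delta_mul_self a) (delta_mul_self b),
      cochain_mul _ (delta_mul_self a) (delta_mul_self b), ← mul_assoc, grp_mul_inv, one_mul,
      one_mul]

theorem phi_mul {r s : R.carrier} {a b : Xi R}
    (ha : delta R r * a = a) (hb : delta R s * b = b) (c : Xi R) :
    (phi R : Xi R ⊗[ℂ] (Xi R ⊗[ℂ] Xi R)) * a ⊗ₜ (b ⊗ₜ c) =
      a ⊗ₜ (b ⊗ₜ (grp R (R.tau r s)⁻¹ * c)) :=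
  cochain_mul _ ha hb c

open Classical in
theorem counit_left (h : Xi R) : Algebra.TensorProduct.lid ℂ (Xi R)
    (Algebra.TensorProduct.map (counit R) (AlgHom.id ℂ (Xi R)) (comul R h)) = h := by
  have : ((Algebra.TensorProduct.lid ℂ (Xi R)).toAlgHom.comp
      (Algebra.TensorProduct.map (counit R) (AlgHom.id ℂ (Xi R)))).comp (comul R) =
      AlgHom.id ℂ (Xi R) :=
    algHom_ext (fun x => by simp [comulGrp, (R.lact_ract_e x).2])
      (fun r => by
        suffices (∑ s, ∑ t, if R.dot s t = r then if s = R.e then delta R t else 0 else 0) =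
            delta R r by simpa [comulDelta, apply_ite, ite_smul] using this
        rw [Finset.sum_eq_single R.e (fun s _ hs => by simp [hs]) (by simp)]
        simp [(R.e_dot_tau _).1])
  exact DFunLike.congr_fun this h

open Classical in
theorem counit_right (h : Xi R) : Algebra.TensorProduct.rid ℂ ℂ (Xi R)
    (Algebra.TensorProduct.map (AlgHom.id ℂ (Xi R)) (counit R) (comul R h)) = h := by
  have : ((Algebra.TensorProduct.rid ℂ ℂ (Xi R)).toAlgHom.comp
      (Algebra.TensorProduct.map (AlgHom.id ℂ (Xi R)) (counit R))).comp (comul R) =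
      AlgHom.id ℂ (Xi R) :=
    algHom_ext (fun x => by simp [comulGrp, ← Finset.mul_sum, sum_delta])
      (fun r => by
        suffices (∑ s, ∑ t, if R.dot s t = r then if t = R.e then delta R s else 0 else 0) =
            delta R r by simpa [comulDelta, apply_ite, ite_smul] using this
        rw [Finset.sum_comm, Finset.sum_eq_single R.e (fun s _ hs => by simp [hs]) (by simp)]
        simp [(R.dot_tau_e _).1])
  exact DFunLike.congr_fun this h

theorem coassoc_grp_left (x : K) {r s : R.carrier} {a b : Xi R} (ha : delta R r * a = a)
    (hb : delta R s * b = b) (c : Xi R) :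
    Algebra.TensorProduct.map (AlgHom.id ℂ (Xi R)) (comul R) (comul R (grp R x)) *
      a ⊗ₜ (b ⊗ₜ c) = (grp R x * a) ⊗ₜ
        ((grp R (R.ract x r) * b) ⊗ₜ (grp R (R.ract (R.ract x r) s) * c)) := by
  rw [tensorMap_right_mul (comul R) (by rw [comul_grp]; exact comulGrp_mul x ha 1), mul_one,
    comul_grp, comulGrp_mul _ hb]

/-- The first two factors together have degree $r\cdot s$, hence $x\triangleleft(r\cdot s)$ in the
third, where the other bracketing gives $(x\triangleleft r)\triangleleft s$. The discrepancy is what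
$\phi$ corrects. -/
theorem coassoc_grp_right (x : K) {r s : R.carrier} {a b : Xi R} (ha : delta R r * a = a)
    (hb : delta R s * b = b) (c : Xi R) :
    Algebra.TensorProduct.assoc ℂ ℂ ℂ (Xi R) (Xi R) (Xi R)
        (Algebra.TensorProduct.map (comul R) (AlgHom.id ℂ (Xi R)) (comul R (grp R x))) *
      a ⊗ₜ (b ⊗ₜ c) = (grp R x * a) ⊗ₜ
        ((grp R (R.ract x r) * b) ⊗ₜ (grp R (R.ract x (R.dot r s)) * c)) :=
  tensorMap_left_mul (comul R) (by rw [comul_grp]; exact comulGrp_mul x (delta_mul_self _) c)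
    (comul_delta_dot_mul ha hb)
    (by rw [map_mul, mul_assoc, comul_delta_dot_mul ha hb, comul_grp, comulGrp_mul _ ha])

theorem coassoc_delta_left (d : R.carrier) {r s t : R.carrier} {a b c : Xi R}
    (ha : delta R r * a = a) (hb : delta R s * b = b) (hc : delta R t * c = c)
    [DecidableEq R.carrier] :
    Algebra.TensorProduct.map (AlgHom.id ℂ (Xi R)) (comul R) (comul R (delta R d)) *
      a ⊗ₜ (b ⊗ₜ c) = if R.dot r (R.dot s t) = d then a ⊗ₜ (b ⊗ₜ c) else 0 := by
  -- The idempotent $\Delta(\delta_{s\cdot t})$ fixes $b\otimes c$, so inserting it costs nothing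
  -- and exposes an argument of $\mathrm{id}\otimes\Delta$.
  have e : a ⊗ₜ[ℂ] (b ⊗ₜ[ℂ] c) = Algebra.TensorProduct.map (AlgHom.id ℂ (Xi R)) (comul R)
      (a ⊗ₜ delta R (R.dot s t)) * 1 ⊗ₜ (b ⊗ₜ c) := by
    simp [-comul_delta, comul_delta_dot_mul hb hc]
  conv_lhs => rw [e]
  rw [← mul_assoc, ← map_mul, comul_delta, comulDelta_mul _ ha (delta_mul_self _)]
  split_ifs
  · exact e.symm
  · simp

theorem coassoc_delta_right (d : R.carrier) {r s t : R.carrier} {a b c : Xi R}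
    (ha : delta R r * a = a) (hb : delta R s * b = b) (hc : delta R t * c = c)
    [DecidableEq R.carrier] :
    Algebra.TensorProduct.assoc ℂ ℂ ℂ (Xi R) (Xi R) (Xi R)
        (Algebra.TensorProduct.map (comul R) (AlgHom.id ℂ (Xi R)) (comul R (delta R d))) *
      a ⊗ₜ (b ⊗ₜ c) = if R.dot (R.dot r s) t = d then a ⊗ₜ (b ⊗ₜ c) else 0 := by
  have e : a ⊗ₜ[ℂ] (b ⊗ₜ[ℂ] c) = Algebra.TensorProduct.assoc ℂ ℂ ℂ (Xi R) (Xi R) (Xi R)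
      (Algebra.TensorProduct.map (comul R) (AlgHom.id ℂ (Xi R)) (delta R (R.dot r s) ⊗ₜ c) *
        (a ⊗ₜ b) ⊗ₜ 1) := by
    simp [-comul_delta, comul_delta_dot_mul ha hb]
  conv_lhs => rw [e]
  rw [← map_mul, ← mul_assoc, ← map_mul, comul_delta, comulDelta_mul _ (delta_mul_self _) hc]
  split_ifs
  · exact e.symm
  · simp

/-- Quasi-coassociativity as an intertwining relation. In this form the set of good $h$ is visibly
closed under products, so generators suffice. -/
theorem coassoc_mul_phi (h : Xi R) :
    Algebra.TensorProduct.map (AlgHom.id ℂ (Xi R)) (comul R) (comul R h) *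
        (phi R : Xi R ⊗[ℂ] (Xi R ⊗[ℂ] Xi R)) =
      phi R * Algebra.TensorProduct.assoc ℂ ℂ ℂ (Xi R) (Xi R) (Xi R)
        (Algebra.TensorProduct.map (comul R) (AlgHom.id ℂ (Xi R)) (comul R h)) := by
  classical
  induction h using induction_on with
  | hgrp x =>
    refine ext₃ fun a b c => ?_
    have ha := delta_mul_self a
    have hb := delta_mul_self b
    rw [mul_assoc, phi_mul ha hb, coassoc_grp_left x ha hb, mul_assoc, coassoc_grp_right x ha hb,
      phi_mul (delta_mul_grp_mul ha x) (delta_mul_grp_mul hb _), ← mul_assoc, ← mul_assoc,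
      ← map_mul, ← map_mul]
    -- The $K$-part of `lact_ract_dot`, rearranged to compare the third factors.
    have e : R.ract (R.ract x a) b * (R.tau a b)⁻¹ =
        (R.tau (R.lact x a) (R.lact (R.ract x a) b))⁻¹ * R.ract x (R.dot a b) := by
      rw [eq_inv_mul_iff_mul_eq, ← mul_assoc, ← (R.lact_ract_dot x a b).2, mul_inv_cancel_right]
    rw [e]
  | hdelta r =>
    refine ext₃ fun a b c => ?_
    have ha := delta_mul_self a
    have hb := delta_mul_self b
    have hc := delta_mul_self c
    -- After $\phi$ the third degree is $\tau(a,b)^{-1}\triangleright c$, and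
    -- $a\cdot(b\cdot(\tau(a,b)^{-1}\triangleright c))=(a\cdot b)\cdot c$, so both sides test the
    -- same condition.
    rw [mul_assoc, phi_mul ha hb, coassoc_delta_left r ha hb (delta_mul_grp_mul hc _), mul_assoc,
      coassoc_delta_right r ha hb hc, (R.dot_tau_assoc _ _ _).1, R.lact_lact_inv]
    split_ifs
    · rw [phi_mul ha hb]
    · rw [mul_zero]
  | add a b ha hb => simp only [map_add, add_mul, mul_add, ha, hb]
  | mul a b ha hb => rw [map_mul, map_mul, mul_assoc, hb, ← mul_assoc, ha, mul_assoc, map_mul,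
      map_mul]
  | smul c a ha => simp only [map_smul, smul_mul_assoc, mul_smul_comm, ha]

/-- Fixes only the first degree of $\phi$, leaving the other two factors as a sum to which an
algebra map can still be applied by `tensorMap_right_mul`. -/
theorem phi_mul_tmul_one {r : R.carrier} {a : Xi R} (ha : delta R r * a = a) :
    (phi R : Xi R ⊗[ℂ] (Xi R ⊗[ℂ] Xi R)) * a ⊗ₜ 1 =
      a ⊗ₜ ∑ s, delta R s ⊗ₜ[ℂ] grp R (R.tau r s)⁻¹ := by
  change cochain R _ * _ = _
  rw [cochain_eq, sum_tmul_mul _ ha, mul_one]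

/-- Write $c'=\tau(a,b)^{-1}\triangleright c$. On
$\delta_a\otimes\delta_b\otimes\delta_c\otimes\delta_d$ both sides multiply the third factor by
$\tau(a,b)^{-1}$. On the fourth the left side gives $\tau(b,c')^{-1}\tau(a,b\cdot c')^{-1}$ and the
right side $(\tau(a,b)^{-1}\triangleleft c)\,\tau(a\cdot b,c)^{-1}$. These are equal by the $K$-part
of `dot_tau_assoc` at $(a,b,c')$, inverted. -/
theorem cocycle :
    ((1 : Xi R) ⊗ₜ[ℂ] (phi R : Xi R ⊗[ℂ] (Xi R ⊗[ℂ] Xi R)) :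
        Xi R ⊗[ℂ] (Xi R ⊗[ℂ] (Xi R ⊗[ℂ] Xi R))) *
      Algebra.TensorProduct.map (AlgHom.id ℂ (Xi R))
        ((Algebra.TensorProduct.assoc ℂ ℂ ℂ (Xi R) (Xi R) (Xi R)).toAlgHom.comp
          (Algebra.TensorProduct.map (comul R) (AlgHom.id ℂ (Xi R))))
        (phi R : Xi R ⊗[ℂ] (Xi R ⊗[ℂ] Xi R)) *
      Algebra.TensorProduct.map (AlgHom.id ℂ (Xi R))
        (Algebra.TensorProduct.assoc ℂ ℂ ℂ (Xi R) (Xi R) (Xi R)).toAlgHom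
        (Algebra.TensorProduct.assoc ℂ ℂ ℂ (Xi R) (Xi R ⊗[ℂ] Xi R) (Xi R)
          ((phi R : Xi R ⊗[ℂ] (Xi R ⊗[ℂ] Xi R)) ⊗ₜ[ℂ] (1 : Xi R))) =
    Algebra.TensorProduct.map (AlgHom.id ℂ (Xi R))
        (Algebra.TensorProduct.map (AlgHom.id ℂ (Xi R)) (comul R))
        (phi R : Xi R ⊗[ℂ] (Xi R ⊗[ℂ] Xi R)) *
      Algebra.TensorProduct.assoc ℂ ℂ ℂ (Xi R) (Xi R) (Xi R ⊗[ℂ] Xi R)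
        (Algebra.TensorProduct.map (comul R) (AlgHom.id ℂ (Xi R ⊗[ℂ] Xi R))
          (phi R : Xi R ⊗[ℂ] (Xi R ⊗[ℂ] Xi R))) := by
  refine ext₄ fun a b c d => ?_
  have ha := delta_mul_self a
  have hb := delta_mul_self b
  have hc := delta_mul_self c
  have hc' := delta_mul_grp_mul hc (R.tau a b)⁻¹
  have e₁ := tmul_one_assoc_mul (phi_mul ha hb (delta R c)) (delta R d)
  have e₂ := tensorMap_right_mul
    ((Algebra.TensorProduct.assoc ℂ ℂ ℂ (Xi R) (Xi R) (Xi R)).toAlgHom.comp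
      (Algebra.TensorProduct.map (comul R) (AlgHom.id ℂ (Xi R)))) (phi_mul_tmul_one ha)
      (delta R b ⊗ₜ ((grp R (R.tau a b)⁻¹ * delta R c) ⊗ₜ delta R d))
  have e₃ := tensorMap_left_mul (comul R)
    (sum_tmul_mul (fun s => grp R (R.tau a s)⁻¹) (delta_mul_self _) (delta R d))
    (comul_delta_dot_mul hb hc') (comul_delta_dot_mul hb hc')
  have e₄ := tensorMap_left_mul (comul R)
    (phi_mul (delta_mul_self (R.dot a b)) hc (delta R d))
    (comul_delta_dot_mul ha hb) (comul_delta_dot_mul ha hb)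
  have e₅ := tensorMap_right_mul (Algebra.TensorProduct.map (AlgHom.id ℂ (Xi R)) (comul R))
    (phi_mul_tmul_one ha)
    (delta R b ⊗ₜ (delta R c ⊗ₜ (grp R (R.tau (R.dot a b) c)⁻¹ * delta R d)))
  have e₆ := tensorMap_right_mul (comul R)
    (sum_tmul_mul (fun s => grp R (R.tau a s)⁻¹) hb 1)
    (delta R c ⊗ₜ (grp R (R.tau (R.dot a b) c)⁻¹ * delta R d))
  have key := (R.dot_tau_assoc a b (R.lact (R.tau a b)⁻¹ c)).2
  rw [R.lact_lact_inv] at key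
  -- The cocycle identity produces $\tau(a,b)\triangleleft c'$, while the coproduct of
  -- $\tau(a,b)^{-1}$ produces $\tau(a,b)^{-1}\triangleleft c$; the two are inverse to each other.
  have key' : R.ract (R.tau a b) (R.lact (R.tau a b)⁻¹ c) = (R.ract (R.tau a b)⁻¹ c)⁻¹ := by
    have := R.ract_inv_lact (R.tau a b)⁻¹ c
    rwa [inv_inv] at this
  rw [key'] at key
  have f₂ := e₂.trans (congrArg (delta R a ⊗ₜ[ℂ] ·) e₃)
  have f₅ := e₅.trans (congrArg (delta R a ⊗ₜ[ℂ] ·) e₆)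
  rw [mul_one, comul_grp, comulGrp_mul _ hc] at f₅
  refine mul_eq_mul_of_chain e₁ f₂ ?_ e₄ f₅
  rw [Algebra.TensorProduct.tmul_mul_tmul, one_mul, phi_mul hb hc', ← mul_assoc, ← map_mul,
    ← mul_inv_rev, key, mul_inv_rev, inv_inv, map_mul, mul_assoc]

/-- The counit kills every term except $s=e$, and $\tau(r,e)=1$. -/
theorem counit_mid : Algebra.TensorProduct.map (AlgHom.id ℂ (Xi R))
      ((Algebra.TensorProduct.lid ℂ (Xi R)).toAlgHom.comp
        (Algebra.TensorProduct.map (counit R) (AlgHom.id ℂ (Xi R))))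
      (phi R : Xi R ⊗[ℂ] (Xi R ⊗[ℂ] Xi R)) = 1 := by
  change Algebra.TensorProduct.map _ _ (cochain R _) = 1
  simp [cochain, (R.dot_tau_e _).2, ← TensorProduct.tmul_sum, ← TensorProduct.sum_tmul, sum_delta,
    Algebra.TensorProduct.one_def]

variable (R) in
/-- `Ξ(R,K)` is a quasi-bialgebra. -/
abbrev quasiBialgebra : QuasiBialgebra (Xi R) where
  comul := comul R
  counit := counit R
  assoc := phi R
  counit_left := counit_left
  counit_right := counit_right
  coassoc h := by rw [← coassoc_mul_phi, Units.mul_inv_cancel_right]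
  cocycle := cocycle
  counit_mid := counit_mid

end Xi

end

noncomputable section

/-! ### Factors of products with an element of K -/

namespace Transversal

variable {G : Type u} [Group G] {K : Subgroup G} (R : Transversal K)

/-- Right multiplication stays in the coset $gK$: the $R$-part survives passage to coinvariants, and
the $K$-part records the position within the coset. -/
theorem rPart_kPart_mul_right (g : G) (y : K) :
    R.rPart (g * y) = R.rPart g ∧ R.kPart (g * y) = R.kPart g * y :=
  R.factor_unique (by
    rw [rPart_mul_kPart, Subgroup.coe_mul, ← mul_assoc, rPart_mul_kPart])

/-- The left action of $K$ on cosets is $\triangleright$, and the change of position within the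
coset is the factor $x\triangleleft|v|$ in the definition of $F(V)$. -/
theorem rPart_kPart_mul_left (x : K) (g : G) :
    R.rPart (x * g) = R.lact x (R.rPart g) ∧
      R.kPart (x * g) = R.ract x (R.rPart g) * R.kPart g :=
  R.factor_unique (by
    rw [rPart_mul_kPart, Subgroup.coe_mul, ← mul_assoc, lact_mul_ract, mul_assoc, rPart_mul_kPart])

end Transversal

/-! ## The functor is fully faithful -/

namespace AlgMod

variable {G : Type u} [Group G] {K : Subgroup G} {R : Transversal K}

section

variable (V : AlgMod.{u, w} (Xi R))

/-- The linear map `v ⊗ z ↦ v`. -/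
def forgetK : V.carrier ⊗[ℂ] (K →₀ ℂ) →ₗ[ℂ] V.carrier :=
  (TensorProduct.rid ℂ V.carrier).toLinearMap ∘ₗ
    TensorProduct.map LinearMap.id (Finsupp.linearCombination ℂ fun _ => (1 : ℂ))

@[simp] theorem forgetK_tmul (v : V.carrier) (z : K) :
    forgetK V (v ⊗ₜ Finsupp.single z 1) = v := by
  simp [forgetK]

theorem forgetK_right (y : K) (t : V.carrier ⊗[ℂ] (K →₀ ℂ)) :
    forgetK V (TensorProduct.map LinearMap.id (Finsupp.lmapDomain ℂ ℂ (· * y)) t) =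
      forgetK V t := by
  have : forgetK V ∘ₗ TensorProduct.map LinearMap.id (Finsupp.lmapDomain ℂ ℂ (· * y)) =
      forgetK V :=
    TensorProduct.ext (LinearMap.ext fun v => Finsupp.lhom_ext' fun z => LinearMap.ext_ring (by
      simp))
  exact LinearMap.congr_fun this t

theorem forgetK_mem_grade {r : R.carrier} {t : V.carrier ⊗[ℂ] (K →₀ ℂ)}
    (ht : t ∈ V.tensorDeg r) : forgetK V t ∈ V.grade r := by
  refine (tensorDeg_le (S := (V.grade r).comap (forgetK V)) ?_) ht
  intro s v z h hv
  obtain ⟨rfl, -⟩ := R.factor_unique (r := s) (s := r) (x := z) (y := 1) (by simpa using h)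
  simpa using hv

/-- If $sz=r$ with $r,s\in R$ then $z=1$ by uniqueness, so elements of degree in $R$ lie in
$V\otimes 1$. This is what makes $F$ full. -/
theorem forgetK_tmul_one {r : R.carrier} {t : V.carrier ⊗[ℂ] (K →₀ ℂ)}
    (ht : t ∈ V.tensorDeg r) : forgetK V t ⊗ₜ Finsupp.single 1 1 = t := by
  refine (tensorDeg_le (S := LinearMap.eqLocus
    ((TensorProduct.mk ℂ V.carrier (K →₀ ℂ)).flip (Finsupp.single 1 1) ∘ₗ forgetK V)
      LinearMap.id) ?_) ht
  intro s v z h hv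
  obtain ⟨-, rfl⟩ := R.factor_unique (r := s) (s := r) (x := z) (y := 1) (by simpa using h)
  simp [LinearMap.mem_eqLocus]

theorem right_tmul_one (v : V.carrier) (z : K) :
    TensorProduct.map LinearMap.id (Finsupp.lmapDomain ℂ ℂ (· * z))
      (v ⊗ₜ[ℂ] Finsupp.single (1 : K) (1 : ℂ)) = v ⊗ₜ[ℂ] Finsupp.single z (1 : ℂ) := by
  simp

end

variable [Finite G]

theorem forgetK_left (V : AlgMod.{u, w} (Xi R)) (x : K) (t : V.carrier ⊗[ℂ] (K →₀ ℂ)) :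
    forgetK V (leftLin V x t) = V.act (Xi.grp R x) (forgetK V t) := by
  have : forgetK V ∘ₗ leftLin V x = V.act (Xi.grp R x) ∘ₗ forgetK V :=
    V.grade_ext fun r v z hv => by simp [leftLin_tmul x hv]
  exact LinearMap.congr_fun this t

/-- Linear maps out of a module agree if they agree on homogeneous elements. -/
theorem hom_grade_ext (V : AlgMod.{u, w} (Xi R)) {E : Type*} [AddCommGroup E] [Module ℂ E]
    {f g : V.carrier →ₗ[ℂ] E} (h : ∀ (r : R.carrier) v, v ∈ V.grade r → f v = g v) : f = g :=
  LinearMap.ext fun v => by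
    rw [← sum_delta_apply v, map_sum, map_sum]
    exact Finset.sum_congr rfl fun r _ => h r _ (delta_mem_grade r v)

/-- A linear map that preserves the degree and commutes with `K` is a map of `Ξ(R,K)`-modules. -/
def homOfGrade {V W : AlgMod.{u, w} (Xi R)} (f : V.carrier →ₗ[ℂ] W.carrier)
    (hgrp : ∀ x v, f (V.act (Xi.grp R x) v) = W.act (Xi.grp R x) (f v))
    (hgrade : ∀ (r : R.carrier) v, v ∈ V.grade r → f v ∈ W.grade r) : V ⟶ W where
  toLin := f
  comm h v := by
    induction h using Xi.induction_on generalizing v with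
    | hgrp x => exact hgrp x v
    | hdelta r =>
      classical
      have : f ∘ₗ V.act (Xi.delta R r) = W.act (Xi.delta R r) ∘ₗ f :=
        V.hom_grade_ext fun s v hv => by
          rw [LinearMap.comp_apply, LinearMap.comp_apply, delta_of_mem_grade hv,
            delta_of_mem_grade (hgrade s v hv)]
          split_ifs <;> simp
      exact LinearMap.congr_fun this v
    | add a b ha hb => simp only [map_add, LinearMap.add_apply, ha, hb]
    | mul a b ha hb => simp only [map_mul, Module.End.mul_apply, ha, hb]
    | smul c a ha => simp only [map_smul, LinearMap.smul_apply, ha]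

end AlgMod

section

variable {G : Type u} [Group G] [Finite G] {K : Subgroup G} (R : Transversal K)

/-- $f$ is read off from $f\otimes\mathrm{id}$ by evaluating at $v\otimes 1$ and dropping the factor
in $\mathbb{C}K$. -/
theorem bimodFunctor_faithful : (bimodFunctor.{u, w} R).Faithful where
  map_injective {V W} f g h := AlgMod.hom_ext (LinearMap.ext fun v => by
    have h1 : TensorProduct.map f.toLin LinearMap.id = TensorProduct.map g.toLin LinearMap.id :=
      congrArg GrBimod.Hom.toLin h
    have h2 := congrArg (AlgMod.forgetK W)
      (LinearMap.congr_fun h1 (v ⊗ₜ[ℂ] Finsupp.single (1 : K) (1 : ℂ)))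
    simpa using h2)

theorem bimodFunctor_full : (bimodFunctor.{u, w} R).Full where
  map_surjective {V W} h := by
    let l : V.carrier ⊗[ℂ] (K →₀ ℂ) →ₗ[ℂ] W.carrier ⊗[ℂ] (K →₀ ℂ) := h.toLin
    have hl : ∀ x t, l (AlgMod.leftLin V x t) = AlgMod.leftLin W x (l t) := h.comm_left
    have hr : ∀ (y : K) t,
        l (TensorProduct.map LinearMap.id (Finsupp.lmapDomain ℂ ℂ (· * y)) t) =
        TensorProduct.map LinearMap.id (Finsupp.lmapDomain ℂ ℂ (· * y)) (l t) := h.comm_right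
    have hd : ∀ g t, t ∈ V.tensorDeg g → l t ∈ W.tensorDeg g := h.map_deg
    have hd1 : ∀ (r : R.carrier) v, v ∈ V.grade r →
        l (v ⊗ₜ Finsupp.single 1 1) ∈ W.tensorDeg r := fun r v hv =>
      hd _ _ (by simpa using AlgMod.tmul_mem_tensorDeg hv 1)
    let f : V.carrier →ₗ[ℂ] W.carrier := AlgMod.forgetK W ∘ₗ l ∘ₗ
      (TensorProduct.mk ℂ V.carrier (K →₀ ℂ)).flip (Finsupp.single 1 1)
    -- By right equivariance $z$ may replace $1$ in the definition of $f$. This freedom is needed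
    -- because the left action does not preserve $V\otimes 1$.
    have hf : ∀ v z, AlgMod.forgetK W (l (v ⊗ₜ Finsupp.single z 1)) = f v := fun v z => by
      rw [← AlgMod.right_tmul_one, hr, AlgMod.forgetK_right]
      rfl
    have hgrp : ∀ x v, f (V.act (Xi.grp R x) v) = W.act (Xi.grp R x) (f v) := fun x => by
      refine LinearMap.congr_fun (f := f ∘ₗ V.act (Xi.grp R x)) (g := W.act (Xi.grp R x) ∘ₗ f)
        (V.hom_grade_ext fun r v hv => ?_)
      change f _ = W.act _ (f v)
      -- The value $(x\triangleleft r)1$ is chosen so that the argument of $l$ becomes $x.(v\otimes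
      -- 1)$.
      rw [← hf _ (R.ract x r * 1),
        ← AlgMod.leftLin_tmul x hv, hl, AlgMod.forgetK_left, hf]
    refine ⟨AlgMod.homOfGrade f hgrp fun r v hv => AlgMod.forgetK_mem_grade W (hd1 r v hv),
      GrBimod.hom_ext ?_⟩
    change TensorProduct.map f LinearMap.id = l
    refine V.grade_ext fun r v z hv => ?_
    -- Here $v\otimes z=(v\otimes 1).z$, and $l(v\otimes 1)$ has degree in $R$, so it equals
    -- $f(v)\otimes 1$.
    rw [← AlgMod.right_tmul_one V v z, hr, ← AlgMod.forgetK_tmul_one W (hd1 r v hv), hf]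
    simp

end

/-! ## The functor is essentially surjective -/

namespace GrBimod

open MulOpposite (op)

variable {G : Type u} [Group G] {K : Subgroup G} (M : GrBimod.{u, w} K)

/-- The projection to the component of degree `g`. -/
def proj (g : G) : Module.End ℂ M.carrier := M.exists_proj.choose g

open Classical in
theorem proj_apply (g : G) {h : G} {m : M.carrier} (hm : m ∈ M.deg h) :
    M.proj g m = if g = h then m else 0 :=
  M.exists_proj.choose_spec g h m hm

/-- Linear maps agree if they agree on homogeneous elements. -/
theorem hom_deg_ext {E : Type*} [AddCommGroup E] [Module ℂ E] {f f' : M.carrier →ₗ[ℂ] E}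
    (h : ∀ g m, m ∈ M.deg g → f m = f' m) : f = f' :=
  LinearMap.ext fun m => by
    induction m using M.deg_induction with
    | hom g m hm => exact h g m hm
    | add a b ha hb => rw [map_add, map_add, ha, hb]

/-- The subspace spanned by the elements `m.y - m`. -/
def augmentation : Submodule ℂ M.carrier :=
  Submodule.span ℂ {t | ∃ (m : M.carrier) (y : K), t = M.right (op y) m - m}

variable {M}

theorem mkQ_right (y : K) (m : M.carrier) :
    M.augmentation.mkQ (M.right (op y) m) = M.augmentation.mkQ m :=
  (Submodule.Quotient.eq _).2 (Submodule.subset_span ⟨m, y, rfl⟩)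

/-- A linear map that is invariant under the right action descends to the coinvariants. -/
theorem augmentation_le_ker {E : Type*} [AddCommGroup E] [Module ℂ E] {f : M.carrier →ₗ[ℂ] E}
    (h : ∀ y m, f (M.right (op y) m) = f m) : M.augmentation ≤ LinearMap.ker f := by
  rw [augmentation, Submodule.span_le]
  rintro _ ⟨m, y, rfl⟩
  simp [h]

theorem coinv_ext {E : Type*} [AddCommGroup E] [Module ℂ E]
    {f f' : (M.carrier ⧸ M.augmentation) →ₗ[ℂ] E}
    (h : ∀ g m, m ∈ M.deg g → f (M.augmentation.mkQ m) = f' (M.augmentation.mkQ m)) : f = f' :=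
  Submodule.linearMap_qext _ (M.hom_deg_ext h)

variable (M) in
/-- An endomorphism commuting with the right action acts on the coinvariants. -/
def coinvMap (f : Module.End ℂ M.carrier)
    (h : ∀ y m, f (M.right (op y) m) = M.right (op y) (f m)) :
    Module.End ℂ (M.carrier ⧸ M.augmentation) :=
  M.augmentation.liftQ (M.augmentation.mkQ ∘ₗ f)
    (augmentation_le_ker fun y m => by
      rw [LinearMap.comp_apply, LinearMap.comp_apply, h, mkQ_right])

@[simp] theorem coinvMap_mkQ (f : Module.End ℂ M.carrier)
    (h : ∀ y m, f (M.right (op y) m) = M.right (op y) (f m)) (m : M.carrier) :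
    M.coinvMap f h (M.augmentation.mkQ m) = M.augmentation.mkQ (f m) := rfl

theorem right_right (x y : K) (m : M.carrier) :
    M.right (op x) (M.right (op y) m) = M.right (op (y * x)) m := by
  rw [MulOpposite.op_mul, map_mul]; rfl

variable [Finite G] (R : Transversal K)

variable (M) in
/-- The endomorphism which is multiplication by `c g` on the component of degree `g`. -/
def diag (c : G → ℂ) : Module.End ℂ M.carrier :=
  ∑ g ∈ (Set.toFinite (Set.univ : Set G)).toFinset, c g • M.proj g

theorem diag_apply (c : G → ℂ) {g : G} {m : M.carrier} (hm : m ∈ M.deg g) :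
    M.diag c m = c g • m := by
  rw [diag, LinearMap.sum_apply, Finset.sum_eq_single g]
  · rw [LinearMap.smul_apply, proj_apply _ _ hm, if_pos rfl]
  · intro h _ hh
    rw [LinearMap.smul_apply, proj_apply _ _ hm, if_neg hh, smul_zero]
  · simp

open Classical in
variable (M) in
/-- The projection to the sum of the components with degree in `rK`. -/
def cosetProj (r : R.carrier) : Module.End ℂ M.carrier :=
  M.diag fun g => if R.rPart g = r then 1 else 0

open Classical in
theorem cosetProj_apply (r : R.carrier) {g : G} {m : M.carrier} (hm : m ∈ M.deg g) :
    M.cosetProj R r m = if R.rPart g = r then m else 0 := by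
  rw [cosetProj, diag_apply _ hm, ite_smul, one_smul, zero_smul]

/-- Since $gyK=gK$, the grading by cosets, unlike that by $G$, descends to the coinvariants. -/
theorem cosetProj_right (r : R.carrier) (y : K) (m : M.carrier) :
    M.cosetProj R r (M.right (op y) m) = M.right (op y) (M.cosetProj R r m) := by
  have : M.cosetProj R r ∘ₗ M.right (op y) = M.right (op y) ∘ₗ M.cosetProj R r :=
    M.hom_deg_ext fun g m hm => by
      rw [LinearMap.comp_apply, LinearMap.comp_apply, cosetProj_apply _ _ hm,
        cosetProj_apply _ _ (M.right_deg y g m hm), (R.rPart_kPart_mul_right g y).1]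
      split_ifs <;> simp
  exact LinearMap.congr_fun this m

variable (M) in
/-- The left action on the coinvariants for the right action. -/
def coinvLeft : K →* Module.End ℂ (M.carrier ⧸ M.augmentation) where
  toFun x := M.coinvMap (M.left x) (M.left_right x)
  map_one' := coinv_ext fun g m _ => by
    rw [coinvMap_mkQ, map_one]
    rfl
  map_mul' x y := coinv_ext fun g m _ => by
    rw [coinvMap_mkQ, map_mul]
    rfl

/-- The cross relation of $\Xi(R,K)$: multiplying by $x$ carries the coset of $r$ to that of
$x\triangleright r$, and no other coset lands there. -/
theorem coinvLeft_mul_cosetProj (x : K) (r : R.carrier) :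
    M.coinvLeft x * M.coinvMap (M.cosetProj R r) (cosetProj_right R r) =
      M.coinvMap (M.cosetProj R (R.lact x r)) (cosetProj_right R _) * M.coinvLeft x :=
  coinv_ext fun g m hm => by
    change M.augmentation.mkQ (M.left x (M.cosetProj R r m)) =
      M.augmentation.mkQ (M.cosetProj R (R.lact x r) (M.left x m))
    rw [cosetProj_apply _ _ hm, cosetProj_apply _ _ (M.left_deg x g m hm),
      (R.rPart_kPart_mul_left x g).1]
    by_cases h : R.rPart g = r
    · rw [if_pos h, if_pos (congrArg _ h)]
    · rw [if_neg h, if_neg fun h' => h (R.lact_injective x h'), map_zero]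

variable (M) in
/-- The `Ξ(R,K)`-module of coinvariants for the right action of `K`. -/
def coinvariants : AlgMod.{u, w} (Xi R) where
  carrier := M.carrier ⧸ M.augmentation
  act := Xi.lift M.coinvLeft
    (fun r => M.coinvMap (M.cosetProj R r) (cosetProj_right R r))
    (fun r => coinv_ext fun g m hm => by
      simp only [Module.End.mul_apply, coinvMap_mkQ, cosetProj_apply _ _ hm]
      split_ifs with h
      · rw [cosetProj_apply _ _ hm, if_pos h]
      · rw [map_zero])
    (fun r s hrs => coinv_ext fun g m hm => by
      simp only [Module.End.mul_apply, coinvMap_mkQ, cosetProj_apply _ _ hm]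
      split_ifs with h
      · rw [cosetProj_apply _ _ hm, if_neg fun h' => hrs (h'.symm.trans h)]; rfl
      · rw [map_zero, map_zero]; rfl)
    (coinv_ext fun g m hm => by
      classical
      rw [LinearMap.sum_apply]
      simp only [coinvMap_mkQ, cosetProj_apply _ _ hm]
      rw [Finset.sum_eq_single (R.rPart g)]
      · simp
      · intro r _ hr
        rw [if_neg hr.symm, map_zero]
      · simp)
    (coinvLeft_mul_cosetProj R)

theorem coinvariants_grp (x : K) (m : M.carrier) :
    (M.coinvariants R).act (Xi.grp R x) (M.augmentation.mkQ m) =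
      M.augmentation.mkQ (M.left x m) :=
  congrArg (fun f : Module.End ℂ (M.carrier ⧸ M.augmentation) => f (M.augmentation.mkQ m))
    (Xi.lift_grp M.coinvLeft _ _ _ _ (coinvLeft_mul_cosetProj R) x)

theorem coinvariants_grade {g : G} {m : M.carrier} (hm : m ∈ M.deg g) :
    M.augmentation.mkQ m ∈ (M.coinvariants R).grade (R.rPart g) := by
  have h : (M.coinvariants R).act (Xi.delta R (R.rPart g)) (M.augmentation.mkQ m) =
      M.augmentation.mkQ (M.cosetProj R (R.rPart g) m) :=
    congrArg (fun f : Module.End ℂ (M.carrier ⧸ M.augmentation) => f (M.augmentation.mkQ m))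
      (Xi.lift_delta M.coinvLeft _ _ _ _ (coinvLeft_mul_cosetProj R) (R.rPart g))
  rw [cosetProj_apply _ _ hm, if_pos rfl] at h
  exact h

variable (M) in
/-- The linear map with `m ↦ [m] ⊗ k` for `|m| = rk`. -/
def toCoinvTensor : M.carrier →ₗ[ℂ] (M.carrier ⧸ M.augmentation) ⊗[ℂ] (K →₀ ℂ) :=
  ∑ g ∈ (Set.toFinite (Set.univ : Set G)).toFinset,
    (TensorProduct.mk ℂ (M.carrier ⧸ M.augmentation) (K →₀ ℂ)).flip
      (Finsupp.single (R.kPart g) 1) ∘ₗ M.augmentation.mkQ ∘ₗ M.proj g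

theorem toCoinvTensor_apply {g : G} {m : M.carrier} (hm : m ∈ M.deg g) :
    M.toCoinvTensor R m = M.augmentation.mkQ m ⊗ₜ Finsupp.single (R.kPart g) 1 := by
  rw [toCoinvTensor, LinearMap.sum_apply, Finset.sum_eq_single g]
  · simp only [LinearMap.comp_apply, proj_apply _ _ hm, if_pos]
    rfl
  · intro h _ hh
    simp only [LinearMap.comp_apply, proj_apply _ _ hm, if_neg hh, map_zero]
  · simp

variable (M) in
/-- The linear map with `m ↦ m.k⁻¹` for `|m| = rk`. -/
def untwist : Module.End ℂ M.carrier :=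
  ∑ g ∈ (Set.toFinite (Set.univ : Set G)).toFinset, M.right (op (R.kPart g)⁻¹) ∘ₗ M.proj g

theorem untwist_apply {g : G} {m : M.carrier} (hm : m ∈ M.deg g) :
    M.untwist R m = M.right (op (R.kPart g)⁻¹) m := by
  rw [untwist, LinearMap.sum_apply, Finset.sum_eq_single g]
  · rw [LinearMap.comp_apply, proj_apply _ _ hm, if_pos rfl]
  · intro h _ hh
    rw [LinearMap.comp_apply, proj_apply _ _ hm, if_neg hh, map_zero]
  · simp

/-- If $m$ has $K$-part $k$, then $m.y$ has $K$-part $ky$, and $(m.y).(ky)^{-1}=m.k^{-1}$. Thus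
untwisting factors through the coinvariants. -/
theorem untwist_right (y : K) (m : M.carrier) :
    M.untwist R (M.right (op y) m) = M.untwist R m := by
  have : M.untwist R ∘ₗ M.right (op y) = M.untwist R := M.hom_deg_ext fun g m hm => by
    rw [LinearMap.comp_apply, untwist_apply _ hm, untwist_apply _ (M.right_deg y g m hm),
      right_right, (R.rPart_kPart_mul_right g y).2, mul_inv_rev, mul_inv_cancel_left]
  exact LinearMap.congr_fun this m

variable (M) in
/-- The linear map with `[m] ⊗ z ↦ m.k⁻¹z` for `|m| = rk`. -/
def ofCoinvTensor : (M.carrier ⧸ M.augmentation) ⊗[ℂ] (K →₀ ℂ) →ₗ[ℂ] M.carrier :=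
  TensorProduct.lift ((Finsupp.linearCombination ℂ fun z => M.right (op z)).flip ∘ₗ
    M.augmentation.liftQ (M.untwist R) (augmentation_le_ker (untwist_right R)))

theorem ofCoinvTensor_apply {g : G} {m : M.carrier} (hm : m ∈ M.deg g) (z : K) :
    M.ofCoinvTensor R (M.augmentation.mkQ m ⊗ₜ Finsupp.single z 1) =
      M.right (op ((R.kPart g)⁻¹ * z)) m := by
  rw [← right_right, ← untwist_apply R hm]
  simp [ofCoinvTensor]

variable (M) in
/-- A graded bimodule is the tensor product of its coinvariants with `ℂK`. -/
def coinvTensorEquiv : M.carrier ≃ₗ[ℂ] (M.carrier ⧸ M.augmentation) ⊗[ℂ] (K →₀ ℂ) :=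
  LinearEquiv.ofLinearMap (M.toCoinvTensor R) (M.ofCoinvTensor R)
    (by
      refine TensorProduct.ext (LinearMap.ext fun t => Finsupp.lhom_ext' fun z =>
        LinearMap.ext_ring ?_)
      refine LinearMap.congr_fun (f := (M.toCoinvTensor R ∘ₗ M.ofCoinvTensor R) ∘ₗ
          (TensorProduct.mk ℂ (M.carrier ⧸ M.augmentation) (K →₀ ℂ)).flip (Finsupp.single z 1))
        (g := (TensorProduct.mk ℂ (M.carrier ⧸ M.augmentation) (K →₀ ℂ)).flip
          (Finsupp.single z 1)) (coinv_ext fun g m hm => ?_) t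
      -- For $|m|=rk$ the element $m.k^{-1}z$ has degree $rz$ and the same class as $m$, so it is
      -- sent back to $[m]\otimes z$.
      have h := M.right_deg ((R.kPart g)⁻¹ * z) g m hm
      have hk : R.kPart (g * ((R.kPart g)⁻¹ * z : K)) = z := by
        rw [(R.rPart_kPart_mul_right _ _).2, mul_inv_cancel_left]
      change M.toCoinvTensor R (M.ofCoinvTensor R
        (M.augmentation.mkQ m ⊗ₜ Finsupp.single z 1)) = M.augmentation.mkQ m ⊗ₜ Finsupp.single z 1
      rw [ofCoinvTensor_apply R hm, toCoinvTensor_apply R h, hk, mkQ_right])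
    (M.hom_deg_ext fun g m hm => by
      rw [LinearMap.comp_apply, toCoinvTensor_apply R hm, ofCoinvTensor_apply R hm,
        inv_mul_cancel]
      simp)

end GrBimod

section

variable {G : Type u} [Group G] [Finite G] {K : Subgroup G} (R : Transversal K)

/-- A graded bimodule is isomorphic to the image of its coinvariants. -/
def coinvariantsIso (M : GrBimod.{u, u} K) :
    M ≅ (bimodFunctor.{u, u} R).obj (M.coinvariants R) :=
  GrBimod.isoOfEquiv (N := (M.coinvariants R).toGrBimod) (M.coinvTensorEquiv R)
    (fun x => LinearMap.congr_fun (f := M.toCoinvTensor R ∘ₗ M.left x)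
      (g := (M.coinvariants R).leftLin x ∘ₗ M.toCoinvTensor R)
      (M.hom_deg_ext fun g m hm => by
        change M.toCoinvTensor R (M.left x m) =
          (M.coinvariants R).leftLin x (M.toCoinvTensor R m)
        rw [GrBimod.toCoinvTensor_apply R hm, GrBimod.toCoinvTensor_apply R (M.left_deg x g m hm)]
        refine Eq.trans ?_ (AlgMod.leftLin_tmul x (GrBimod.coinvariants_grade R hm) _).symm
        -- Left equivariance is the rule that $xg$ has $K$-part $(x\triangleleft r)k$ for $g=rk$.
        exact congrArg₂ (fun m z => m ⊗ₜ[ℂ] Finsupp.single z (1 : ℂ))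
          (GrBimod.coinvariants_grp R x m).symm (R.rPart_kPart_mul_left x g).2))
    (fun y => LinearMap.congr_fun (f := M.toCoinvTensor R ∘ₗ M.right (MulOpposite.op y))
      (g := TensorProduct.map LinearMap.id (Finsupp.lmapDomain ℂ ℂ (· * y)) ∘ₗ M.toCoinvTensor R)
      (M.hom_deg_ext fun g m hm => by
        rw [LinearMap.comp_apply, LinearMap.comp_apply, GrBimod.toCoinvTensor_apply R hm,
          GrBimod.toCoinvTensor_apply R (M.right_deg y g m hm), GrBimod.mkQ_right,
          (R.rPart_kPart_mul_right g y).2]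
        simp))
    (fun g m hm => by
      change M.toCoinvTensor R m ∈ (M.coinvariants R).tensorDeg g
      rw [GrBimod.toCoinvTensor_apply R hm]
      have := AlgMod.tmul_mem_tensorDeg (GrBimod.coinvariants_grade R hm) (R.kPart g)
      rw [R.rPart_mul_kPart] at this
      exact this)

theorem bimodFunctor_essSurj : (bimodFunctor.{u, u} R).EssSurj where
  mem_essImage M := ⟨M.coinvariants R, ⟨(coinvariantsIso R M).symm⟩⟩

theorem bimodFunctor_isEquivalence : (bimodFunctor.{u, u} R).IsEquivalence where
  faithful := bimodFunctor_faithful R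
  full := bimodFunctor_full R
  essSurj := bimodFunctor_essSurj R

end

end

noncomputable section

/-! ## Homogeneous elements of tensor products -/

namespace AlgMod

open MulOpposite (op)

/-- Transfers the computations of $\Delta$ and $\phi$ on idempotents to homogeneous vectors: the
idempotents fixing $v$ and $w$ are inserted to the right of $T$. -/
theorem tensorAct_mul_apply {A B V W : Type*} [Ring A] [Algebra ℂ A] [Ring B] [Algebra ℂ B]
    [AddCommGroup V] [Module ℂ V] [AddCommGroup W] [Module ℂ W]
    (ρ : A →ₐ[ℂ] Module.End ℂ V) (σ : B →ₐ[ℂ] Module.End ℂ W) (T : A ⊗[ℂ] B) {a : A} {b : B}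
    {v : V} {w : W} (hv : ρ a v = v) (hw : σ b w = w) :
    tensorAct ρ σ T (v ⊗ₜ w) = tensorAct ρ σ (T * a ⊗ₜ b) (v ⊗ₜ w) := by
  rw [map_mul, Module.End.mul_apply, tensorAct_tmul, TensorProduct.map_tmul, hv, hw]

variable {G : Type u} [Group G] [Finite G] {K : Subgroup G} {R : Transversal K}

attribute [local instance] Xi.quasiBialgebra

/-- The bilinear map `(v, w) ↦ v ⊗ w`. -/
def tmul (V W : AlgMod.{u, w} (Xi R)) : V.carrier →ₗ[ℂ] W.carrier →ₗ[ℂ] (tensor V W).carrier :=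
  TensorProduct.mk ℂ V.carrier W.carrier

theorem tensor_act_grp (V W : AlgMod.{u, w} (Xi R)) (x : K) {r : R.carrier} {v : V.carrier}
    (hv : v ∈ V.grade r) (w : W.carrier) :
    (tensor V W).act (Xi.grp R x) (tmul V W v w) =
      tmul V W (V.act (Xi.grp R x) v) (W.act (Xi.grp R (R.ract x r)) w) := by
  change tensorAct V.act W.act (Xi.comul R _) (v ⊗ₜ w) = _ ⊗ₜ _
  rw [tensorAct_mul_apply _ _ _ (mem_grade.1 hv)
    (show W.act 1 w = w by rw [map_one]; rfl), Xi.comul_grp,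
    Xi.comulGrp_mul _ (Xi.delta_mul_self r), mul_one, tensorAct_tmul, TensorProduct.map_tmul,
    map_mul, Module.End.mul_apply, mem_grade.1 hv]

theorem tmul_mem_grade {V W : AlgMod.{u, w} (Xi R)} {r s : R.carrier} {v : V.carrier}
    {w : W.carrier} (hv : v ∈ V.grade r) (hw : w ∈ W.grade s) :
    (tmul V W v w) ∈ (tensor V W).grade (R.dot r s) := by
  change tensorAct V.act W.act (Xi.comul R _) (v ⊗ₜ w) = v ⊗ₜ w
  rw [tensorAct_mul_apply _ _ _ (mem_grade.1 hv) (mem_grade.1 hw),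
    Xi.comul_delta_dot_mul (Xi.delta_mul_self r) (Xi.delta_mul_self s), tensorAct_tmul,
    TensorProduct.map_tmul, mem_grade.1 hv, mem_grade.1 hw]

theorem act₃_phi (U V W : AlgMod.{u, w} (Xi R)) {r s : R.carrier} {u : U.carrier} {v : V.carrier}
    (hu : u ∈ U.grade r) (hv : v ∈ V.grade s) (w : W.carrier) :
    act₃ U V W (Xi.phi R : Xi R ⊗[ℂ] (Xi R ⊗[ℂ] Xi R)) (u ⊗ₜ (v ⊗ₜ w)) =
      u ⊗ₜ (v ⊗ₜ W.act (Xi.grp R (R.tau r s)⁻¹) w) := by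
  have h1 : tensorAct V.act W.act (Xi.delta R s ⊗ₜ 1) (v ⊗ₜ w) = v ⊗ₜ w := by
    rw [tensorAct_tmul, TensorProduct.map_tmul, mem_grade.1 hv, map_one]; rfl
  rw [act₃, tensorAct_mul_apply _ _ _ (mem_grade.1 hu) h1,
    Xi.phi_mul (Xi.delta_mul_self r) (Xi.delta_mul_self s), tensorAct_tmul,
    TensorProduct.map_tmul, tensorAct_tmul, TensorProduct.map_tmul, mem_grade.1 hu,
    mem_grade.1 hv, mul_one]

/-- Linear maps out of a tensor product agree if they agree on tensors of homogeneous elements. -/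
theorem tensor_grade_ext {V W : AlgMod.{u, w} (Xi R)} {E : Type*} [AddCommGroup E] [Module ℂ E]
    {f g : (tensor V W).carrier →ₗ[ℂ] E} (h : ∀ (r s : R.carrier) v w, v ∈ V.grade r →
      w ∈ W.grade s → f (tmul V W v w) = g (tmul V W v w)) : f = g :=
  TensorProduct.ext (V.hom_grade_ext fun r v hv => W.hom_grade_ext fun s w hw => h r s v w hv hw)

/-! ### The generators `v ⊗ z` -/

variable (V W : AlgMod.{u, u} (Xi R))

/-- The linear map `v ↦ v ⊗ z`. -/
def gen (z : K) : V.carrier →ₗ[ℂ] V.toGrBimod.carrier :=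
  (TensorProduct.mk ℂ V.carrier (K →₀ ℂ)).flip (Finsupp.single z 1)

variable {V W}

theorem gen_ext {E : Type*} [AddCommGroup E] [Module ℂ E] {f g : V.toGrBimod.carrier →ₗ[ℂ] E}
    (h : ∀ (r : R.carrier) v z, v ∈ V.grade r → f (gen V z v) = g (gen V z v)) : f = g :=
  V.grade_ext fun r v z hv => h r v z hv

theorem left_gen (x : K) {r : R.carrier} {v : V.carrier} (hv : v ∈ V.grade r) (z : K) :
    V.toGrBimod.left x (gen V z v) = gen V (R.ract x r * z) (V.act (Xi.grp R x) v) :=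
  leftLin_tmul x hv z

theorem right_gen (y z : K) (v : V.carrier) :
    V.toGrBimod.right (op y) (gen V z v) = gen V (z * y) v := by
  change TensorProduct.map LinearMap.id (Finsupp.lmapDomain ℂ ℂ (· * y))
      (v ⊗ₜ[ℂ] Finsupp.single z (1 : ℂ)) = v ⊗ₜ[ℂ] Finsupp.single (z * y) (1 : ℂ)
  simp

theorem gen_mem_deg {r : R.carrier} {v : V.carrier} (hv : v ∈ V.grade r) (z : K) :
    gen V z v ∈ V.toGrBimod.deg (r * z) :=
  tmul_mem_tensorDeg hv z

theorem map_gen (f : V ⟶ W) (z : K) (v : V.carrier) :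
    ((bimodFunctor R).map f).toLin (gen V z v) = gen W z (f.toLin v) := rfl

/-- As $v\otimes z=(v\otimes 1).z$, the element $z$ can be moved across, so tensors with left factor
in $V\otimes 1$ span. -/
theorem bt_gen_left {M : GrBimod.{u, u} K} (z : K) (v : V.carrier) (m : M.carrier) :
    GrBimod.bt V.toGrBimod M (gen V z v) m =
      GrBimod.bt V.toGrBimod M (gen V 1 v) (M.left z m) := by
  rw [← GrBimod.bt_balanced, right_gen, one_mul]

theorem bt_gen_gen (y z : K) (v : V.carrier) {s : R.carrier} {w : W.carrier} (hw : w ∈ W.grade s) :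
    GrBimod.bt V.toGrBimod W.toGrBimod (gen V y v) (gen W z w) =
      GrBimod.bt V.toGrBimod W.toGrBimod (gen V 1 v)
        (gen W (R.ract y s * z) (W.act (Xi.grp R y) w)) := by
  rw [bt_gen_left, left_gen y hw]

theorem bt_gen_ext_left {M : GrBimod.{u, u} K} {E : Type*} [AddCommGroup E] [Module ℂ E]
    {f g : GrBimod.BTensor V.toGrBimod M →ₗ[ℂ] E}
    (h : ∀ (r : R.carrier) v m, v ∈ V.grade r →
      f (GrBimod.bt V.toGrBimod M (gen V 1 v) m) =
        g (GrBimod.bt V.toGrBimod M (gen V 1 v) m)) : f = g :=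
  GrBimod.bt_ext fun l m => LinearMap.congr_fun (f := f ∘ₗ (GrBimod.bt V.toGrBimod M).flip m)
    (g := g ∘ₗ (GrBimod.bt V.toGrBimod M).flip m) (gen_ext fun r v z hv => by
      rw [LinearMap.comp_apply, LinearMap.comp_apply, LinearMap.flip_apply, bt_gen_left]
      exact h r v _ hv) l

theorem bt_gen_ext {E : Type*} [AddCommGroup E] [Module ℂ E]
    {f g : GrBimod.BTensor V.toGrBimod W.toGrBimod →ₗ[ℂ] E}
    (h : ∀ (r s : R.carrier) v w z, v ∈ V.grade r → w ∈ W.grade s →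
      f (GrBimod.bt V.toGrBimod W.toGrBimod (gen V 1 v) (gen W z w)) =
        g (GrBimod.bt V.toGrBimod W.toGrBimod (gen V 1 v) (gen W z w))) : f = g :=
  bt_gen_ext_left fun r v m hv => LinearMap.congr_fun
    (f := f ∘ₗ GrBimod.bt V.toGrBimod W.toGrBimod (gen V 1 v))
    (g := g ∘ₗ GrBimod.bt V.toGrBimod W.toGrBimod (gen V 1 v))
    (gen_ext fun s w z hw => h r s v w z hv hw) m

/-! ### The tensorator -/

variable (V W)

/-- The linear map `(v ⊗ w) ⊗ z ↦ (v ⊗ w) ⊗ κ(|v|,|w|) z`. -/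
def twist (κ : R.carrier → R.carrier → K) :
    Module.End ℂ ((V.carrier ⊗[ℂ] W.carrier) ⊗[ℂ] (K →₀ ℂ)) :=
  ∑ r : R.carrier, ∑ s : R.carrier, TensorProduct.map
    (TensorProduct.map (V.act (Xi.delta R r)) (W.act (Xi.delta R s)))
    (Finsupp.lmapDomain ℂ ℂ (κ r s * ·))

variable {V W} in
theorem twist_tmul (κ : R.carrier → R.carrier → K) {r s : R.carrier} {v : V.carrier}
    {w : W.carrier} (hv : v ∈ V.grade r) (hw : w ∈ W.grade s) (z : K) :
    twist V W κ ((v ⊗ₜ w) ⊗ₜ Finsupp.single z 1) =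
      (v ⊗ₜ w) ⊗ₜ Finsupp.single (κ r s * z) 1 := by
  classical
  rw [twist, LinearMap.sum_apply, Finset.sum_eq_single r, LinearMap.sum_apply,
    Finset.sum_eq_single s]
  · simp [mem_grade.1 hv, mem_grade.1 hw]
  · intro t _ ht
    simp [delta_of_mem_grade hw, ht]
  · simp
  · intro t _ ht
    simp [delta_of_mem_grade hv, ht]
  · simp

/-- The linear map `v ↦ (w ⊗ z ↦ (v ⊗ w) ⊗ τ(|v|,|w|) z)`. -/
def muAux : V.carrier →ₗ[ℂ] W.toGrBimod.carrier →ₗ[ℂ] (tensor V W).toGrBimod.carrier :=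
  TensorProduct.curry (twist V W R.tau ∘ₗ
    (TensorProduct.assoc ℂ V.carrier W.carrier (K →₀ ℂ)).symm.toLinearMap)

variable {V W} in
theorem muAux_gen {r s : R.carrier} {v : V.carrier} {w : W.carrier} (hv : v ∈ V.grade r)
    (hw : w ∈ W.grade s) (z : K) :
    muAux V W v (gen W z w) = gen (tensor V W) (R.tau r s * z) (tmul V W v w) :=
  twist_tmul R.tau hv hw z

/-- The bilinear map `(v ⊗ y, t) ↦ muAux v (y.t)`. -/
def muBilin : V.toGrBimod.carrier →ₗ[ℂ] W.toGrBimod.carrier →ₗ[ℂ]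
    (tensor V W).toGrBimod.carrier :=
  TensorProduct.lift (Finsupp.linearCombination ℂ fun y : K =>
    (muAux V W).compl₂ (W.toGrBimod.left y)).flip

theorem muBilin_gen (y : K) (v : V.carrier) (t : W.toGrBimod.carrier) :
    muBilin V W (gen V y v) t = muAux V W v (W.toGrBimod.left y t) := by
  have h : muBilin V W (gen V y v) = (muAux V W).compl₂ (W.toGrBimod.left y) v := by
    change TensorProduct.lift _ (v ⊗ₜ[ℂ] Finsupp.single y (1 : ℂ)) = _
    simp
  rw [h, LinearMap.compl₂_apply]

/-- Since `muBilin` lets the $K$-component of the left factor act on the right one, balancedness is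
just $(yx).n=y.(x.n)$. -/
theorem muBilin_balanced (m : V.toGrBimod.carrier) (x : K) (n : W.toGrBimod.carrier) :
    muBilin V W (V.toGrBimod.right (op x) m) n = muBilin V W m (W.toGrBimod.left x n) :=
  LinearMap.congr_fun
    (f := (muBilin V W).flip n ∘ₗ V.toGrBimod.right (op x))
    (g := (muBilin V W).flip (W.toGrBimod.left x n)) (gen_ext fun r v y _ => by
      rw [LinearMap.comp_apply, LinearMap.flip_apply, LinearMap.flip_apply, right_gen, muBilin_gen,
        muBilin_gen, map_mul, Module.End.mul_apply]) m

/-- The underlying linear map of the tensorator,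
`(v ⊗ 1) ⊗ (w ⊗ z) ↦ (v ⊗ w) ⊗ τ(|v|,|w|) z`. -/
def mu : GrBimod.BTensor V.toGrBimod W.toGrBimod →ₗ[ℂ] (tensor V W).toGrBimod.carrier :=
  GrBimod.btLift (muBilin V W) (muBilin_balanced V W)

variable {V W} in
theorem mu_bt {r s : R.carrier} {v : V.carrier} {w : W.carrier} (hv : v ∈ V.grade r)
    (hw : w ∈ W.grade s) (z : K) :
    mu V W (GrBimod.bt V.toGrBimod W.toGrBimod (gen V 1 v) (gen W z w)) =
      gen (tensor V W) (R.tau r s * z) (tmul V W v w) := by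
  rw [mu, GrBimod.btLift_bt, muBilin_gen, map_one, Module.End.one_apply, muAux_gen hv hw]

/-- The inverse of the tensorator, `(v ⊗ w) ⊗ z ↦ (v ⊗ 1) ⊗ (w ⊗ τ(|v|,|w|)⁻¹ z)`. -/
def muInv : (tensor V W).toGrBimod.carrier →ₗ[ℂ] GrBimod.BTensor V.toGrBimod W.toGrBimod :=
  (TensorProduct.lift (GrBimod.bt V.toGrBimod W.toGrBimod ∘ₗ gen V 1 :
      V.carrier →ₗ[ℂ] (W.carrier ⊗[ℂ] (K →₀ ℂ)) →ₗ[ℂ]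
        GrBimod.BTensor V.toGrBimod W.toGrBimod) ∘ₗ
    (TensorProduct.assoc ℂ V.carrier W.carrier (K →₀ ℂ)).toLinearMap) ∘ₗ
      twist V W fun r s => (R.tau r s)⁻¹

variable {V W} in
theorem muInv_gen {r s : R.carrier} {v : V.carrier} {w : W.carrier} (hv : v ∈ V.grade r)
    (hw : w ∈ W.grade s) (z : K) :
    muInv V W (gen (tensor V W) z (tmul V W v w)) =
      GrBimod.bt V.toGrBimod W.toGrBimod (gen V 1 v) (gen W ((R.tau r s)⁻¹ * z) w) := by
  have h := twist_tmul (fun r s => (R.tau r s)⁻¹) hv hw z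
  refine (congrArg (TensorProduct.lift (GrBimod.bt V.toGrBimod W.toGrBimod ∘ₗ gen V 1 :
      V.carrier →ₗ[ℂ] (W.carrier ⊗[ℂ] (K →₀ ℂ)) →ₗ[ℂ]
        GrBimod.BTensor V.toGrBimod W.toGrBimod) ∘ₗ
    (TensorProduct.assoc ℂ V.carrier W.carrier (K →₀ ℂ)).toLinearMap) h).trans rfl

variable {V W} in
theorem gen_tensor_ext {E : Type*} [AddCommGroup E] [Module ℂ E]
    {f g : (tensor V W).toGrBimod.carrier →ₗ[ℂ] E}
    (h : ∀ (r s : R.carrier) v w z, v ∈ V.grade r → w ∈ W.grade s →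
      f (gen (tensor V W) z (tmul V W v w)) =
        g (gen (tensor V W) z (tmul V W v w))) : f = g :=
  gen_ext fun _ t z _ => LinearMap.congr_fun (f := f ∘ₗ gen (tensor V W) z)
    (g := g ∘ₗ gen (tensor V W) z) (tensor_grade_ext fun r s v w hv hw => h r s v w z hv hw) t

/-- The tensorator as a linear equivalence. -/
def muEquiv : GrBimod.BTensor V.toGrBimod W.toGrBimod ≃ₗ[ℂ] (tensor V W).toGrBimod.carrier :=
  LinearEquiv.ofLinearMap (mu V W) (muInv V W)
    (gen_tensor_ext fun r s v w z hv hw => by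
      rw [LinearMap.comp_apply, muInv_gen hv hw, mu_bt hv hw, mul_inv_cancel_left]; rfl)
    (bt_gen_ext fun r s v w z hv hw => by
      rw [LinearMap.comp_apply, mu_bt hv hw, muInv_gen hv hw, inv_mul_cancel_left]; rfl)

/-- Acting by $x$ on $v\otimes 1$ leaves $x\triangleleft r$, which crosses to act on $w\otimes z$.
The resulting $K$-components agree by the $K$-part of `lact_ract_dot`. -/
theorem mu_left (x : K) (t : GrBimod.BTensor V.toGrBimod W.toGrBimod) :
    mu V W (GrBimod.btLeft V.toGrBimod W.toGrBimod x t) =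
      (tensor V W).toGrBimod.left x (mu V W t) :=
  LinearMap.congr_fun (f := mu V W ∘ₗ GrBimod.btLeft V.toGrBimod W.toGrBimod x)
    (g := (tensor V W).toGrBimod.left x ∘ₗ mu V W) (bt_gen_ext fun r s v w z hv hw => by
      rw [LinearMap.comp_apply, LinearMap.comp_apply, GrBimod.btLeft_bt, mu_bt hv hw,
        left_gen x hv, left_gen x (tmul_mem_grade hv hw), bt_gen_gen _ _ _ hw,
        mu_bt (grp_mem_grade hv x) (grp_mem_grade hw _), tensor_act_grp V W x hv,
        ← mul_assoc, ← mul_assoc, (R.lact_ract_dot x r s).2, mul_one]) t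

theorem mu_right (y : K) (t : GrBimod.BTensor V.toGrBimod W.toGrBimod) :
    mu V W (GrBimod.btRight V.toGrBimod W.toGrBimod (op y) t) =
      (tensor V W).toGrBimod.right (op y) (mu V W t) :=
  LinearMap.congr_fun (f := mu V W ∘ₗ GrBimod.btRight V.toGrBimod W.toGrBimod (op y))
    (g := (tensor V W).toGrBimod.right (op y) ∘ₗ mu V W) (bt_gen_ext fun r s v w z hv hw => by
      rw [LinearMap.comp_apply, LinearMap.comp_apply, GrBimod.btRight_bt, mu_bt hv hw,
        right_gen, right_gen, mu_bt hv hw, mul_assoc]) t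

theorem mu_deg (g : G) (t : GrBimod.BTensor V.toGrBimod W.toGrBimod)
    (ht : t ∈ GrBimod.btDeg V.toGrBimod W.toGrBimod g) :
    mu V W t ∈ (tensor V W).toGrBimod.deg g := by
  refine (GrBimod.btDeg_le (S := ((tensor V W).toGrBimod.deg g).comap (mu V W)) ?_) ht
  rintro a b m n rfl hm hn
  refine (tensorDeg_le (S := ((tensor V W).toGrBimod.deg (a * b)).comap
    (mu V W ∘ₗ (GrBimod.bt V.toGrBimod W.toGrBimod).flip n)) ?_) hm
  rintro r v y rfl hv
  refine (tensorDeg_le (S := ((tensor V W).toGrBimod.deg (r * y * b)).comap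
    (mu V W ∘ₗ GrBimod.bt V.toGrBimod W.toGrBimod (gen V y v))) ?_) hn
  rintro s w z rfl hw
  change mu V W (GrBimod.bt V.toGrBimod W.toGrBimod (gen V y v) (gen W z w)) ∈
    (tensor V W).toGrBimod.deg (r * y * (s * z))
  rw [bt_gen_gen y z v hw, mu_bt hv (grp_mem_grade hw y)]
  -- Once $y$ has crossed, $ry\,sz=r(y\triangleright s)(y\triangleleft s)z$; factoring
  -- $r(y\triangleright s)$ gives the degree of the image.
  have e : (r * y * (s * z) : G) =
      R.dot r (R.lact y s) * (R.tau r (R.lact y s) * (R.ract y s * z) : K) := by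
    rw [Subgroup.coe_mul, Subgroup.coe_mul, ← mul_assoc (R.dot _ _ : G), R.dot_mul_tau,
      mul_assoc, ← mul_assoc (y : G), ← R.lact_mul_ract]
    group
  rw [e]
  exact gen_mem_deg (tmul_mem_grade hv (grp_mem_grade hw y)) _

/-- The tensorator. -/
def muIso : GrBimod.tensor V.toGrBimod W.toGrBimod ≅ (tensor V W).toGrBimod :=
  GrBimod.isoOfEquiv (M := GrBimod.tensor V.toGrBimod W.toGrBimod) (muEquiv V W)
    (mu_left V W) (mu_right V W) (mu_deg V W)

end AlgMod

end

noncomputable section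

/-! ## The functor is monoidal -/

namespace AlgMod

open MulOpposite (op)

variable {G : Type u} [Group G] [Finite G] {K : Subgroup G} {R : Transversal K}

attribute [local instance] Xi.quasiBialgebra

variable (R) in
/-- The generator of the unit object. -/
def triv : (trivial.{u, u} (Xi R)).carrier := (ULift.up 1 : ULift.{u} ℂ)

theorem trivial_act (h : Xi R) : (trivial.{u, u} (Xi R)).act h (triv R) = Xi.counit R h • triv R :=
  rfl

theorem triv_mem_grade : triv R ∈ (trivial.{u, u} (Xi R)).grade R.e := by
  rw [mem_grade, trivial_act, Xi.counit_delta, if_pos rfl, one_smul]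

theorem trivial_act_grp (x : K) : (trivial.{u, u} (Xi R)).act (Xi.grp R x) (triv R) = triv R := by
  rw [trivial_act, Xi.counit_grp, one_smul]

theorem leftUnitor_tmul (V : AlgMod.{u, u} (Xi R)) (v : V.carrier) :
    (leftUnitor V).hom.toLin (tmul (trivial (Xi R)) V (triv R) v) = v :=
  one_smul ℂ v

theorem rightUnitor_tmul (V : AlgMod.{u, u} (Xi R)) (v : V.carrier) :
    (rightUnitor V).hom.toLin (tmul V (trivial (Xi R)) v (triv R)) = v :=
  one_smul ℂ v

theorem associator_tmul (U V W : AlgMod.{u, u} (Xi R)) {r s : R.carrier} {u : U.carrier}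
    {v : V.carrier} (hu : u ∈ U.grade r) (hv : v ∈ V.grade s) (w : W.carrier) :
    (associator U V W).hom.toLin (tmul (tensor U V) W (tmul U V u v) w) =
      tmul U (tensor V W) u (tmul V W v (W.act (Xi.grp R (R.tau r s)⁻¹) w)) :=
  act₃_phi U V W hu hv w

variable (R) in
/-- The unit comparison `z ↦ 1 ⊗ z` as a linear equivalence. -/
def epsEquiv : (K →₀ ℂ) ≃ₗ[ℂ] (trivial.{u, u} (Xi R)).toGrBimod.carrier :=
  (TensorProduct.lid ℂ (K →₀ ℂ)).symm.trans
    (TensorProduct.congr ULift.moduleEquiv.symm (LinearEquiv.refl ℂ (K →₀ ℂ)))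

theorem epsEquiv_single (z : K) :
    epsEquiv R (Finsupp.single z 1) = gen (trivial.{u, u} (Xi R)) z (triv R) := rfl

variable (R) in
/-- The unit comparison. -/
def epsIso : GrBimod.unit K ≅ (trivial.{u, u} (Xi R)).toGrBimod :=
  GrBimod.isoOfEquiv (M := GrBimod.unit K) (epsEquiv R)
    (fun x => LinearMap.congr_fun
      (f := (epsEquiv R).toLinearMap ∘ₗ (GrBimod.unit K).left x)
      (g := (trivial.{u, u} (Xi R)).toGrBimod.left x ∘ₗ (epsEquiv R).toLinearMap)
      (GrBimod.unit_ext fun z => by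
        change epsEquiv R ((GrBimod.unit K).left x (Finsupp.single z 1)) =
          (trivial.{u, u} (Xi R)).toGrBimod.left x (epsEquiv R (Finsupp.single z 1))
        rw [GrBimod.unit_left, epsEquiv_single, epsEquiv_single, left_gen x triv_mem_grade,
          (R.lact_ract_e x).2, trivial_act_grp]))
    (fun y => LinearMap.congr_fun
      (f := (epsEquiv R).toLinearMap ∘ₗ (GrBimod.unit K).right (op y))
      (g := (trivial.{u, u} (Xi R)).toGrBimod.right (op y) ∘ₗ (epsEquiv R).toLinearMap)
      (GrBimod.unit_ext fun z => by
        change epsEquiv R ((GrBimod.unit K).right (op y) (Finsupp.single z 1)) =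
          (trivial.{u, u} (Xi R)).toGrBimod.right (op y) (epsEquiv R (Finsupp.single z 1))
        rw [GrBimod.unit_right, epsEquiv_single, epsEquiv_single, right_gen]))
    (fun g t ht => by
      refine (Submodule.span_le (p := ((trivial.{u, u} (Xi R)).toGrBimod.deg g).comap
        (epsEquiv R).toLinearMap)).2 ?_ ht
      rintro _ ⟨z, rfl, rfl⟩
      have h := gen_mem_deg (triv_mem_grade (R := R)) z
      rw [show (R.e : G) = 1 from rfl, one_mul] at h
      exact h)

theorem mu_natural {V W V' W' : AlgMod.{u, u} (Xi R)} (f : V ⟶ V') (g : W ⟶ W') :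
    GrBimod.tensorMap ((bimodFunctor R).map f) ((bimodFunctor R).map g) ≫ (muIso V' W').hom =
      (muIso V W).hom ≫ (bimodFunctor R).map (tensorMap f g) :=
  GrBimod.hom_ext (bt_gen_ext fun r s v w z hv hw => by
    have hf : f.toLin v ∈ V'.grade r := by rw [mem_grade] at hv ⊢; rw [← f.comm, hv]
    have hg : g.toLin w ∈ W'.grade s := by rw [mem_grade] at hw ⊢; rw [← g.comm, hw]
    change mu V' W' ((GrBimod.tensorMap ((bimodFunctor R).map f) ((bimodFunctor R).map g)).toLin
        (GrBimod.bt V.toGrBimod W.toGrBimod (gen V 1 v) (gen W z w))) =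
      ((bimodFunctor R).map (tensorMap f g)).toLin
        (mu V W (GrBimod.bt V.toGrBimod W.toGrBimod (gen V 1 v) (gen W z w)))
    rw [mu_bt hv hw, map_gen]
    refine (congrArg (mu V' W') (GrBimod.tensorMap_bt ((bimodFunctor R).map f)
      ((bimodFunctor R).map g) (gen V 1 v) (gen W z w))).trans ?_
    exact mu_bt hf hg z)

/-- Elements of $K$ are pushed rightwards twice, so that only the last factor carries one. -/
theorem bt_gen_ext₃ {U V W : AlgMod.{u, u} (Xi R)} {E : Type*} [AddCommGroup E] [Module ℂ E]
    {f g : GrBimod.BTensor (GrBimod.tensor U.toGrBimod V.toGrBimod) W.toGrBimod →ₗ[ℂ] E}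
    (h : ∀ (r s q : R.carrier) u v w z, u ∈ U.grade r → v ∈ V.grade s → w ∈ W.grade q →
      f (GrBimod.bt (GrBimod.tensor U.toGrBimod V.toGrBimod) W.toGrBimod
          (GrBimod.bt U.toGrBimod V.toGrBimod (gen U 1 u) (gen V 1 v)) (gen W z w)) =
        g (GrBimod.bt (GrBimod.tensor U.toGrBimod V.toGrBimod) W.toGrBimod
          (GrBimod.bt U.toGrBimod V.toGrBimod (gen U 1 u) (gen V 1 v)) (gen W z w))) : f = g := by
  refine GrBimod.bt_ext fun t n => LinearMap.congr_fun
    (f := f ∘ₗ (GrBimod.bt (GrBimod.tensor U.toGrBimod V.toGrBimod) W.toGrBimod).flip n)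
    (g := g ∘ₗ (GrBimod.bt (GrBimod.tensor U.toGrBimod V.toGrBimod) W.toGrBimod).flip n)
    (bt_gen_ext fun r s u v y hu hv => ?_) t
  have hb := GrBimod.bt_balanced (GrBimod.tensor U.toGrBimod V.toGrBimod) W.toGrBimod
      (GrBimod.bt U.toGrBimod V.toGrBimod (gen U 1 u) (gen V 1 v)) y n
  rw [GrBimod.btRight_bt, right_gen, one_mul] at hb
  rw [LinearMap.comp_apply, LinearMap.comp_apply, LinearMap.flip_apply, hb]
  exact LinearMap.congr_fun
    (f := f ∘ₗ GrBimod.bt (GrBimod.tensor U.toGrBimod V.toGrBimod) W.toGrBimod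
      (GrBimod.bt U.toGrBimod V.toGrBimod (gen U 1 u) (gen V 1 v)))
    (g := g ∘ₗ GrBimod.bt (GrBimod.tensor U.toGrBimod V.toGrBimod) W.toGrBimod
      (GrBimod.bt U.toGrBimod V.toGrBimod (gen U 1 u) (gen V 1 v)))
    (gen_ext fun q w z hw => h r s q u v w z hu hv hw) (W.toGrBimod.left y n)

/-- On $(u\otimes 1)\otimes(v\otimes 1)\otimes(w\otimes z)$ the left route creates $\tau(r,s)$
before meeting $w$. Crossing, it acts on $w$ and leaves $\tau(r,s)\triangleleft q$. The factor
$\tau(r,s)^{-1}$ in $\phi$ cancels the action on $w$, and the $K$-components agree by the $K$-part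
of `dot_tau_assoc`. -/
theorem mu_assoc (U V W : AlgMod.{u, u} (Xi R)) :
    GrBimod.tensorMap (muIso U V).hom (𝟙 W.toGrBimod) ≫ (muIso (tensor U V) W).hom ≫
        (bimodFunctor R).map (associator U V W).hom =
      (GrBimod.associator U.toGrBimod V.toGrBimod W.toGrBimod).hom ≫
        GrBimod.tensorMap (𝟙 U.toGrBimod) (muIso V W).hom ≫ (muIso U (tensor V W)).hom := by
  apply GrBimod.hom_ext
  refine bt_gen_ext₃ fun r s q u v w z hu hv hw => ?_
  have e₁ := GrBimod.tensorMap_bt (muIso U V).hom (𝟙 W.toGrBimod)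
    (GrBimod.bt U.toGrBimod V.toGrBimod (gen U 1 u) (gen V 1 v)) (gen W z w)
  have e₂ : (muIso U V).hom.toLin (GrBimod.bt U.toGrBimod V.toGrBimod (gen U 1 u) (gen V 1 v)) =
      gen (tensor U V) (R.tau r s) (tmul U V u v) := by
    have := mu_bt hu hv 1
    rwa [mul_one] at this
  rw [e₂] at e₁
  replace e₁ := e₁.trans (bt_gen_gen (R.tau r s) z (tmul U V u v) hw)
  have e₃ := GrBimod.associator_bt U.toGrBimod V.toGrBimod W.toGrBimod (gen U 1 u) (gen V 1 v)
    (gen W z w)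
  have e₄ := GrBimod.tensorMap_bt (𝟙 U.toGrBimod) (muIso V W).hom (gen U 1 u)
    (GrBimod.bt V.toGrBimod W.toGrBimod (gen V 1 v) (gen W z w))
  have e₅ : (muIso V W).hom.toLin (GrBimod.bt V.toGrBimod W.toGrBimod (gen V 1 v) (gen W z w)) =
      gen (tensor V W) (R.tau s q * z) (tmul V W v w) := mu_bt hv hw z
  rw [e₅] at e₄
  have e₆ := mu_bt (tmul_mem_grade hu hv) (grp_mem_grade hw (R.tau r s))
    (R.ract (R.tau r s) q * z)
  have e₇ := mu_bt hu (tmul_mem_grade hv hw) (R.tau s q * z)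
  change ((bimodFunctor R).map (associator U V W).hom).toLin ((muIso (tensor U V) W).hom.toLin
      ((GrBimod.tensorMap (muIso U V).hom (𝟙 W.toGrBimod)).toLin
        (GrBimod.bt (GrBimod.tensor U.toGrBimod V.toGrBimod) W.toGrBimod
          (GrBimod.bt U.toGrBimod V.toGrBimod (gen U 1 u) (gen V 1 v)) (gen W z w)))) =
    (muIso U (tensor V W)).hom.toLin ((GrBimod.tensorMap (𝟙 U.toGrBimod) (muIso V W).hom).toLin
      ((GrBimod.associator U.toGrBimod V.toGrBimod W.toGrBimod).hom.toLin
        (GrBimod.bt (GrBimod.tensor U.toGrBimod V.toGrBimod) W.toGrBimod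
          (GrBimod.bt U.toGrBimod V.toGrBimod (gen U 1 u) (gen V 1 v)) (gen W z w))))
  rw [e₁, e₃, e₄]
  refine (congrArg ((bimodFunctor R).map (associator U V W).hom).toLin e₆).trans ?_
  refine Eq.trans ?_ e₇.symm
  rw [map_gen, associator_tmul U V W hu hv, ← Module.End.mul_apply, ← map_mul,
    Xi.grp_inv_mul, map_one, Module.End.one_apply, ← mul_assoc, ← mul_assoc,
    (R.dot_tau_assoc r s q).2]

/-- The element $z$ of the unit crosses and acts on $F(V)$ from the left; the tensorator adds
nothing because $\tau(e,\cdot)=1$. -/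
theorem mu_leftUnitor (V : AlgMod.{u, u} (Xi R)) :
    (GrBimod.leftUnitor V.toGrBimod).hom =
      GrBimod.tensorMap (epsIso R).hom (𝟙 V.toGrBimod) ≫ (muIso (trivial (Xi R)) V).hom ≫
        (bimodFunctor R).map (leftUnitor V).hom :=
  GrBimod.hom_ext (GrBimod.bt_ext_unit_left fun z m => LinearMap.congr_fun
    (f := (GrBimod.leftUnitor V.toGrBimod).hom.toLin ∘ₗ
      GrBimod.bt (GrBimod.unit K) V.toGrBimod (Finsupp.single z 1))
    (g := (GrBimod.tensorMap (epsIso R).hom (𝟙 V.toGrBimod) ≫ (muIso (trivial (Xi R)) V).hom ≫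
        (bimodFunctor R).map (leftUnitor V).hom).toLin ∘ₗ
      GrBimod.bt (GrBimod.unit K) V.toGrBimod (Finsupp.single z 1))
    (gen_ext fun r v y hv => by
      have e₁ := GrBimod.leftUnitor_bt V.toGrBimod z (gen V y v)
      have e₂ : (GrBimod.tensorMap (epsIso R).hom (𝟙 V.toGrBimod)).toLin
          (GrBimod.bt (GrBimod.unit K) V.toGrBimod (Finsupp.single z 1) (gen V y v)) =
          GrBimod.bt (trivial (Xi R)).toGrBimod V.toGrBimod (gen (trivial (Xi R)) z (triv R))
            (gen V y v) :=
        GrBimod.tensorMap_bt (epsIso R).hom (𝟙 V.toGrBimod) (Finsupp.single z 1) (gen V y v)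
      rw [bt_gen_left, left_gen z hv] at e₂
      have e₃ := mu_bt triv_mem_grade (grp_mem_grade hv z) (R.ract z r * y)
      rw [(R.e_dot_tau _).2, one_mul] at e₃
      rw [left_gen z hv] at e₁
      change (GrBimod.leftUnitor V.toGrBimod).hom.toLin
          (GrBimod.bt (GrBimod.unit K) V.toGrBimod (Finsupp.single z 1) (gen V y v)) =
        ((bimodFunctor R).map (leftUnitor V).hom).toLin ((muIso (trivial (Xi R)) V).hom.toLin
          ((GrBimod.tensorMap (epsIso R).hom (𝟙 V.toGrBimod)).toLin
            (GrBimod.bt (GrBimod.unit K) V.toGrBimod (Finsupp.single z 1) (gen V y v))))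
      rw [e₂]
      refine e₁.trans (Eq.trans ?_
        (congrArg ((bimodFunctor R).map (leftUnitor V).hom).toLin e₃).symm)
      rw [map_gen, leftUnitor_tmul]) m)

/-- Nothing has to cross here, and $\tau(r,e)=1$. -/
theorem mu_rightUnitor (V : AlgMod.{u, u} (Xi R)) :
    (GrBimod.rightUnitor V.toGrBimod).hom =
      GrBimod.tensorMap (𝟙 V.toGrBimod) (epsIso R).hom ≫ (muIso V (trivial (Xi R))).hom ≫
        (bimodFunctor R).map (rightUnitor V).hom :=
  GrBimod.hom_ext (bt_gen_ext_left fun r v m hv => LinearMap.congr_fun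
    (f := (GrBimod.rightUnitor V.toGrBimod).hom.toLin ∘ₗ
      GrBimod.bt V.toGrBimod (GrBimod.unit K) (gen V 1 v))
    (g := (GrBimod.tensorMap (𝟙 V.toGrBimod) (epsIso R).hom ≫ (muIso V (trivial (Xi R))).hom ≫
        (bimodFunctor R).map (rightUnitor V).hom).toLin ∘ₗ
      GrBimod.bt V.toGrBimod (GrBimod.unit K) (gen V 1 v))
    (GrBimod.unit_ext fun z => by
      have e₁ := GrBimod.rightUnitor_bt V.toGrBimod z (gen V 1 v)
      have e₂ : (GrBimod.tensorMap (𝟙 V.toGrBimod) (epsIso R).hom).toLin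
          (GrBimod.bt V.toGrBimod (GrBimod.unit K) (gen V 1 v) (Finsupp.single z 1)) =
          GrBimod.bt V.toGrBimod (trivial (Xi R)).toGrBimod (gen V 1 v)
            (gen (trivial (Xi R)) z (triv R)) :=
        GrBimod.tensorMap_bt (𝟙 V.toGrBimod) (epsIso R).hom (gen V 1 v) (Finsupp.single z 1)
      have e₃ := mu_bt hv triv_mem_grade z
      rw [(R.dot_tau_e _).2, one_mul] at e₃
      rw [right_gen, one_mul] at e₁
      change (GrBimod.rightUnitor V.toGrBimod).hom.toLin
          (GrBimod.bt V.toGrBimod (GrBimod.unit K) (gen V 1 v) (Finsupp.single z 1)) =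
        ((bimodFunctor R).map (rightUnitor V).hom).toLin ((muIso V (trivial (Xi R))).hom.toLin
          ((GrBimod.tensorMap (𝟙 V.toGrBimod) (epsIso R).hom).toLin
            (GrBimod.bt V.toGrBimod (GrBimod.unit K) (gen V 1 v) (Finsupp.single z 1))))
      rw [e₂]
      refine e₁.trans (Eq.trans ?_
        (congrArg ((bimodFunctor R).map (rightUnitor V).hom).toLin e₃).symm)
      rw [map_gen, rightUnitor_tmul]) m)

end AlgMod

section

variable {G : Type u} [Group G] [Finite G] {K : Subgroup G} (R : Transversal K)

attribute [local instance] Xi.quasiBialgebra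

/-- The functor from `Ξ(R,K)`-modules to graded bimodules is strong monoidal. -/
def bimodFunctorCoreMonoidal : (bimodFunctor.{u, u} R).CoreMonoidal where
  εIso := AlgMod.epsIso R
  μIso := AlgMod.muIso
  μIso_hom_natural_left f X := by
    -- Whiskering is the tensor product with an identity, and $F$ preserves identities.
    refine Eq.trans ?_ (AlgMod.mu_natural f (𝟙 X))
    rw [(bimodFunctor R).map_id]
    rfl
  μIso_hom_natural_right X f := by
    refine Eq.trans ?_ (AlgMod.mu_natural (𝟙 X) f)
    rw [(bimodFunctor R).map_id]
    rfl
  associativity := AlgMod.mu_assoc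
  left_unitality := AlgMod.mu_leftUnitor
  right_unitality := AlgMod.mu_rightUnitor

end

end

/-! ### The main theorem -/

open Classical in
theorem mainTheorem4 {G : Type u} [Group G] [Finite G] (K : Subgroup G) (R : Transversal K) :
    (bimodFunctor.{u, u} R).IsEquivalence ∧
    ∃ Q : QuasiBialgebra (Xi R),
      (∀ x : K, Q.comul (Xi.grp R x) =
        ∑ s, (Xi.grp R x * Xi.delta R s) ⊗ₜ[ℂ] Xi.grp R (R.ract x s)) ∧
      (∀ r : R.carrier, Q.comul (Xi.delta R r) =
        ∑ s, ∑ t, if R.dot s t = r then Xi.delta R s ⊗ₜ[ℂ] Xi.delta R t else 0) ∧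
      (∀ x : K, Q.counit (Xi.grp R x) = 1) ∧
      (∀ r : R.carrier, Q.counit (Xi.delta R r) = if r = R.e then 1 else 0) ∧
      (Q.assoc : Xi R ⊗[ℂ] (Xi R ⊗[ℂ] Xi R)) =
        ∑ r, ∑ s, Xi.delta R r ⊗ₜ[ℂ] (Xi.delta R s ⊗ₜ[ℂ] Xi.grp R (R.tau r s)⁻¹) ∧
      ((Q.assoc⁻¹ : (Xi R ⊗[ℂ] (Xi R ⊗[ℂ] Xi R))ˣ) : Xi R ⊗[ℂ] (Xi R ⊗[ℂ] Xi R)) =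
        ∑ r, ∑ s, Xi.delta R r ⊗ₜ[ℂ] (Xi.delta R s ⊗ₜ[ℂ] Xi.grp R (R.tau r s)) ∧
      ∃ M : (bimodFunctor.{u, u} R).Monoidal,
        ∀ (V V' : AlgMod.{u, u} (Xi R)) (r s : R.carrier) (v : V.carrier) (v' : V'.carrier) (z : K),
          v ∈ V.grade r → v' ∈ V'.grade s →
          (M.μ V V').toLin (GrBimod.bt V.toGrBimod V'.toGrBimod
              (v ⊗ₜ[ℂ] Finsupp.single (1 : K) (1 : ℂ)) (v' ⊗ₜ[ℂ] Finsupp.single z (1 : ℂ))) =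
            ((v ⊗ₜ[ℂ] v') ⊗ₜ[ℂ] Finsupp.single (R.tau r s * z) (1 : ℂ) :
              (V.carrier ⊗[ℂ] V'.carrier) ⊗[ℂ] (K →₀ ℂ)) := by
  refine ⟨bimodFunctor_isEquivalence R, Xi.quasiBialgebra R, Xi.comul_grp, Xi.comul_delta,
    Xi.counit_grp, Xi.counit_delta, rfl, rfl,
    -- The tensor product of $\Xi(R,K)$-modules depends on the quasi-bialgebra structure, so the
    -- witness just given for it is the one that must be in force here.
    letI := Xi.quasiBialgebra R; (bimodFunctorCoreMonoidal R).toMonoidal,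
    fun V V' r s v v' z hv hv' => ?_⟩
  let := Xi.quasiBialgebra R
  exact AlgMod.mu_bt hv hv' z
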